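/- Let $n\ge 1$ and $1\le k<d$ be integers and let $P=(p_1,\dots,p_n)$ be points of $\mathbb{R}^d$. Let $$\mathcal D=\{(X,y)\in\mathbb{R}^{d\times d}\times\mathbb{R}^n : X^T=X,\ \operatorname{tr}X=d-k,\ 0\prec X\prec I_d,\ \|Xp_i\|_2<y_i\ (1\le i\le n)\},$$ and for $t>0$ let $G_t:\mathcal D\to\mathbb{R}$, $$G_t(X,y)=t\sum_{i=1}^n y_i-\sum_{i=1}^n\ln\bigl(y_i^2-\|Xp_i\|_2^2\bigr)-\ln\det X-\ln\det(I_d-X).$$ For $z\in\mathcal D$ the Newton decrement is $\lambda(G_t,z)=\sqrt{\nabla G_t(z)^T(\nabla^2G_t(z))^{-1}\nabla G_t(z)}$, where the gradient and the Hessian are those of $G_t$ as a function on the affine subspace $\{X^T=X,\ \operatorname{tr}X=d-k\}$. Put $$X_0=\tfrac{d-k}{d}I_d,\qquad (y_0)_i=\sqrt{\|X_0p_i\|_2^2+e},\qquad t_0=\frac{2n}{\sum_{i=1}^n (y_0)_i}.$$ (a) $(X_0,y_0)\in\mathcal D$, the function $G_{t_0}$ is bounded below on $\mathcal D$, and if $t_0>1$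 then $$G_{t_0}(X_0,y_0)-\inf_{\mathcal D}G_{t_0}\le 2n+4d\ln d .$$ (b) Consider the real RAM: a random access machine with memory cells for natural numbers and for real numbers, which performs the operations $+,-,\cdot$ on natural numbers, the operations $+,-,\cdot,/,\sqrt{\ }$ on reals, comparisons, indirect reads and writes, the conversion of a natural number to a real, and the use of the constant $e$, exactly and at unit cost. Let $\omega$ be a real number such that invertible real $m\times m$ matrices can be inverted on this machine in $O(m^\omega)$ time (by one program for all $m\ge1$, whatever the initial contents of its working memory). Then there is one program that, given any $n\ge1$, any $1\le k<d$ and any $P\in(\mathbb{R}^d)^n$ (whatever the initial contents of the other cells), computes a pair $(X_{t_0},y_{t_0})\in\mathcal D$ with $$\lambda\bigl(G_{t_0},(X_{t_0},y_{t_0})\bigr)\le 0.01$$ in time $O\bigl((n+d^2)^\omega\,(n+d\log d)\bigr)$; the constant in the $O$ does not depend on $n$, $d$, $k$ or $P$. -/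

import Mathlib

open scoped Gradient

noncomputable section

namespace KSM

/-! ### The barrier problem -/

/-- The Euclidean space `ℝ^{d×d} × ℝ^n` of pairs `(X, y)`, with `X` stored entrywise. -/
abbrev Point (n d : ℕ) : Type := EuclideanSpace ℝ ((Fin d × Fin d) ⊕ Fin n)

/-- The matrix component `X` of `z = (X, y)`. -/
def Point.X {n d : ℕ} (z : Point n d) : Matrix (Fin d) (Fin d) ℝ :=
  Matrix.of fun i j => z (Sum.inl (i, j))

/-- The vector component `y` of `z = (X, y)`. -/
def Point.y {n d : ℕ} (z : Point n d) (i : Fin n) : ℝ := z (Sum.inr i)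

/-- The pair `(X, y)` as a point of the Euclidean space. -/
def mkPoint {n d : ℕ} (X : Matrix (Fin d) (Fin d) ℝ) (y : Fin n → ℝ) : Point n d :=
  WithLp.toLp 2 (Sum.elim (fun ij => X ij.1 ij.2) y)

/-- The vector `X p`, in Euclidean `ℝ^d`. -/
def applyTo {d : ℕ} (X : Matrix (Fin d) (Fin d) ℝ) (p : EuclideanSpace ℝ (Fin d)) :
    EuclideanSpace ℝ (Fin d) :=
  Matrix.toEuclideanLin X p

/-- The domain `𝒟(G)`: `X` symmetric, `tr X = d - k`, `0 ≺ X ≺ I`, `‖X p_i‖ < y_i` for all `i`.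
(`Matrix.PosDef` includes symmetry.) -/
def domain {n d : ℕ} (k : ℕ) (P : Fin n → EuclideanSpace ℝ (Fin d)) : Set (Point n d) :=
  {z | z.X.PosDef ∧ (1 - z.X).PosDef ∧ z.X.trace = (d : ℝ) - (k : ℝ) ∧
    ∀ i, ‖applyTo z.X (P i)‖ < z.y i}

/-- The directions of the affine hull of the domain: `Xᵀ = X` and `tr X = 0`. -/
def tangent (n d : ℕ) : Submodule ℝ (Point n d) where
  carrier := {z | (∀ i j, z.X i j = z.X j i) ∧ z.X.trace = 0}
  zero_mem' := by
    simp [Point.X, Matrix.trace]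
  add_mem' := by
    rintro a b ⟨ha, ha'⟩ ⟨hb, hb'⟩
    refine ⟨fun i j => ?_, ?_⟩
    · have h1 := ha i j
      have h2 := hb i j
      simp only [Point.X, Matrix.of_apply] at h1 h2
      simp [Point.X, h1, h2]
    · simp only [Point.X, Matrix.trace, Matrix.diag_apply, Matrix.of_apply] at ha' hb'
      simp [Point.X, Matrix.trace, Finset.sum_add_distrib, ha', hb']
  smul_mem' := by
    rintro c a ⟨ha, ha'⟩
    refine ⟨fun i j => ?_, ?_⟩
    · have h1 := ha i j
      simp only [Point.X, Matrix.of_apply] at h1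
      simp [Point.X, h1]
    · simp only [Point.X, Matrix.trace, Matrix.diag_apply, Matrix.of_apply] at ha'
      simp [Point.X, Matrix.trace, ← Finset.mul_sum, ha']

/-- The `t`-relaxation
`G_t(X,y) = t 1ᵀy - ∑ ln(y_i² - ‖X p_i‖²) - ln det X - ln det (I - X)`. -/
def relaxation {n d : ℕ} (P : Fin n → EuclideanSpace ℝ (Fin d)) (t : ℝ) (z : Point n d) : ℝ :=
  t * ∑ i, z.y i - ∑ i, Real.log (z.y i ^ 2 - ‖applyTo z.X (P i)‖ ^ 2)
    - Real.log z.X.det - Real.log (1 - z.X).det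

/-- The Newton decrement `√(∇φᵀ (∇²φ)⁻¹ ∇φ)` at `x` of a function `φ` on the affine subspace
`x + V`; the gradient and the Hessian are those of `φ` along `V`. -/
def newtonDecrement {E : Type*} [NormedAddCommGroup E] [InnerProductSpace ℝ E]
    [FiniteDimensional ℝ E] (V : Submodule ℝ E) (φ : E → ℝ) (x : E) : ℝ :=
  haveI : CompleteSpace V := FiniteDimensional.complete ℝ V
  let ψ : V → ℝ := fun v => φ (x + v)
  let hessian : V →L[ℝ] V := fderiv ℝ (fun v => ∇ ψ v) 0
  Real.sqrt (inner ℝ (∇ ψ 0) (hessian.inverse (∇ ψ 0)))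

/-- `λ(G_t, z)`. -/
def decrement {n d : ℕ} (P : Fin n → EuclideanSpace ℝ (Fin d)) (t : ℝ) (z : Point n d) : ℝ :=
  newtonDecrement (tangent n d) (relaxation P t) z

/-- `X₀ = ((d-k)/d) I`. -/
def X0 (d k : ℕ) : Matrix (Fin d) (Fin d) ℝ :=
  (((d : ℝ) - (k : ℝ)) / (d : ℝ)) • (1 : Matrix (Fin d) (Fin d) ℝ)

/-- `(y₀)_i = √(‖X₀ p_i‖² + e)`. -/
def y0 {n d : ℕ} (k : ℕ) (P : Fin n → EuclideanSpace ℝ (Fin d)) (i : Fin n) : ℝ :=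
  Real.sqrt (‖applyTo (X0 d k) (P i)‖ ^ 2 + Real.exp 1)

/-- `(X₀, y₀)`. -/
def initialPoint {n d : ℕ} (k : ℕ) (P : Fin n → EuclideanSpace ℝ (Fin d)) : Point n d :=
  mkPoint (X0 d k) (y0 k P)

/-- `t₀ = 2n / ∑ (y₀)_i`. -/
def t0 {n d : ℕ} (k : ℕ) (P : Fin n → EuclideanSpace ℝ (Fin d)) : ℝ :=
  2 * (n : ℝ) / ∑ i, y0 k P i

/-! ### The real RAM

Unit-cost random access machine with exact real arithmetic, programmed in a structured language.
Memory consists of arrays of natural numbers and arrays of reals; the name of an array is a fixed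
number in the program text, the index into it is computed at run time. A scalar variable is a cell
with a constant index. -/

/-- A memory: `nat b i` and `real b i` are the cells with index `i` of the arrays named `b`. -/
structure Memory where
  /-- the arrays of natural numbers -/
  nat : ℕ → ℕ → ℕ
  /-- the arrays of real numbers -/
  real : ℕ → ℕ → ℝ

/-- Expressions for natural numbers. -/
inductive NExp where
  | lit (c : ℕ)
  | get (b : ℕ) (i : NExp)
  | add (u v : NExp)
  | sub (u v : NExp)
  | mul (u v : NExp)

/-- Expressions for real numbers; the constants are the natural numbers and Euler's number. -/
inductive RExp where
  | ofNat (u : NExp)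
  | euler
  | get (b : ℕ) (i : NExp)
  | add (u v : RExp)
  | sub (u v : RExp)
  | mul (u v : RExp)
  | div (u v : RExp)
  | sqrt (u : RExp)

/-- Tests. -/
inductive Test where
  | natLt (u v : NExp)
  | realLt (u v : RExp)

/-- Programs. -/
inductive Prog where
  | skip
  | setNat (b : ℕ) (i u : NExp)
  | setReal (b : ℕ) (i : NExp) (u : RExp)
  | seq (p q : Prog)
  | ite (c : Test) (p q : Prog)
  | while (c : Test) (p : Prog)

/-- Value of an expression; subtraction of natural numbers is truncated at `0`. -/
def NExp.eval (s : Memory) : NExp → ℕ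
  | .lit c => c
  | .get b i => s.nat b (i.eval s)
  | .add u v => u.eval s + v.eval s
  | .sub u v => u.eval s - v.eval s
  | .mul u v => u.eval s * v.eval s

/-- Number of operations in an expression. -/
def NExp.cost : NExp → ℕ
  | .lit _ => 1
  | .get _ i => i.cost + 1
  | .add u v => u.cost + v.cost + 1
  | .sub u v => u.cost + v.cost + 1
  | .mul u v => u.cost + v.cost + 1

/-- Value of an expression; division by zero and the root of a negative number give `0`. -/
def RExp.eval (s : Memory) : RExp → ℝ
  | .ofNat u => (u.eval s : ℝ)
  | .euler => Real.exp 1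
  | .get b i => s.real b (i.eval s)
  | .add u v => u.eval s + v.eval s
  | .sub u v => u.eval s - v.eval s
  | .mul u v => u.eval s * v.eval s
  | .div u v => u.eval s / v.eval s
  | .sqrt u => Real.sqrt (u.eval s)

/-- Number of operations in an expression. -/
def RExp.cost : RExp → ℕ
  | .ofNat u => u.cost + 1
  | .euler => 1
  | .get _ i => i.cost + 1
  | .add u v => u.cost + v.cost + 1
  | .sub u v => u.cost + v.cost + 1
  | .mul u v => u.cost + v.cost + 1
  | .div u v => u.cost + v.cost + 1
  | .sqrt u => u.cost + 1

/-- The test succeeds. -/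
def Test.Holds (s : Memory) : Test → Prop
  | .natLt u v => u.eval s < v.eval s
  | .realLt u v => u.eval s < v.eval s

/-- Number of operations in a test. -/
def Test.cost : Test → ℕ
  | .natLt u v => u.cost + v.cost + 1
  | .realLt u v => u.cost + v.cost + 1

/-- Write `x` into the cell with index `i` of the array `b` of natural numbers. -/
def Memory.writeNat (s : Memory) (b i x : ℕ) : Memory :=
  { s with nat := Function.update s.nat b (Function.update (s.nat b) i x) }

/-- Write `x` into the cell with index `i` of the array `b` of real numbers. -/
def Memory.writeReal (s : Memory) (b i : ℕ) (x : ℝ) : Memory :=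
  { s with real := Function.update s.real b (Function.update (s.real b) i x) }

/-- `Exec p s s' τ`: the program `p`, started in the memory `s`, halts in the memory `s'` after
`τ` elementary operations. -/
inductive Exec : Prog → Memory → Memory → ℕ → Prop where
  | skip (s : Memory) : Exec .skip s s 1
  | setNat (s : Memory) (b : ℕ) (i u : NExp) :
      Exec (.setNat b i u) s (s.writeNat b (i.eval s) (u.eval s)) (i.cost + u.cost + 1)
  | setReal (s : Memory) (b : ℕ) (i : NExp) (u : RExp) :
      Exec (.setReal b i u) s (s.writeReal b (i.eval s) (u.eval s)) (i.cost + u.cost + 1)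
  | seq {p q : Prog} {s s' s'' : Memory} {τ τ' : ℕ} :
      Exec p s s' τ → Exec q s' s'' τ' → Exec (.seq p q) s s'' (τ + τ')
  | iteTrue {c : Test} {p q : Prog} {s s' : Memory} {τ : ℕ} :
      c.Holds s → Exec p s s' τ → Exec (.ite c p q) s s' (c.cost + τ)
  | iteFalse {c : Test} {p q : Prog} {s s' : Memory} {τ : ℕ} :
      ¬ c.Holds s → Exec q s s' τ → Exec (.ite c p q) s s' (c.cost + τ)
  | whileTrue {c : Test} {p : Prog} {s s' s'' : Memory} {τ τ' : ℕ} :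
      c.Holds s → Exec p s s' τ → Exec (.while c p) s' s'' τ' →
      Exec (.while c p) s s'' (c.cost + τ + τ')
  | whileFalse {c : Test} {p : Prog} {s : Memory} :
      ¬ c.Holds s → Exec (.while c p) s s c.cost

/-- Real `m × m` matrices can be inverted in `O(m^ω)` time: one program, given `m` and an
invertible matrix `A` (row by row in the real array `0`), writes `A⁻¹` (row by row) into the real
array `1`. As for every subroutine, the contents of all other cells at the start are arbitrary. -/
def InversionTime (ω : ℝ) : Prop :=
  ∃ (inv : Prog) (C : ℝ), ∀ (m : ℕ), 1 ≤ m → ∀ A : Matrix (Fin m) (Fin m) ℝ, IsUnit A.det →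
    ∀ s : Memory, s.nat 0 0 = m → (∀ i j : Fin m, s.real 0 (i * m + j) = A i j) →
      ∃ (s' : Memory) (τ : ℕ), Exec inv s s' τ ∧ (τ : ℝ) ≤ C * (m : ℝ) ^ ω ∧
        ∀ i j : Fin m, s'.real 1 (i * m + j) = A⁻¹ i j

/-- The memory holds the input: `n, d, k` in the array `0` of natural numbers, and the coordinates
of `p_1, …, p_n`, point by point, in the real array `0`. All other cells are arbitrary. -/
def HoldsInput {n d : ℕ} (s : Memory) (k : ℕ) (P : Fin n → EuclideanSpace ℝ (Fin d)) : Prop :=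
  s.nat 0 0 = n ∧ s.nat 0 1 = d ∧ s.nat 0 2 = k ∧
    ∀ (i : Fin n) (j : Fin d), s.real 0 (i * d + j) = P i j

/-- The memory holds the output `(X, y)`: `X` row by row in the real array `1`, and `y` in the real
array `2`. -/
def HoldsOutput {n d : ℕ} (s : Memory) (z : Point n d) : Prop :=
  (∀ i j : Fin d, s.real 1 (i * d + j) = z.X i j) ∧ ∀ i : Fin n, s.real 2 i = z.y i

end KSM

end

/-!
Along a line, the logarithmic terms of `-G_t` change by a sum `∑ log (1 + s μ_j)` with `∑ μ_j² =
∇²G_t(v, v)`, the `μ_j` coming from eigenvalues for the determinants and from the roots of a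
quadratic polynomial for each cone. Since `log (1 + x) ≥ x - x²` for `|x| ≤ 1 / 2`, a damped Newton
step stays in the domain and decreases `G_t` by a fixed amount as long as the Newton decrement
exceeds `1 / 100`. The barrier is at least `2n + 2n ln (t / 2)` everywhere, whereas over `X₀` its
value exceeds this bound by `O(n + d ln d)`; hence `O(n + d ln d)` steps suffice.

A Newton step is read off the inverse of the KKT matrix of the quadratic model, a matrix of order
`m = d² + 2n + 2`, in which the rank-one parts of the Hessian are split off by one auxiliary unknown
per point. The remaining work per step is `O(m²)`, and inversion itself costs at least `m²` because
it has to write that many cells of memory.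
-/

noncomputable section

namespace KSM

section Matrices

open scoped ComplexOrder Matrix

variable {ι 𝕜 : Type*} [Fintype ι] [RCLike 𝕜]

open scoped MatrixOrder Matrix.Norms.L2Operator in
theorem exists_isUnit_mul_conjTranspose [DecidableEq ι] {X : Matrix ι ι 𝕜} (hX : X.PosDef) :
    ∃ R : Matrix ι ι 𝕜, IsUnit R ∧ X = R * Rᴴ :=
  CStarAlgebra.isStrictlyPositive_iff_eq_mul_star_self.1 hX.isStrictlyPositive

theorem exists_congruence_diagonal [DecidableEq ι] {X U : Matrix ι ι 𝕜} (hX : X.PosDef)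
    (hU : U.IsHermitian) :
    ∃ (R : Matrix ι ι 𝕜) (μ : ι → ℝ), IsUnit R ∧ X = R * Rᴴ ∧
      U = R * Matrix.diagonal (fun j => (μ j : 𝕜)) * Rᴴ := by
  obtain ⟨A, hA, rfl⟩ := exists_isUnit_mul_conjTranspose hX
  have hA₁ : A * A⁻¹ = 1 := Matrix.mul_nonsing_inv _ ((Matrix.isUnit_iff_isUnit_det _).1 hA)
  have hA₂ : A⁻¹ᴴ * Aᴴ = 1 := by rw [← Matrix.conjTranspose_mul, hA₁, Matrix.conjTranspose_one]
  have hW : (A⁻¹ * U * A⁻¹ᴴ).IsHermitian := Matrix.isHermitian_mul_mul_conjTranspose _ hU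
  let Z : Matrix ι ι 𝕜 := hW.eigenvectorUnitary
  have hZ : Z * Zᴴ = 1 := Unitary.mul_star_self_of_mem hW.eigenvectorUnitary.2
  refine ⟨A * Z, hW.eigenvalues, hA.mul (Unitary.toUnits hW.eigenvectorUnitary).isUnit, ?_, ?_⟩
  · calc A * Aᴴ = A * (Z * Zᴴ) * Aᴴ := by rw [hZ, Matrix.mul_one]
      _ = A * Z * (A * Z)ᴴ := by simp only [Matrix.conjTranspose_mul, Matrix.mul_assoc]
  · calc U = A * A⁻¹ * U * (A⁻¹ᴴ * Aᴴ) := by rw [hA₁, hA₂, Matrix.one_mul, Matrix.mul_one]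
      _ = A * (A⁻¹ * U * A⁻¹ᴴ) * Aᴴ := by simp only [Matrix.mul_assoc]
      _ = A * (Z * Matrix.diagonal (fun j => (hW.eigenvalues j : 𝕜)) * Zᴴ) * Aᴴ :=
          congrArg (A * · * Aᴴ) hW.spectral_theorem
      _ = _ := by simp only [Matrix.conjTranspose_mul, Matrix.mul_assoc]

theorem trace_conjTranspose_mul_mul_mul_nonneg {S : Matrix ι ι 𝕜} (hS : S.PosDef)
    (U : Matrix ι ι 𝕜) : 0 ≤ (Uᴴ * S * U * S).trace := by
  classical
  obtain ⟨R, -, hR⟩ := exists_isUnit_mul_conjTranspose hS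
  have h : (Uᴴ * S * U * S).trace = (Rᴴ * (Uᴴ * S * U) * R).trace := by
    conv_lhs => enter [1, 2]; rw [hR]
    rw [← Matrix.mul_assoc, Matrix.trace_mul_comm]
    simp only [Matrix.mul_assoc]
  exact h ▸ ((hS.posSemidef.conjTranspose_mul_mul_same U).conjTranspose_mul_mul_same R).trace_nonneg

theorem eq_zero_of_trace_conjTranspose_mul_mul_mul_eq_zero {S : Matrix ι ι 𝕜} (hS : S.PosDef)
    {U : Matrix ι ι 𝕜} (hU : (Uᴴ * S * U * S).trace = 0) : U = 0 := by
  classical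
  obtain ⟨R, hR, rfl⟩ := exists_isUnit_mul_conjTranspose hS
  have hR' : IsUnit Rᴴ := (Matrix.isUnit_conjTranspose R).2 hR
  have h : (Uᴴ * (R * Rᴴ) * U * (R * Rᴴ)).trace = ((Rᴴ * U * R)ᴴ * (Rᴴ * U * R)).trace := by
    rw [← Matrix.mul_assoc, Matrix.trace_mul_comm]
    simp only [Matrix.mul_assoc, Matrix.conjTranspose_mul, Matrix.conjTranspose_conjTranspose]
  rw [h, Matrix.trace_conjTranspose_mul_self_eq_zero_iff] at hU
  exact hR'.mul_right_eq_zero.1 (hR.mul_left_eq_zero.1 hU)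

theorem det_le_one_of_posSemidef_one_sub [DecidableEq ι] {X : Matrix ι ι 𝕜} (hX : X.PosSemidef)
    (hX' : (1 - X).PosSemidef) : X.det ≤ 1 := by
  rw [hX.1.det_eq_prod_eigenvalues, ← RCLike.ofReal_prod, ← RCLike.ofReal_one,
    RCLike.ofReal_le_ofReal]
  refine Finset.prod_le_one (fun i _ => hX.eigenvalues_nonneg i) fun i _ => ?_
  have h := hX'.re_dotProduct_nonneg (hX.1.eigenvectorBasis i)
  have hone : RCLike.re (star (hX.1.eigenvectorBasis i).ofLp ⬝ᵥ hX.1.eigenvectorBasis i) = 1 := by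
    rw [← dotProduct_comm, ← EuclideanSpace.inner_eq_star_dotProduct,
      inner_self_eq_norm_sq_to_K, hX.1.eigenvectorBasis.orthonormal.1 i]
    simp
  rw [Matrix.sub_mulVec, Matrix.one_mulVec, dotProduct_sub, map_sub, hone,
    ← hX.1.eigenvalues_eq i] at h
  linarith

end Matrices

section LogFactors

open Filter Topology

variable {ι κ : Type*}

theorem eventually_forall_one_add_mul_pos [Finite ι] (μ : ι → ℝ) :
    ∀ᶠ s in 𝓝 (0 : ℝ), ∀ j, 0 < 1 + s * μ j :=
  eventually_all.2 fun j =>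
    (show ContinuousAt (fun s : ℝ => 1 + s * μ j) 0 by fun_prop).eventually_const_lt (by simp)

theorem hasDerivAt_one_add_mul (m s : ℝ) : HasDerivAt (fun s : ℝ => 1 + s * m) m s := by
  simpa using ((hasDerivAt_id s).mul_const m).const_add 1

variable [Fintype ι] [Fintype κ]

/-- The function `F` of a real parameter `s` is `F 0 + ∑ j, log (1 + s μ j)`, and `s` stays in the
set `D`, as long as all the factors `1 + s μ j` are positive. This is how the logarithmic barriers
behave along a line, with `D` the parameters of the points of the domain. -/
def HasLogFactors (D : Set ℝ) (F : ℝ → ℝ) (μ : ι → ℝ) : Prop :=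
  ∀ s : ℝ, (∀ j, 0 < 1 + s * μ j) → s ∈ D ∧ F s = F 0 + ∑ j, Real.log (1 + s * μ j)

theorem HasLogFactors.add {D D' : Set ℝ} {F F' : ℝ → ℝ} {μ : ι → ℝ} {μ' : κ → ℝ}
    (h : HasLogFactors D F μ) (h' : HasLogFactors D' F' μ') :
    HasLogFactors (D ∩ D') (fun s => F s + F' s) (Sum.elim μ μ') := by
  intro s hs
  obtain ⟨hD, hF⟩ := h s fun j => hs (.inl j)
  obtain ⟨hD', hF'⟩ := h' s fun j => hs (.inr j)
  refine ⟨⟨hD, hD'⟩, ?_⟩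
  simp only [hF, hF', Fintype.sum_sum_type, Sum.elim_inl, Sum.elim_inr]
  ring

theorem HasLogFactors.sum {D : κ → Set ℝ} {F : κ → ℝ → ℝ} {μ : κ → ι → ℝ}
    (h : ∀ i, HasLogFactors (D i) (F i) (μ i)) :
    HasLogFactors (⋂ i, D i) (fun s => ∑ i, F i s) fun p : κ × ι => μ p.1 p.2 := by
  intro s hs
  have hi : ∀ i, _ := fun i => h i s fun j => hs (i, j)
  refine ⟨Set.mem_iInter.2 fun i => (hi i).1, ?_⟩
  simp only [fun i => (hi i).2, Finset.sum_add_distrib, Fintype.sum_prod_type]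

theorem hasDerivAt_sum_log_one_add_mul {μ : ι → ℝ} {s : ℝ} (hs : ∀ j, 0 < 1 + s * μ j) :
    HasDerivAt (fun s => ∑ j, Real.log (1 + s * μ j)) (∑ j, μ j / (1 + s * μ j)) s :=
  HasDerivAt.fun_sum fun j _ => (hasDerivAt_one_add_mul (μ j) s).log (hs j).ne'

theorem hasDerivAt_sum_div_one_add_mul (μ : ι → ℝ) :
    HasDerivAt (fun s => ∑ j, μ j / (1 + s * μ j)) (-∑ j, μ j ^ 2) 0 := by
  rw [← Finset.sum_neg_distrib]
  refine HasDerivAt.fun_sum fun j _ => ?_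
  simpa [sq] using
    (hasDerivAt_const (0 : ℝ) (μ j)).fun_div (hasDerivAt_one_add_mul (μ j) 0) (by simp)

theorem sub_sq_le_log_one_add {x : ℝ} (hx : |x| ≤ 1 / 2) : x - x ^ 2 ≤ Real.log (1 + x) := by
  have hpos : 0 < 1 + x := by linarith [(abs_le.1 hx).1]
  have hcast : Complex.log (1 + (x : ℂ)) - x = ((Real.log (1 + x) - x : ℝ) : ℂ) := by
    rw [Complex.ofReal_sub, Complex.ofReal_log hpos.le, Complex.ofReal_add, Complex.ofReal_one]
  have hlog := Complex.norm_log_one_add_sub_self_le (z := (x : ℂ))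
    (by rw [Complex.norm_real, Real.norm_eq_abs]; linarith)
  rw [hcast, Complex.norm_real, Complex.norm_real, Real.norm_eq_abs, Real.norm_eq_abs, sq_abs]
    at hlog
  have hinv : (1 - |x|)⁻¹ ≤ 2 := by
    rw [inv_le_comm₀ (by linarith) (by norm_num)]
    linarith
  nlinarith [(abs_le.1 hlog).1, sq_nonneg x]

theorem sum_sub_sum_sq_le_sum_log {μ : ι → ℝ} (hμ : ∑ j, μ j ^ 2 ≤ 1 / 4) :
    (∀ j, 0 < 1 + μ j) ∧ ∑ j, μ j - ∑ j, μ j ^ 2 ≤ ∑ j, Real.log (1 + μ j) := by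
  have hle : ∀ j, |μ j| ≤ 1 / 2 := fun j => by
    have hj : μ j ^ 2 ≤ ∑ j, μ j ^ 2 :=
      Finset.single_le_sum (f := fun j => μ j ^ 2) (fun _ _ => sq_nonneg _) (Finset.mem_univ j)
    exact abs_le_of_sq_le_sq (by linarith) (by norm_num)
  refine ⟨fun j => by linarith [(abs_le.1 (hle j)).1], ?_⟩
  rw [← Finset.sum_sub_distrib]
  exact Finset.sum_le_sum fun j _ => sub_sq_le_log_one_add (hle j)

end LogFactors

section LogDet

open scoped Matrix

variable {ι : Type*} [Fintype ι] [DecidableEq ι]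

theorem mul_conjTranspose_add_smul (R : Matrix ι ι ℝ) (μ : ι → ℝ) (s : ℝ) :
    R * Rᴴ + s • (R * Matrix.diagonal μ * Rᴴ) =
      R * Matrix.diagonal (fun j => 1 + s * μ j) * Rᴴ := by
  have h : Matrix.diagonal (fun j => 1 + s * μ j) = 1 + s • Matrix.diagonal μ := by
    rw [← Matrix.diagonal_one, ← Matrix.diagonal_smul, Matrix.diagonal_add]
    rfl
  rw [h, Matrix.mul_add, Matrix.add_mul, Matrix.mul_one, Matrix.mul_smul, Matrix.smul_mul]

theorem hasLogFactors_det_congruence {R : Matrix ι ι ℝ} (hR : IsUnit R) (μ : ι → ℝ) :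
    HasLogFactors {s | (R * Rᴴ + s • (R * Matrix.diagonal μ * Rᴴ)).PosDef}
      (fun s => Real.log (R * Rᴴ + s • (R * Matrix.diagonal μ * Rᴴ)).det) μ := by
  intro s hs
  have hdet : R.det ≠ 0 := ((Matrix.isUnit_iff_isUnit_det _).1 hR).ne_zero
  simp only [mul_conjTranspose_add_smul, Set.mem_ofPred_eq]
  refine ⟨(Matrix.PosDef.diagonal hs).mul_mul_conjTranspose_same
    (Matrix.vecMul_injective_of_isUnit hR), ?_⟩
  simp only [Matrix.det_mul, Matrix.det_diagonal, Matrix.det_conjTranspose, star_trivial, zero_mul,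
    add_zero, Finset.prod_const_one, mul_one]
  rw [← Real.log_prod fun j _ => (hs j).ne', ← Real.log_mul (mul_ne_zero hdet hdet)
    (Finset.prod_pos fun j _ => hs j).ne', mul_right_comm]

theorem exists_hasLogFactors_det {X U : Matrix ι ι ℝ} (hX : X.PosDef) (hU : U.IsSymm) :
    ∃ μ : ι → ℝ,
      HasLogFactors {s | (X + s • U).PosDef} (fun s => Real.log (X + s • U).det) μ ∧
      ∑ j, μ j = (X⁻¹ * U).trace ∧ ∑ j, μ j ^ 2 = (Uᵀ * X⁻¹ * U * X⁻¹).trace := by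
  obtain ⟨R, μ, hR, rfl, hUR⟩ :=
    exists_congruence_diagonal hX ((Matrix.conjTranspose_eq_transpose_of_trivial U).trans hU)
  have hR₁ : R⁻¹ * R = 1 := Matrix.nonsing_inv_mul _ ((Matrix.isUnit_iff_isUnit_det _).1 hR)
  have hR₂ : Rᴴ * Rᴴ⁻¹ = 1 := Matrix.mul_nonsing_inv _
    ((Matrix.isUnit_iff_isUnit_det _).1 ((Matrix.isUnit_conjTranspose R).2 hR))
  have htrace : ∀ ν : ι → ℝ, (Rᴴ⁻¹ * Matrix.diagonal ν * Rᴴ).trace = ∑ j, ν j := fun ν => by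
    rw [Matrix.trace_mul_comm, ← Matrix.mul_assoc, hR₂, Matrix.one_mul, Matrix.trace_diagonal]
  have hXU : (R * Rᴴ)⁻¹ * U = Rᴴ⁻¹ * Matrix.diagonal μ * Rᴴ := by
    calc (R * Rᴴ)⁻¹ * U = Rᴴ⁻¹ * (R⁻¹ * R) * Matrix.diagonal μ * Rᴴ := by
          rw [hUR, Matrix.mul_inv_rev]; simp only [Matrix.mul_assoc]; rfl
      _ = _ := by rw [hR₁, Matrix.mul_one]
  refine ⟨μ, hUR ▸ hasLogFactors_det_congruence hR μ, by rw [hXU, htrace], ?_⟩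
  calc ∑ j, μ j ^ 2 = (Rᴴ⁻¹ * Matrix.diagonal (fun j => μ j ^ 2) * Rᴴ).trace := (htrace _).symm
    _ = ((Rᴴ⁻¹ * Matrix.diagonal μ) * (Rᴴ * Rᴴ⁻¹) * (Matrix.diagonal μ * Rᴴ)).trace := by
        rw [hR₂, Matrix.mul_one, ← Matrix.mul_assoc, Matrix.mul_assoc _ _ (Matrix.diagonal μ),
          Matrix.diagonal_mul_diagonal]
        simp only [sq]
    _ = ((R * Rᴴ)⁻¹ * U * ((R * Rᴴ)⁻¹ * U)).trace := by rw [hXU]; simp only [Matrix.mul_assoc]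
    _ = _ := by
        rw [hU.eq, Matrix.trace_mul_comm, ← Matrix.mul_assoc, Matrix.trace_mul_comm]
        simp only [Matrix.mul_assoc]

end LogDet

section LorentzCone

variable {E : Type*} [NormedAddCommGroup E] [InnerProductSpace ℝ E] {y η : ℝ} {w u : E}

/- With `a = ‖w‖`, `b = ‖u‖`, the two sides differ by at least `(y b - |η| a) ^ 2`. -/
theorem lorentz_reverse_cauchy_schwarz (h : ‖w‖ ≤ y) :
    (y ^ 2 - ‖w‖ ^ 2) * (η ^ 2 - ‖u‖ ^ 2) ≤ (y * η - inner ℝ w u) ^ 2 := by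
  have hq : 0 ≤ y ^ 2 - ‖w‖ ^ 2 := by nlinarith [norm_nonneg w]
  rcases le_total |η| ‖u‖ with hu | hu
  · have hη : η ^ 2 - ‖u‖ ^ 2 ≤ 0 := by nlinarith [sq_abs η, abs_nonneg η]
    exact (mul_nonpos_of_nonneg_of_nonpos hq hη).trans (sq_nonneg _)
  · have hy : 0 ≤ y := (norm_nonneg w).trans h
    have hprod : ‖w‖ * ‖u‖ ≤ y * |η| := mul_le_mul h hu (norm_nonneg u) hy
    have hdiff : y * |η| - ‖w‖ * ‖u‖ ≤ |y * η - inner ℝ w u| := by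
      have := abs_sub_abs_le_abs_sub (y * η) (inner ℝ w u)
      rw [abs_mul, abs_of_nonneg hy] at this
      linarith [abs_real_inner_le_norm w u]
    calc (y ^ 2 - ‖w‖ ^ 2) * (η ^ 2 - ‖u‖ ^ 2) = (y ^ 2 - ‖w‖ ^ 2) * (|η| ^ 2 - ‖u‖ ^ 2) := by
          rw [sq_abs]
      _ ≤ (y * |η| - ‖w‖ * ‖u‖) ^ 2 := by linarith [sq_nonneg (y * ‖u‖ - |η| * ‖w‖)]
      _ ≤ |y * η - inner ℝ w u| ^ 2 := pow_le_pow_left₀ (by linarith) hdiff 2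
      _ = _ := sq_abs _

theorem lorentz_line (s : ℝ) : (y + s * η) ^ 2 - ‖w + s • u‖ ^ 2 =
    (y ^ 2 - ‖w‖ ^ 2) + 2 * s * (y * η - inner ℝ w u) + s ^ 2 * (η ^ 2 - ‖u‖ ^ 2) := by
  rw [norm_add_sq_real, norm_smul, real_inner_smul_right, mul_pow, Real.norm_eq_abs, sq_abs]
  ring

theorem norm_lt_of_lorentz_pos (h : ‖w‖ ≤ y) (hsq : 0 < η ^ 2 - ‖u‖ ^ 2)
    (hinner : 0 < y * η - inner ℝ w u) : ‖u‖ < η := by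
  have hlt : ‖u‖ < |η| := by simpa using sq_lt_sq.1 (sub_pos.1 hsq)
  rcases lt_abs.1 hlt with hη | hη
  · exact hη
  · have := neg_le_of_abs_le (abs_real_inner_le_norm w u)
    nlinarith [norm_nonneg w, norm_nonneg u]

theorem exists_hasLogFactors_lorentz (h : ‖w‖ < y) (η : ℝ) (u : E) :
    ∃ μ : Fin 2 → ℝ,
      HasLogFactors {s | ‖w + s • u‖ < y + s * η}
        (fun s => Real.log ((y + s * η) ^ 2 - ‖w + s • u‖ ^ 2)) μ ∧
      ∑ j, μ j = 2 / (y ^ 2 - ‖w‖ ^ 2) * (y * η - inner ℝ w u) ∧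
      ∑ j, μ j ^ 2 = 4 / (y ^ 2 - ‖w‖ ^ 2) ^ 2 * (y * η - inner ℝ w u) ^ 2 -
        2 / (y ^ 2 - ‖w‖ ^ 2) * (η ^ 2 - ‖u‖ ^ 2) := by
  have hq : 0 < y ^ 2 - ‖w‖ ^ 2 := by nlinarith [norm_nonneg w]
  have hline := lorentz_line (y := y) (η := η) (w := w) (u := u)
  have hmid : ∀ s, y * (y + s * η) - inner ℝ w (w + s • u) =
      (y ^ 2 - ‖w‖ ^ 2) + s * (y * η - inner ℝ w u) := fun s => by
    rw [inner_add_right, real_inner_smul_right, real_inner_self_eq_norm_sq]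
    ring
  have hdisc := lorentz_reverse_cauchy_schwarz (η := η) (u := u) h.le
  generalize y ^ 2 - ‖w‖ ^ 2 = q at *
  generalize y * η - inner ℝ w u = σ at *
  generalize η ^ 2 - ‖u‖ ^ 2 = c at *
  obtain ⟨r, hr⟩ : ∃ r : ℝ, r ^ 2 = σ ^ 2 - q * c := ⟨_, Real.sq_sqrt (by linarith)⟩
  have hfactor : ∀ s, q + 2 * s * σ + s ^ 2 * c =
      q * ((1 + s * ((σ + r) / q)) * (1 + s * ((σ - r) / q))) := fun s => by
    field_simp
    linear_combination s ^ 2 * hr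
  refine ⟨![(σ + r) / q, (σ - r) / q], fun s hs => ?_, ?_, ?_⟩
  · simp only [Fin.forall_fin_two, Matrix.cons_val_zero, Matrix.cons_val_one] at hs
    have hpos := mul_pos hs.1 hs.2
    refine ⟨norm_lt_of_lorentz_pos h.le ?_ ?_, ?_⟩
    · rw [hline, hfactor]
      positivity
    · have : q + s * σ = q * ((1 + s * ((σ + r) / q)) + (1 + s * ((σ - r) / q))) / 2 := by
        field_simp
        ring
      rw [hmid, this]
      exact half_pos (mul_pos hq (add_pos hs.1 hs.2))
    · simp only [hline, hfactor, Fin.sum_univ_two, Matrix.cons_val_zero, Matrix.cons_val_one]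
      rw [Real.log_mul hq.ne' hpos.ne', Real.log_mul hs.1.ne' hs.2.ne']
      simp
  · simp only [Fin.sum_univ_two, Matrix.cons_val_zero, Matrix.cons_val_one]
    ring
  · simp only [Fin.sum_univ_two, Matrix.cons_val_zero, Matrix.cons_val_one]
    field_simp
    linear_combination 2 * hr

end LorentzCone

section Coordinates

variable {n d : ℕ}

@[simp] theorem Point.X_zero : (0 : Point n d).X = 0 := rfl

@[simp] theorem Point.X_add (z v : Point n d) : (z + v).X = z.X + v.X := rfl

@[simp] theorem Point.X_sub (z v : Point n d) : (z - v).X = z.X - v.X := rfl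

@[simp] theorem Point.X_smul (s : ℝ) (v : Point n d) : (s • v).X = s • v.X := rfl

@[simp] theorem Point.y_zero (i : Fin n) : (0 : Point n d).y i = 0 := rfl

@[simp] theorem Point.y_add (z v : Point n d) (i : Fin n) : (z + v).y i = z.y i + v.y i := rfl

@[simp] theorem Point.y_sub (z v : Point n d) (i : Fin n) : (z - v).y i = z.y i - v.y i := rfl

@[simp] theorem Point.y_smul (s : ℝ) (v : Point n d) (i : Fin n) : (s • v).y i = s * v.y i := rfl

@[simp] theorem mkPoint_X (X : Matrix (Fin d) (Fin d) ℝ) (y : Fin n → ℝ) : (mkPoint X y).X = X :=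
  rfl

@[simp] theorem mkPoint_y (X : Matrix (Fin d) (Fin d) ℝ) (y : Fin n → ℝ) (i : Fin n) :
    (mkPoint X y).y i = y i := rfl

theorem Point.ext_components {z v : Point n d} (hX : z.X = v.X) (hy : ∀ i, z.y i = v.y i) :
    z = v := by
  ext (⟨a, b⟩ | i)
  exacts [congrFun₂ hX a b, hy i]

variable (X U : Matrix (Fin d) (Fin d) ℝ) (p : EuclideanSpace ℝ (Fin d))

@[simp] theorem applyTo_add : applyTo (X + U) p = applyTo X p + applyTo U p := by
  simp [applyTo]

@[simp] theorem applyTo_smul (s : ℝ) : applyTo (s • X) p = s • applyTo X p := by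
  simp [applyTo]

@[simp] theorem applyTo_zero : applyTo 0 p = 0 := by
  simp [applyTo]

theorem applyTo_apply (a : Fin d) : applyTo X p a = ∑ b, X a b * p b := by
  simp [applyTo, Matrix.toLpLin_apply, Matrix.mulVec, dotProduct]

theorem mem_tangent {v : Point n d} : v ∈ tangent n d ↔ v.X.IsSymm ∧ v.X.trace = 0 :=
  and_congr_left' ⟨fun h => Matrix.IsSymm.ext fun i j => h j i, fun h i j => h.apply j i⟩

end Coordinates

section Differentials

open scoped Matrix

variable {n d : ℕ} (P : Fin n → EuclideanSpace ℝ (Fin d)) (t : ℝ) (z : Point n d)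

/-- The quantity `y_i² - ‖X p_i‖²`, positive in the interior of the `i`-th Lorentz cone. -/
def residual (i : Fin n) : ℝ := z.y i ^ 2 - ‖applyTo z.X (P i)‖ ^ 2

/-- The symmetric part of a matrix. -/
def symPart (U : Matrix (Fin d) (Fin d) ℝ) : Matrix (Fin d) (Fin d) ℝ :=
  (1 / 2 : ℝ) • (U + Uᵀ)

/-- Half the differential of the `i`-th residual on symmetric directions. Like the forms below it
is extended to all directions so as to be invariant under transposition: the Newton system has one
unknown for every matrix entry. -/
def slope (i : Fin n) : Point n d →ₗ[ℝ] ℝ where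
  toFun v := z.y i * v.y i - inner ℝ (applyTo z.X (P i)) (applyTo (symPart v.X) (P i))
  map_add' u v := by
    simp only [symPart, Point.X_add, Point.y_add, Matrix.transpose_add, applyTo_add, applyTo_smul,
      inner_add_right, real_inner_smul_right]
    ring
  map_smul' s v := by
    simp only [symPart, Point.X_smul, Point.y_smul, Matrix.transpose_smul, applyTo_add,
      applyTo_smul, inner_add_right, real_inner_smul_right, smul_eq_mul, RingHom.id_apply]
    ring

theorem slope_apply (i : Fin n) (v : Point n d) : slope P z i v =
    z.y i * v.y i - inner ℝ (applyTo z.X (P i)) (applyTo (symPart v.X) (P i)) := rfl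

/-- The differential of the relaxation, transposition invariant. -/
def gradForm : Point n d →ₗ[ℝ] ℝ where
  toFun v := t * ∑ i, v.y i - ∑ i, 2 / residual P z i * slope P z i v - (z.X⁻¹ * v.X).trace +
    ((1 - z.X)⁻¹ * v.X).trace
  map_add' u v := by
    simp only [map_add, Point.X_add, Point.y_add, Matrix.trace_add, mul_add,
      Finset.sum_add_distrib]
    ring
  map_smul' s v := by
    simp only [map_smul, Point.X_smul, Point.y_smul, Matrix.mul_smul, Matrix.trace_smul,
      smul_eq_mul, RingHom.id_apply, ← Finset.mul_sum, mul_left_comm _ s]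
    ring

theorem gradForm_apply (v : Point n d) : gradForm P t z v =
    t * ∑ i, v.y i - ∑ i, 2 / residual P z i * slope P z i v - (z.X⁻¹ * v.X).trace +
      ((1 - z.X)⁻¹ * v.X).trace := rfl

/-- The second differential of `-ln (y_i² - ‖X p_i‖²)`, transposition invariant. -/
def coneHessForm (i : Fin n) : LinearMap.BilinForm ℝ (Point n d) :=
  LinearMap.mk₂ ℝ
    (fun u v => 1 / residual P z i * (inner ℝ (applyTo u.X (P i)) (applyTo v.X (P i)) +
        inner ℝ (applyTo u.Xᵀ (P i)) (applyTo v.Xᵀ (P i))) -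
      2 / residual P z i * (u.y i * v.y i) +
      4 / residual P z i ^ 2 * (slope P z i u * slope P z i v))
    (fun u u' v => by
      simp only [map_add, Point.X_add, Point.y_add, Matrix.transpose_add, applyTo_add,
        inner_add_left]
      ring)
    (fun s u v => by
      simp only [map_smul, Point.X_smul, Point.y_smul, Matrix.transpose_smul, applyTo_smul,
        real_inner_smul_left, smul_eq_mul]
      ring)
    (fun u v v' => by
      simp only [map_add, Point.X_add, Point.y_add, Matrix.transpose_add, applyTo_add,
        inner_add_right]
      ring)
    (fun s u v => by
      simp only [map_smul, Point.X_smul, Point.y_smul, Matrix.transpose_smul, applyTo_smul,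
        real_inner_smul_right, smul_eq_mul]
      ring)

theorem coneHessForm_apply (i : Fin n) (u v : Point n d) : coneHessForm P z i u v =
    1 / residual P z i * (inner ℝ (applyTo u.X (P i)) (applyTo v.X (P i)) +
        inner ℝ (applyTo u.Xᵀ (P i)) (applyTo v.Xᵀ (P i))) -
      2 / residual P z i * (u.y i * v.y i) +
      4 / residual P z i ^ 2 * (slope P z i u * slope P z i v) := rfl

/-- The second differential of the relaxation, transposition invariant. -/
def hessForm : LinearMap.BilinForm ℝ (Point n d) :=
  LinearMap.mk₂ ℝ
    (fun u v => (u.Xᵀ * z.X⁻¹ * v.X * z.X⁻¹).trace +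
      (u.Xᵀ * (1 - z.X)⁻¹ * v.X * (1 - z.X)⁻¹).trace + ∑ i, coneHessForm P z i u v)
    (fun u u' v => by
      simp only [map_add, LinearMap.add_apply, Point.X_add, Matrix.transpose_add, Matrix.add_mul,
        Matrix.trace_add, Finset.sum_add_distrib]
      ring)
    (fun s u v => by
      simp only [map_smul, LinearMap.smul_apply, Point.X_smul, Matrix.transpose_smul,
        Matrix.smul_mul, Matrix.trace_smul, smul_add, Finset.smul_sum])
    (fun u v v' => by
      simp only [map_add, Point.X_add, Matrix.mul_add, Matrix.add_mul, Matrix.trace_add,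
        Finset.sum_add_distrib]
      ring)
    (fun s u v => by
      simp only [map_smul, Point.X_smul, Matrix.mul_smul, Matrix.smul_mul, Matrix.trace_smul,
        smul_add, Finset.smul_sum])

theorem hessForm_apply (u v : Point n d) : hessForm P z u v =
    (u.Xᵀ * z.X⁻¹ * v.X * z.X⁻¹).trace + (u.Xᵀ * (1 - z.X)⁻¹ * v.X * (1 - z.X)⁻¹).trace +
      ∑ i, coneHessForm P z i u v := rfl

theorem relaxation_eq_add_relaxation_zero :
    relaxation P t z = t * ∑ i, z.y i + relaxation P 0 z := by
  simp only [relaxation]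
  ring

theorem gradForm_eq_add_gradForm_zero (v : Point n d) :
    gradForm P t z v = t * ∑ i, v.y i + gradForm P 0 z v := by
  simp only [gradForm_apply]
  ring

variable {P t z}

theorem symPart_of_isSymm {U : Matrix (Fin d) (Fin d) ℝ} (hU : U.IsSymm) : symPart U = U := by
  rw [symPart, hU.eq, ← two_smul ℝ, smul_smul]
  norm_num

theorem trace_transpose_mul_mul_mul_comm {S : Matrix (Fin d) (Fin d) ℝ} (hS : S.IsSymm)
    (U V : Matrix (Fin d) (Fin d) ℝ) : (Uᵀ * S * V * S).trace = (Vᵀ * S * U * S).trace := by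
  rw [← Matrix.trace_transpose]
  simp only [Matrix.transpose_mul, Matrix.transpose_transpose, hS.eq]
  rw [Matrix.trace_mul_comm]
  simp only [Matrix.mul_assoc]

theorem coneHessForm_comm (i : Fin n) (u v : Point n d) :
    coneHessForm P z i u v = coneHessForm P z i v u := by
  simp only [coneHessForm_apply, real_inner_comm (applyTo v.X (P i)),
    real_inner_comm (applyTo v.Xᵀ (P i)), mul_comm (v.y i), mul_comm (slope P z i v)]

theorem norm_midpoint_sq_le {E : Type*} [NormedAddCommGroup E] [InnerProductSpace ℝ E] (a b : E) :
    2 * ‖(1 / 2 : ℝ) • (a + b)‖ ^ 2 ≤ ‖a‖ ^ 2 + ‖b‖ ^ 2 := by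
  have h := parallelogram_law_with_norm ℝ a b
  rw [norm_smul, mul_pow, Real.norm_eq_abs, sq_abs]
  nlinarith [mul_self_nonneg ‖a - b‖]

variable {k : ℕ} (hz : z ∈ domain k P)
include hz

theorem residual_pos (i : Fin n) : 0 < residual P z i :=
  sub_pos.2 (pow_lt_pow_left₀ (hz.2.2.2 i) (norm_nonneg _) two_ne_zero)

theorem isSymm_inv_X : z.X⁻¹.IsSymm := by
  simpa [Matrix.IsSymm, Matrix.IsHermitian] using hz.1.inv.1

theorem isSymm_inv_one_sub_X : (1 - z.X)⁻¹.IsSymm := by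
  simpa [Matrix.IsSymm, Matrix.IsHermitian] using hz.2.1.inv.1

theorem hessForm_comm (u v : Point n d) : hessForm P z u v = hessForm P z v u := by
  simp only [hessForm_apply, coneHessForm_comm _ u v,
    trace_transpose_mul_mul_mul_comm (isSymm_inv_X hz) u.X,
    trace_transpose_mul_mul_mul_comm (isSymm_inv_one_sub_X hz) u.X]

theorem two_mul_slope_div_residual_sq_le (i : Fin n) (v : Point n d) :
    2 * (slope P z i v / residual P z i) ^ 2 ≤ coneHessForm P z i v v := by
  have hq := residual_pos hz i
  have hmid : 2 * ‖applyTo (symPart v.X) (P i)‖ ^ 2 ≤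
      ‖applyTo v.X (P i)‖ ^ 2 + ‖applyTo v.Xᵀ (P i)‖ ^ 2 := by
    simpa [symPart] using norm_midpoint_sq_le (applyTo v.X (P i)) (applyTo v.Xᵀ (P i))
  have hcs : residual P z i * (v.y i ^ 2 - ‖applyTo (symPart v.X) (P i)‖ ^ 2) ≤
      slope P z i v ^ 2 := lorentz_reverse_cauchy_schwarz (hz.2.2.2 i).le
  rw [coneHessForm_apply, real_inner_self_eq_norm_sq, real_inner_self_eq_norm_sq, ← sub_nonneg]
  calc 0 ≤ (residual P z i * (‖applyTo v.X (P i)‖ ^ 2 + ‖applyTo v.Xᵀ (P i)‖ ^ 2 -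
          2 * v.y i ^ 2) + 2 * slope P z i v ^ 2) / residual P z i ^ 2 :=
        div_nonneg (by nlinarith) (sq_nonneg _)
    _ = _ := by field_simp; ring

theorem coneHessForm_self_nonneg (i : Fin n) (v : Point n d) : 0 ≤ coneHessForm P z i v v :=
  (by positivity : (0 : ℝ) ≤ _).trans (two_mul_slope_div_residual_sq_le hz i v)

theorem hessForm_self_nonneg (v : Point n d) : 0 ≤ hessForm P z v v :=
  add_nonneg (add_nonneg (trace_conjTranspose_mul_mul_mul_nonneg hz.1.inv v.X)
    (trace_conjTranspose_mul_mul_mul_nonneg hz.2.1.inv v.X))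
    (Finset.sum_nonneg fun i _ => coneHessForm_self_nonneg hz i v)

theorem eq_zero_of_hessForm_self_eq_zero {v : Point n d} (hv : hessForm P z v v = 0) : v = 0 := by
  have hX₁ := trace_conjTranspose_mul_mul_mul_nonneg hz.1.inv v.X
  have hX₂ := trace_conjTranspose_mul_mul_mul_nonneg hz.2.1.inv v.X
  have hcone : ∀ i ∈ Finset.univ, 0 ≤ coneHessForm P z i v v :=
    fun i _ => coneHessForm_self_nonneg hz i v
  have hsum := Finset.sum_nonneg hcone
  rw [hessForm_apply] at hv
  simp only [Matrix.conjTranspose_eq_transpose_of_trivial] at hX₁ hX₂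
  have hX : v.X = 0 := eq_zero_of_trace_conjTranspose_mul_mul_mul_eq_zero hz.1.inv (by
    rw [Matrix.conjTranspose_eq_transpose_of_trivial]
    linarith)
  refine Point.ext_components hX fun i => ?_
  have hi := (Finset.sum_eq_zero_iff_of_nonneg hcone).1 (by linarith) i (Finset.mem_univ i)
  have hsq : (slope P z i v / residual P z i) ^ 2 = 0 :=
    le_antisymm (by linarith [two_mul_slope_div_residual_sq_le hz i v]) (sq_nonneg _)
  have hslope : slope P z i v = 0 := by
    simpa [(residual_pos hz i).ne'] using hsq
  have hy : z.y i ≠ 0 := ((norm_nonneg _).trans_lt (hz.2.2.2 i)).ne'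
  simpa [slope_apply, symPart, hX, hy] using hslope

end Differentials

section Line

open scoped Matrix

variable {n d k : ℕ} {P : Fin n → EuclideanSpace ℝ (Fin d)} {t : ℝ} {z v : Point n d}

/-- Along a line the two determinants contribute their eigenvalues, and each Lorentz cone the two
roots of a quadratic polynomial. -/
theorem exists_hasLogFactors_line (hz : z ∈ domain k P) (hv : v ∈ tangent n d) :
    ∃ μ : (Fin d ⊕ Fin d) ⊕ Fin n × Fin 2 → ℝ,
      HasLogFactors {s | z + s • v ∈ domain k P} (fun s => -relaxation P 0 (z + s • v)) μ ∧
      ∑ j, μ j = -gradForm P 0 z v ∧ ∑ j, μ j ^ 2 = hessForm P z v v := by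
  obtain ⟨hsymm, htrace⟩ := mem_tangent.1 hv
  obtain ⟨μ₁, hμ₁, hsum₁, hsq₁⟩ := exists_hasLogFactors_det hz.1 hsymm
  obtain ⟨μ₂, hμ₂, hsum₂, hsq₂⟩ := exists_hasLogFactors_det hz.2.1 hsymm.neg
  choose ν hν hsumν hsqν using fun i =>
    exists_hasLogFactors_lorentz (hz.2.2.2 i) (v.y i) (applyTo v.X (P i))
  have hslope : ∀ i, slope P z i v =
      z.y i * v.y i - inner ℝ (applyTo z.X (P i)) (applyTo v.X (P i)) := fun i => by
    rw [slope_apply, symPart_of_isSymm hsymm]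
  have hsub : ∀ s : ℝ, 1 - (z + s • v).X = 1 - z.X + s • -v.X := fun s => by
    rw [Point.X_add, Point.X_smul, smul_neg]
    abel
  refine ⟨Sum.elim (Sum.elim μ₁ μ₂) fun p => ν p.1 p.2, fun s hs => ?_, ?_, ?_⟩
  · obtain ⟨⟨⟨hpos₁, hpos₂⟩, hcone⟩, hF⟩ := (hμ₁.add hμ₂).add (HasLogFactors.sum hν) s hs
    have htr : (z + s • v).X.trace = (d : ℝ) - k := by
      simpa [Matrix.trace_add, Matrix.trace_smul, htrace] using hz.2.2.1
    refine ⟨⟨hpos₁, (hsub s).symm ▸ hpos₂, htr, fun i => ?_⟩, ?_⟩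
    · simpa using Set.mem_iInter.1 hcone i
    · simp only [relaxation, hsub]
      simp only [Point.X_add, Point.y_add, Point.X_smul, Point.y_smul, applyTo_add,
        applyTo_smul] at hF ⊢
      linarith
  · simp only [Fintype.sum_sum_type, Fintype.sum_prod_type, Sum.elim_inl, Sum.elim_inr, hsum₁,
      hsum₂, hsumν, gradForm_apply, hslope, Matrix.mul_neg, Matrix.trace_neg, residual]
    ring
  · simp only [Fintype.sum_sum_type, Fintype.sum_prod_type, Sum.elim_inl, Sum.elim_inr, hsq₁,
      hsq₂, hsqν, hessForm_apply, coneHessForm_apply, hslope, hsymm.eq, Matrix.transpose_neg,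
      Matrix.neg_mul, Matrix.mul_neg, neg_neg, real_inner_self_eq_norm_sq, residual]
    congr 1
    exact Finset.sum_congr rfl fun i _ => by ring

theorem add_mem_domain_and_relaxation_add_le (hz : z ∈ domain k P) (hv : v ∈ tangent n d)
    (hv' : hessForm P z v v ≤ 1 / 4) :
    z + v ∈ domain k P ∧
      relaxation P t (z + v) ≤ relaxation P t z + gradForm P t z v + hessForm P z v v := by
  obtain ⟨μ, hμ, hsum, hsq⟩ := exists_hasLogFactors_line hz hv
  obtain ⟨hpos, hlog⟩ := sum_sub_sum_sq_le_sum_log (hsq.trans_le hv')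
  obtain ⟨hmem, hF⟩ := hμ 1 fun j => by simpa using hpos j
  simp only [one_smul, one_mul, zero_smul, add_zero, Set.mem_ofPred_eq] at hmem hF
  refine ⟨hmem, ?_⟩
  rw [relaxation_eq_add_relaxation_zero P t (z + v), relaxation_eq_add_relaxation_zero P t z,
    gradForm_eq_add_gradForm_zero]
  simp only [Point.y_add, Finset.sum_add_distrib, mul_add]
  linarith

end Line

section NewtonDecrement

open Filter Topology

theorem HasLogFactors.eventually_hasDerivAt {ι : Type*} [Fintype ι] {D : Set ℝ} {F : ℝ → ℝ}
    {μ : ι → ℝ} (hF : HasLogFactors D F μ) :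
    ∀ᶠ s in 𝓝 0, HasDerivAt F (∑ j, μ j / (1 + s * μ j)) s := by
  filter_upwards [(eventually_forall_one_add_mul_pos μ).eventually_nhds] with s hs
  refine ((hasDerivAt_sum_log_one_add_mul hs.self_of_nhds).const_add (F 0)).congr_of_eventuallyEq ?_
  exact hs.mono fun r hr => (hF r hr).2

variable {V W : Type*} [NormedAddCommGroup V] [NormedSpace ℝ V] [NormedAddCommGroup W]
  [NormedSpace ℝ W]

theorem hasDerivAt_comp_smul {f : V → W} {s : ℝ} {v : V} (hf : DifferentiableAt ℝ f (s • v)) :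
    HasDerivAt (fun r : ℝ => f (r • v)) (fderiv ℝ f (s • v) v) s := by
  have hline : HasDerivAt (fun r : ℝ => r • v) v s := by
    simpa using (hasDerivAt_id s).smul_const v
  exact hf.hasFDerivAt.comp_hasDerivAt s hline

theorem fderiv_zero_eq_and_fderiv_fderiv_zero_eq {ψ : V → ℝ} (hψ : ContDiffAt ℝ 2 ψ 0) {v : V}
    {f' : ℝ → ℝ} {a : ℝ} (hf' : ∀ᶠ s in 𝓝 0, HasDerivAt (fun s : ℝ => ψ (s • v)) (f' s) s)
    (ha : HasDerivAt f' a 0) :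
    fderiv ℝ ψ 0 v = f' 0 ∧ fderiv ℝ (fderiv ℝ ψ) 0 v v = a := by
  have hline : Tendsto (fun s : ℝ => s • v) (𝓝 0) (𝓝 0) :=
    Continuous.tendsto' (by fun_prop) 0 0 (zero_smul ℝ v)
  have hdiff : ∀ᶠ x in 𝓝 (0 : V), DifferentiableAt ℝ ψ x :=
    (hψ.eventually (by simp)).mono fun x hx => hx.differentiableAt (by simp)
  have hdiff₂ : DifferentiableAt ℝ (fderiv ℝ ψ) ((0 : ℝ) • v) := by
    rw [zero_smul]
    exact (hψ.fderiv_right (m := 1) (by norm_num)).differentiableAt (by simp)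
  have heq : ∀ᶠ s in 𝓝 (0 : ℝ), fderiv ℝ ψ (s • v) v = f' s := by
    filter_upwards [hline.eventually hdiff, hf'] with s hs hs'
    exact (hasDerivAt_comp_smul hs).unique hs'
  refine ⟨by simpa using heq.self_of_nhds, ?_⟩
  have hderiv := (hasDerivAt_comp_smul hdiff₂).clm_apply (hasDerivAt_const (0 : ℝ) v)
  simpa using hderiv.unique (ha.congr_of_eventuallyEq heq)

theorem newtonDecrement_eq_sqrt_fderiv {E : Type*} [NormedAddCommGroup E] [InnerProductSpace ℝ E]
    [FiniteDimensional ℝ E] {V : Submodule ℝ E} {φ : E → ℝ} {x : E}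
    (hφ : ContDiffAt ℝ 2 (fun v : V => φ (x + v)) 0)
    (hker : ∀ v, fderiv ℝ (fderiv ℝ fun v : V => φ (x + v)) 0 v v = 0 → v = 0) {N : V}
    (hN : fderiv ℝ (fderiv ℝ fun v : V => φ (x + v)) 0 N = fderiv ℝ (fun v : V => φ (x + v)) 0) :
    newtonDecrement V φ x = √(fderiv ℝ (fun v : V => φ (x + v)) 0 N) := by
  have : CompleteSpace V := FiniteDimensional.complete ℝ V
  set ψ : V → ℝ := fun v => φ (x + v)
  have hdiff : DifferentiableAt ℝ (fderiv ℝ ψ) 0 :=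
    (hφ.fderiv_right (m := 1) (by norm_num)).differentiableAt (by simp)
  let riesz := (InnerProductSpace.toDual ℝ V).symm.toContinuousLinearEquiv.toContinuousLinearMap
  set H : V →L[ℝ] V := fderiv ℝ (fun v => ∇ ψ v) 0
  have hHess : H = riesz ∘L fderiv ℝ (fderiv ℝ ψ) 0 :=
    (riesz.hasFDerivAt.comp 0 hdiff.hasFDerivAt).fderiv
  have hinner (u v : V) : inner ℝ (H u) v = fderiv ℝ (fderiv ℝ ψ) 0 u v := by
    rw [hHess]
    exact InnerProductSpace.toDual_symm_apply
  have hinj : Function.Injective H := (injective_iff_map_eq_zero H).2 fun u hu =>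
    hker u (by rw [← hinner, hu, inner_zero_left])
  let e : V ≃L[ℝ] V := (LinearEquiv.ofInjectiveEndo (H : V →ₗ[ℝ] V) hinj).toContinuousLinearEquiv
  have hinv : H.inverse (∇ ψ 0) = N := by
    have he : (e : V →L[ℝ] V) = H := rfl
    have hHN : e N = ∇ ψ 0 := ext_inner_right ℝ fun v => by
      rw [inner_gradient_left, ← hN, ← hinner, ← he, ContinuousLinearEquiv.coe_coe]
    rw [← hHN, ← he, ContinuousLinearMap.inverse_equiv, ContinuousLinearEquiv.coe_coe,
      e.symm_apply_apply]
  change √(inner ℝ (∇ ψ 0) (H.inverse (∇ ψ 0))) = _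
  rw [hinv, inner_gradient_left]

end NewtonDecrement

section Decrement

variable {n d : ℕ} {P : Fin n → EuclideanSpace ℝ (Fin d)} {t : ℝ} {z : Point n d}

theorem contDiff_det {E ι : Type*} [NormedAddCommGroup E] [NormedSpace ℝ E] [Fintype ι]
    [DecidableEq ι] {m : WithTop ℕ∞} {f : E → Matrix ι ι ℝ}
    (hf : ∀ i j, ContDiff ℝ m fun x => f x i j) : ContDiff ℝ m fun x => (f x).det := by
  simp only [Matrix.det_apply]
  exact ContDiff.sum fun σ _ => (contDiff_prod fun i _ => hf _ _).const_smul _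

theorem contDiff_X_apply {m : WithTop ℕ∞} (i j : Fin d) :
    ContDiff ℝ m fun z : Point n d => z.X i j := by
  simp only [Point.X, Matrix.of_apply]
  fun_prop

theorem contDiff_y {m : WithTop ℕ∞} (i : Fin n) : ContDiff ℝ m fun z : Point n d => z.y i := by
  simp only [Point.y]
  fun_prop

theorem contDiff_applyTo_X {m : WithTop ℕ∞} (p : EuclideanSpace ℝ (Fin d)) :
    ContDiff ℝ m fun z : Point n d => applyTo z.X p := by
  refine contDiff_euclidean.2 fun a => ?_
  simp only [applyTo_apply]
  exact ContDiff.sum fun b _ => (contDiff_X_apply a b).mul contDiff_const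

variable {k : ℕ} (hz : z ∈ domain k P)
include hz

theorem contDiffAt_relaxation {m : WithTop ℕ∞} : ContDiffAt ℝ m (relaxation P t) z := by
  have hdet : ContDiff ℝ m fun z : Point n d => z.X.det := contDiff_det contDiff_X_apply
  have hdet' : ContDiff ℝ m fun z : Point n d => (1 - z.X).det := contDiff_det fun i j => by
    simp only [Matrix.sub_apply]
    exact contDiff_const.sub (contDiff_X_apply i j)
  have hcone (i : Fin n) : ContDiffAt ℝ m
      (fun z : Point n d => Real.log (z.y i ^ 2 - ‖applyTo z.X (P i)‖ ^ 2)) z :=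
    (((contDiff_y i).pow 2).sub ((contDiff_applyTo_X (P i)).norm_sq ℝ)).contDiffAt.log
      (residual_pos hz i).ne'
  exact (((contDiff_const.mul (ContDiff.sum fun i _ => contDiff_y i)).contDiffAt.sub
    (ContDiffAt.sum fun i _ => hcone i)).sub (hdet.contDiffAt.log hz.1.det_pos.ne')).sub
    (hdet'.contDiffAt.log hz.2.1.det_pos.ne')

theorem contDiffAt_relaxation_comp_tangent {m : WithTop ℕ∞} :
    ContDiffAt ℝ m (fun v : tangent n d => relaxation P t (z + v)) 0 := by
  have hsub : ContDiffAt ℝ m (fun v : tangent n d => z + (v : Point n d)) 0 :=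
    (contDiff_const.add (tangent n d).subtypeL.contDiff).contDiffAt
  refine ContDiffAt.comp (g := relaxation P t) 0 ?_ hsub
  simpa using contDiffAt_relaxation hz

theorem fderiv_relaxation_and_fderiv_fderiv_relaxation (v : tangent n d) :
    fderiv ℝ (fun v : tangent n d => relaxation P t (z + v)) 0 v = gradForm P t z v ∧
      fderiv ℝ (fderiv ℝ fun v : tangent n d => relaxation P t (z + v)) 0 v v =
        hessForm P z v v := by
  obtain ⟨μ, hμ, hsum, hsq⟩ := exists_hasLogFactors_line hz v.2
  have hderiv : ∀ᶠ s : ℝ in nhds 0, HasDerivAt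
      (fun s : ℝ => relaxation P t (z + (s • v : tangent n d)))
      (t * ∑ i, (v : Point n d).y i - ∑ j, μ j / (1 + s * μ j)) s := by
    filter_upwards [hμ.eventually_hasDerivAt] with s hs
    have hlin : HasDerivAt (fun s : ℝ => t * ∑ i, (z + s • (v : Point n d)).y i)
        (t * ∑ i, (v : Point n d).y i) s := by
      simp only [Point.y_add, Point.y_smul, Finset.sum_add_distrib, ← Finset.mul_sum]
      simpa using (((hasDerivAt_id s).mul_const _).const_add _).const_mul t
    refine (hlin.sub hs).congr_of_eventuallyEq (Filter.Eventually.of_forall fun r => ?_)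
    simp only [relaxation_eq_add_relaxation_zero P t, Pi.sub_apply, sub_neg_eq_add,
      Submodule.coe_smul]
  obtain ⟨hgrad, hhess⟩ := fderiv_zero_eq_and_fderiv_fderiv_zero_eq
    (contDiffAt_relaxation_comp_tangent hz) hderiv
    ((hasDerivAt_sum_div_one_add_mul μ).const_sub (t * ∑ i, (v : Point n d).y i))
  refine ⟨hgrad.trans ?_, hhess.trans (by rw [neg_neg, hsq])⟩
  simp only [zero_mul, add_zero, div_one, hsum, sub_neg_eq_add]
  exact (gradForm_eq_add_gradForm_zero P t z v).symm

theorem fderiv_fderiv_relaxation (u v : tangent n d) :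
    fderiv ℝ (fderiv ℝ fun v : tangent n d => relaxation P t (z + v)) 0 u v = hessForm P z u v := by
  let D : LinearMap.BilinForm ℝ (tangent n d) := LinearMap.mk₂ ℝ
    (fun u v => fderiv ℝ (fderiv ℝ fun v : tangent n d => relaxation P t (z + v)) 0 u v)
    (by simp) (by simp) (by simp) (by simp)
  have hD : D.IsSymm :=
    ⟨fun u v => (contDiffAt_relaxation_comp_tangent (m := 2) hz).isSymmSndFDerivAt (by simp) u v⟩
  have hH : (LinearMap.BilinForm.restrict (hessForm P z) (tangent n d)).IsSymm :=
    ⟨fun u v => hessForm_comm hz u v⟩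
  exact congrArg (fun B : LinearMap.BilinForm ℝ (tangent n d) => B u v)
    (LinearMap.BilinForm.ext_of_isSymm hD hH fun v =>
      (fderiv_relaxation_and_fderiv_fderiv_relaxation hz v).2)

theorem decrement_eq_sqrt_gradForm {N : Point n d} (hN : N ∈ tangent n d)
    (hN' : ∀ v ∈ tangent n d, hessForm P z N v = gradForm P t z v) :
    decrement P t z = √(gradForm P t z N) := by
  have hgrad (v : tangent n d) := (fderiv_relaxation_and_fderiv_fderiv_relaxation hz (t := t) v).1
  have hnewton : fderiv ℝ (fderiv ℝ fun v : tangent n d => relaxation P t (z + v)) 0 ⟨N, hN⟩ =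
      fderiv ℝ (fun v : tangent n d => relaxation P t (z + v)) 0 := by
    ext v
    rw [fderiv_fderiv_relaxation hz, hgrad, hN' v v.2]
  rw [decrement, newtonDecrement_eq_sqrt_fderiv (contDiffAt_relaxation_comp_tangent hz)
    (fun v hv => Subtype.ext (eq_zero_of_hessForm_self_eq_zero hz ?_)) hnewton, hgrad]
  rwa [← fderiv_fderiv_relaxation hz]

end Decrement

section InitialGap

variable {n d k : ℕ} {P : Fin n → EuclideanSpace ℝ (Fin d)} {t : ℝ} {z : Point n d}

theorem one_sub_X0 (hd : d ≠ 0) : 1 - X0 d k = ((k : ℝ) / d) • (1 : Matrix (Fin d) (Fin d) ℝ) := by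
  have hcoeff : (1 : ℝ) - ((d : ℝ) - k) / d = k / d := by
    field_simp
    ring
  rw [X0, ← hcoeff, sub_smul, one_smul]

theorem mkPoint_X0_mem_domain (hk : 1 ≤ k) (hkd : k < d) {y : Fin n → ℝ}
    (hy : ∀ i, ‖applyTo (X0 d k) (P i)‖ < y i) : mkPoint (X0 d k) y ∈ domain k P := by
  have hd : d ≠ 0 := by lia
  have hd' : (0 : ℝ) < d := by positivity
  have hkd' : (0 : ℝ) < d - k := sub_pos.2 (mod_cast hkd)
  refine ⟨Matrix.PosDef.one.smul (div_pos hkd' hd'), ?_, ?_, hy⟩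
  · rw [mkPoint_X, one_sub_X0 hd]
    exact Matrix.PosDef.one.smul (div_pos (mod_cast hk) hd')
  · rw [mkPoint_X, X0, Matrix.trace_smul, Matrix.trace_one, Fintype.card_fin, smul_eq_mul,
      div_mul_cancel₀ _ hd'.ne']

theorem initialPoint_mem_domain (hk : 1 ≤ k) (hkd : k < d) : initialPoint k P ∈ domain k P :=
  mkPoint_X0_mem_domain hk hkd fun _ =>
    Real.lt_sqrt_of_sq_lt (lt_add_of_pos_right _ (Real.exp_pos 1))

theorem neg_two_mul_log_le_log_det_X0 (hk : 1 ≤ k) (hkd : k < d) :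
    -(2 * d * Real.log d) ≤ Real.log (X0 d k).det + Real.log (1 - X0 d k).det := by
  have hd : d ≠ 0 := by lia
  have hd' : (d : ℝ) ≠ 0 := mod_cast hd
  have hk' : (1 : ℝ) ≤ k := mod_cast hk
  have hkd' : (1 : ℝ) ≤ d - k := by
    rw [le_sub_iff_add_le']
    exact_mod_cast hkd
  have hlog : 0 ≤ (d : ℝ) * (Real.log (d - k) + Real.log k) :=
    mul_nonneg d.cast_nonneg (add_nonneg (Real.log_nonneg hkd') (Real.log_nonneg hk'))
  rw [one_sub_X0 hd, X0]
  simp only [Matrix.det_smul, Matrix.det_one, mul_one, Fintype.card_fin, Real.log_pow]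
  rw [Real.log_div (by linarith) hd', Real.log_div (by linarith) hd']
  linarith

theorem two_add_two_mul_log_le {y r : ℝ} (ht : 0 < t) (hy : 0 < y) (hr : 0 < y ^ 2 - r ^ 2) :
    2 + 2 * Real.log (t / 2) ≤ t * y - Real.log (y ^ 2 - r ^ 2) := by
  have hlog : Real.log (y ^ 2 - r ^ 2) ≤ 2 * Real.log y := by
    simpa using Real.log_le_log hr (sub_le_self _ (sq_nonneg r))
  have hlin := Real.log_le_sub_one_of_pos (mul_pos (half_pos ht) hy)
  rw [Real.log_mul (half_pos ht).ne' hy.ne'] at hlin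
  linarith

theorem two_mul_add_le_relaxation (ht : 0 < t) (hz : z ∈ domain k P) :
    2 * n + 2 * n * Real.log (t / 2) ≤ relaxation P t z := by
  have hX : Real.log z.X.det ≤ 0 := Real.log_nonpos hz.1.det_pos.le
    (det_le_one_of_posSemidef_one_sub hz.1.posSemidef hz.2.1.posSemidef)
  have hX' : Real.log (1 - z.X).det ≤ 0 := Real.log_nonpos hz.2.1.det_pos.le
    (det_le_one_of_posSemidef_one_sub hz.2.1.posSemidef (by simpa using hz.1.posSemidef))
  have hcone := Finset.card_nsmul_le_sum Finset.univ _ _ fun i _ => two_add_two_mul_log_le ht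
    ((norm_nonneg _).trans_lt (hz.2.2.2 i)) (residual_pos hz i)
  simp only [Finset.card_univ, Fintype.card_fin, nsmul_eq_mul, Finset.sum_sub_distrib,
    ← Finset.mul_sum] at hcone
  rw [relaxation]
  linarith

theorem norm_applyTo_X0_le_y0 (i : Fin n) : ‖applyTo (X0 d k) (P i)‖ ≤ y0 k P i :=
  Real.le_sqrt_of_sq_le (le_add_of_nonneg_right (Real.exp_nonneg 1))

theorem sum_y0_pos (hn : 1 ≤ n) : 0 < ∑ i, y0 k P i :=
  Finset.sum_pos (fun _ _ => Real.sqrt_pos.2 (by positivity)) ⟨⟨0, hn⟩, Finset.mem_univ _⟩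

theorem t0_pos (hn : 1 ≤ n) : 0 < t0 k P :=
  div_pos (mul_pos two_pos (mod_cast hn)) (sum_y0_pos hn)

theorem t0_mul_sum_y0 (hn : 1 ≤ n) : t0 k P * ∑ i, y0 k P i = 2 * n :=
  div_mul_cancel₀ _ (sum_y0_pos hn).ne'

theorem relaxation_initialPoint_le (hn : 1 ≤ n) (hk : 1 ≤ k) (hkd : k < d) :
    relaxation P (t0 k P) (initialPoint k P) ≤ n + 2 * d * Real.log d := by
  have hcone (i : Fin n) : Real.log (y0 k P i ^ 2 - ‖applyTo (X0 d k) (P i)‖ ^ 2) = 1 := by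
    rw [y0, Real.sq_sqrt (by positivity), add_sub_cancel_left, Real.log_exp]
  simp only [relaxation, initialPoint, mkPoint_X, mkPoint_y, hcone, t0_mul_sum_y0 hn,
    Finset.sum_const, Finset.card_univ, Fintype.card_fin, nsmul_eq_mul, mul_one]
  linarith [neg_two_mul_log_le_log_det_X0 hk hkd]

theorem relaxation_initialPoint_sub_sInf_le (hn : 1 ≤ n) (hk : 1 ≤ k) (hkd : k < d)
    (ht : 1 < t0 k P) :
    relaxation P (t0 k P) (initialPoint k P) - sInf (relaxation P (t0 k P) '' domain k P) ≤
      2 * (n : ℝ) + 4 * (d : ℝ) * Real.log d := by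
  have hlog : -1 ≤ Real.log (t0 k P / 2) := calc
    (-1 : ℝ) ≤ Real.log 2⁻¹ := by
      rw [Real.log_inv]
      linarith [Real.log_two_lt_d9]
    _ ≤ Real.log (t0 k P / 2) := Real.log_le_log (by norm_num) (by linarith)
  have hinf : 0 ≤ sInf (relaxation P (t0 k P) '' domain k P) := by
    refine Real.sInf_nonneg (Set.forall_mem_image.2 fun z hz => ?_)
    refine le_trans ?_ (two_mul_add_le_relaxation (t0_pos hn) hz)
    linarith [mul_le_mul_of_nonneg_left hlog n.cast_nonneg]
  have hd : 0 ≤ (d : ℝ) * Real.log d := mul_nonneg d.cast_nonneg (Real.log_natCast_nonneg d)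
  linarith [relaxation_initialPoint_le (P := P) hn hk hkd, n.cast_nonneg (α := ℝ)]

/-- The point over `X₀` at which the program starts. Unlike `initialPoint`, its gap to the infimum
is `O(n + d ln d)` for every value of `t₀`. -/
def startPoint (k : ℕ) (P : Fin n → EuclideanSpace ℝ (Fin d)) : Point n d :=
  mkPoint (X0 d k) fun i => ‖applyTo (X0 d k) (P i)‖ + 2 / t0 k P

theorem startPoint_mem_domain (hn : 1 ≤ n) (hk : 1 ≤ k) (hkd : k < d) :
    startPoint k P ∈ domain k P :=
  mkPoint_X0_mem_domain hk hkd fun _ => lt_add_of_pos_right _ (div_pos two_pos (t0_pos hn))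

theorem neg_two_mul_log_le_log_sq_sub_sq {r : ℝ} (ht : 0 < t) (hr : 0 ≤ r) :
    -(2 * Real.log (t / 2)) ≤ Real.log ((r + 2 / t) ^ 2 - r ^ 2) := calc
  -(2 * Real.log (t / 2)) = Real.log ((2 / t) ^ 2) := by
    rw [Real.log_pow, ← inv_div t 2, Real.log_inv, Nat.cast_ofNat, mul_neg]
  _ ≤ Real.log ((r + 2 / t) ^ 2 - r ^ 2) :=
    Real.log_le_log (by positivity) (by linarith [mul_nonneg hr (div_pos two_pos ht).le])

theorem t0_mul_sum_startPoint_y_le (hn : 1 ≤ n) :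
    t0 k P * ∑ i, (startPoint k P).y i ≤ 4 * n := by
  have ht := t0_pos (k := k) (P := P) hn
  calc t0 k P * ∑ i, (startPoint k P).y i
      ≤ t0 k P * ∑ i, (y0 k P i + 2 / t0 k P) := by
        gcongr with i
        exact add_le_add_left (norm_applyTo_X0_le_y0 i) _
    _ = t0 k P * ∑ i, y0 k P i + n * (t0 k P * (2 / t0 k P)) := by
        simp only [Finset.sum_add_distrib, Finset.sum_const, Finset.card_univ, Fintype.card_fin,
          nsmul_eq_mul]
        ring
    _ = 4 * n := by
        rw [t0_mul_sum_y0 hn, mul_div_cancel₀ _ ht.ne']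
        ring

theorem relaxation_startPoint_le (hn : 1 ≤ n) (hk : 1 ≤ k) (hkd : k < d) :
    relaxation P (t0 k P) (startPoint k P) ≤
      2 * n + 2 * n * Real.log (t0 k P / 2) + (2 * n + 2 * d * Real.log d) := by
  have hcone := Finset.card_nsmul_le_sum Finset.univ _ _ fun i _ =>
    neg_two_mul_log_le_log_sq_sub_sq (t0_pos (k := k) (P := P) hn)
      (norm_nonneg (applyTo (X0 d k) (P i)))
  simp only [Finset.card_univ, Fintype.card_fin, nsmul_eq_mul] at hcone
  have hlin := t0_mul_sum_startPoint_y_le (k := k) (P := P) hn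
  simp only [relaxation, startPoint, mkPoint_X, mkPoint_y] at hlin ⊢
  linarith [neg_two_mul_log_le_log_det_X0 hk hkd]

end InitialGap

section NewtonSystem

open scoped Matrix

variable {n d : ℕ}

/-- Indices of the unknowns of the Newton system: the matrix direction, the vector direction, one
multiplier for every Lorentz cone, the multiplier of the trace constraint, and the scale. -/
abbrev KktIndex (n d : ℕ) : Type := (Fin d × Fin d) ⊕ Fin n ⊕ Fin n ⊕ Unit ⊕ Unit

/-- The multiplier of the trace constraint among the unknowns of the Newton system. -/
abbrev traceIndex (n d : ℕ) : KktIndex n d := .inr (.inr (.inr (.inl ())))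

/-- The scale among the unknowns of the Newton system. -/
abbrev scaleIndex (n d : ℕ) : KktIndex n d := .inr (.inr (.inr (.inr ())))

/-- The direction in a vector of unknowns of the Newton system. -/
def direction : (KktIndex n d → ℝ) →ₗ[ℝ] Point n d where
  toFun x := mkPoint (Matrix.of fun a b => x (.inl (a, b))) fun i => x (.inr (.inl i))
  map_add' _ _ := Point.ext_components rfl fun _ => rfl
  map_smul' _ _ := Point.ext_components rfl fun _ => rfl

theorem direction_apply (x : KktIndex n d → ℝ) : direction x =
    mkPoint (Matrix.of fun a b => x (.inl (a, b))) fun i => x (.inr (.inl i)) := rfl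

variable (P : Fin n → EuclideanSpace ℝ (Fin d)) (t : ℝ) (z : Point n d)

/-- The part of the differential of the relaxation that does not come from the cones. -/
def coneFreeGradForm : Point n d →ₗ[ℝ] ℝ where
  toFun v := t * ∑ i, v.y i - (z.X⁻¹ * v.X).trace + ((1 - z.X)⁻¹ * v.X).trace
  map_add' u v := by
    simp only [Point.X_add, Point.y_add, Matrix.mul_add, Matrix.trace_add, Finset.sum_add_distrib]
    ring
  map_smul' s v := by
    simp only [Point.X_smul, Point.y_smul, Matrix.mul_smul, Matrix.trace_smul, smul_eq_mul,
      RingHom.id_apply, ← Finset.mul_sum]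
    ring

theorem coneFreeGradForm_apply (v : Point n d) : coneFreeGradForm t z v =
    t * ∑ i, v.y i - (z.X⁻¹ * v.X).trace + ((1 - z.X)⁻¹ * v.X).trace := rfl

/-- The left-hand side of the equation of the Newton system for the `i`-th cone, without the term
of its multiplier. -/
def coneRow (i : Fin n) : (KktIndex n d → ℝ) →ₗ[ℝ] ℝ :=
  slope P z i ∘ₗ direction - (residual P z i / 2) • LinearMap.proj (scaleIndex n d)

theorem coneRow_apply (i : Fin n) (x : KktIndex n d → ℝ) : coneRow P z i x =
    slope P z i (direction x) - residual P z i / 2 * x (scaleIndex n d) := rfl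

/-- The symmetric bilinear form of the Newton system. Eliminating the cone multipliers from it
restores the rank one terms of `hessForm`; with the multipliers, each of its coefficients is a
bounded number of arithmetic operations away from `z`, the inverses of `X` and `I - X` and
`∑ (2 / q_i) p_i p_iᵀ`. -/
def kktForm : LinearMap.BilinForm ℝ (KktIndex n d → ℝ) :=
  LinearMap.mk₂ ℝ
    (fun w x => ((direction w).Xᵀ * z.X⁻¹ * (direction x).X * z.X⁻¹).trace +
      ((direction w).Xᵀ * (1 - z.X)⁻¹ * (direction x).X * (1 - z.X)⁻¹).trace +
      ∑ i, (1 / residual P z i *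
          (inner ℝ (applyTo (direction w).X (P i)) (applyTo (direction x).X (P i)) +
            inner ℝ (applyTo (direction w).Xᵀ (P i)) (applyTo (direction x).Xᵀ (P i))) -
        2 / residual P z i * ((direction w).y i * (direction x).y i)) +
      ∑ i, (x (.inr (.inr (.inl i))) * coneRow P z i w +
        w (.inr (.inr (.inl i))) * coneRow P z i x -
        residual P z i ^ 2 / 4 * (w (.inr (.inr (.inl i))) * x (.inr (.inr (.inl i))))) +
      (x (traceIndex n d) * (direction w).X.trace + w (traceIndex n d) * (direction x).X.trace) +
      (x (scaleIndex n d) * coneFreeGradForm t z (direction w) +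
        w (scaleIndex n d) * coneFreeGradForm t z (direction x)) -
      (n + 1) * (w (scaleIndex n d) * x (scaleIndex n d)))
    (fun w w' x => by
      simp only [map_add, Point.X_add, Point.y_add, Matrix.transpose_add, applyTo_add,
        inner_add_left, Matrix.trace_add, Pi.add_apply, mul_add, add_mul,
        Finset.sum_add_distrib, Finset.sum_sub_distrib]
      ring)
    (fun s w x => by
      simp only [map_smul, Point.X_smul, Point.y_smul, Matrix.transpose_smul, applyTo_smul,
        real_inner_smul_left, Matrix.smul_mul, Matrix.trace_smul, Pi.smul_apply, smul_eq_mul,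
        mul_assoc, mul_left_comm _ s, ← mul_add, ← mul_sub, ← Finset.mul_sum])
    (fun w x x' => by
      simp only [map_add, Point.X_add, Point.y_add, Matrix.transpose_add, applyTo_add,
        inner_add_right, Matrix.trace_add, Pi.add_apply, mul_add, add_mul,
        Finset.sum_add_distrib, Finset.sum_sub_distrib]
      ring)
    (fun s w x => by
      simp only [map_smul, Point.X_smul, Point.y_smul, Matrix.transpose_smul, applyTo_smul,
        real_inner_smul_right, Matrix.smul_mul, Matrix.mul_smul, Matrix.trace_smul, Pi.smul_apply,
        smul_eq_mul, mul_assoc, mul_left_comm _ s, ← mul_add, ← mul_sub, ← Finset.mul_sum])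

theorem kktForm_apply (w x : KktIndex n d → ℝ) : kktForm P t z w x =
    ((direction w).Xᵀ * z.X⁻¹ * (direction x).X * z.X⁻¹).trace +
      ((direction w).Xᵀ * (1 - z.X)⁻¹ * (direction x).X * (1 - z.X)⁻¹).trace +
      ∑ i, (1 / residual P z i *
          (inner ℝ (applyTo (direction w).X (P i)) (applyTo (direction x).X (P i)) +
            inner ℝ (applyTo (direction w).Xᵀ (P i)) (applyTo (direction x).Xᵀ (P i))) -
        2 / residual P z i * ((direction w).y i * (direction x).y i)) +
      ∑ i, (x (.inr (.inr (.inl i))) * coneRow P z i w +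
        w (.inr (.inr (.inl i))) * coneRow P z i x -
        residual P z i ^ 2 / 4 * (w (.inr (.inr (.inl i))) * x (.inr (.inr (.inl i))))) +
      (x (traceIndex n d) * (direction w).X.trace + w (traceIndex n d) * (direction x).X.trace) +
      (x (scaleIndex n d) * coneFreeGradForm t z (direction w) +
        w (scaleIndex n d) * coneFreeGradForm t z (direction x)) -
      (n + 1) * (w (scaleIndex n d) * x (scaleIndex n d)) := rfl

/-- The matrix of the Newton system; see `toMatrix'_kktForm`. -/
def kkt : Matrix (KktIndex n d) (KktIndex n d) ℝ := fun r c =>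
  let S := z.X⁻¹
  let Y := (1 - z.X)⁻¹
  let C : Matrix (Fin d) (Fin d) ℝ := Matrix.of fun a b => ∑ i, 2 / residual P z i * (P i a * P i b)
  let I : Matrix (Fin d) (Fin d) ℝ := 1
  let q := residual P z
  let w := fun i => applyTo z.X (P i)
  match r, c with
  | .inl (a, b), .inl (c, e) =>
    S a c * S b e + Y a c * Y b e + (I a c * C b e + I b e * C a c) / 2
  | .inl _, .inr (.inl _) => 0
  | .inl (a, b), .inr (.inr (.inl i)) => -((w i a * P i b + P i a * w i b) / 2)
  | .inl (a, b), .inr (.inr (.inr (.inl _))) => I a b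
  | .inl (a, b), .inr (.inr (.inr (.inr _))) => Y a b - S a b
  | .inr (.inl _), .inl _ => 0
  | .inr (.inl i), .inr (.inl j) => if i = j then -(2 / q i) else 0
  | .inr (.inl i), .inr (.inr (.inl j)) => if i = j then z.y i else 0
  | .inr (.inl _), .inr (.inr (.inr (.inl _))) => 0
  | .inr (.inl _), .inr (.inr (.inr (.inr _))) => t
  | .inr (.inr (.inl i)), .inl (a, b) => -((w i a * P i b + P i a * w i b) / 2)
  | .inr (.inr (.inl i)), .inr (.inl j) => if i = j then z.y i else 0
  | .inr (.inr (.inl i)), .inr (.inr (.inl j)) => if i = j then -(q i ^ 2 / 4) else 0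
  | .inr (.inr (.inl _)), .inr (.inr (.inr (.inl _))) => 0
  | .inr (.inr (.inl i)), .inr (.inr (.inr (.inr _))) => -(q i / 2)
  | .inr (.inr (.inr (.inl _))), .inl (a, b) => I a b
  | .inr (.inr (.inr (.inl _))), .inr _ => 0
  | .inr (.inr (.inr (.inr _))), .inl (a, b) => Y a b - S a b
  | .inr (.inr (.inr (.inr _))), .inr (.inl _) => t
  | .inr (.inr (.inr (.inr _))), .inr (.inr (.inl i)) => -(q i / 2)
  | .inr (.inr (.inr (.inr _))), .inr (.inr (.inr (.inl _))) => 0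
  | .inr (.inr (.inr (.inr _))), .inr (.inr (.inr (.inr _))) => -(n + 1)

theorem direction_single_matrix (a b : Fin d) :
    direction (n := n) (Pi.single (.inl (a, b)) 1) = mkPoint (Matrix.single a b 1) 0 := by
  refine Point.ext_components (Matrix.ext fun c e => ?_) fun i => rfl
  simp [direction_apply, Pi.single_apply, Matrix.single_apply, Prod.ext_iff, eq_comm]

theorem direction_single_vector (i : Fin n) :
    direction (d := d) (Pi.single (.inr (.inl i)) 1) = mkPoint 0 (Pi.single i 1) := by
  refine Point.ext_components rfl fun j => ?_
  simp [direction_apply, Pi.single_apply]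

theorem direction_single_multiplier (r : Fin n ⊕ Unit ⊕ Unit) :
    direction (n := n) (d := d) (Pi.single (.inr (.inr r)) 1) = 0 :=
  Point.ext_components rfl fun _ => rfl

variable {P t z}

theorem applyTo_single (a b : Fin d) (p : EuclideanSpace ℝ (Fin d)) :
    applyTo (Matrix.single a b 1) p = EuclideanSpace.single a (p b) := by
  ext c
  simp [applyTo_apply, Matrix.single_apply, eq_comm, ite_and]

theorem slope_mkPoint_single (i : Fin n) (a b : Fin d) :
    slope P z i (mkPoint (Matrix.single a b 1) 0) =
      -((applyTo z.X (P i) a * P i b + P i a * applyTo z.X (P i) b) / 2) := by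
  simp only [slope_apply, mkPoint_X, mkPoint_y, symPart, Matrix.transpose_single, applyTo_smul,
    applyTo_add, applyTo_single, real_inner_smul_right, inner_add_right,
    EuclideanSpace.inner_single_right, conj_trivial, Pi.zero_apply]
  ring

theorem trace_transpose_single_mul_single_mul {S : Matrix (Fin d) (Fin d) ℝ} (hS : S.IsSymm)
    (a b c e : Fin d) : ((Matrix.single a b (1 : ℝ))ᵀ * S * Matrix.single c e 1 * S).trace =
      S a c * S b e := by
  rw [Matrix.transpose_single, Matrix.single_mul_mul_single, Matrix.trace_single_mul, hS.apply b e]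
  simp

theorem inner_applyTo_single_add_inner (a b c e : Fin d) (p : EuclideanSpace ℝ (Fin d)) :
    inner ℝ (applyTo (Matrix.single a b 1) p) (applyTo (Matrix.single c e 1) p) +
        inner ℝ (applyTo (Matrix.single a b 1)ᵀ p) (applyTo (Matrix.single c e 1)ᵀ p) =
      (1 : Matrix (Fin d) (Fin d) ℝ) a c * (p b * p e) +
        (1 : Matrix (Fin d) (Fin d) ℝ) b e * (p a * p c) := by
  simp only [Matrix.transpose_single, applyTo_single, EuclideanSpace.inner_single_left,
    PiLp.single_apply, Matrix.one_apply, conj_trivial]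
  split_ifs <;> ring

variable {k : ℕ}

theorem coneFreeGradForm_single_matrix (hz : z ∈ domain k P) (a b : Fin d) :
    coneFreeGradForm t z (mkPoint (Matrix.single a b 1) 0) = (1 - z.X)⁻¹ a b - z.X⁻¹ a b := by
  simp [coneFreeGradForm_apply, Matrix.trace_mul_single, (isSymm_inv_X hz).apply a b,
    (isSymm_inv_one_sub_X hz).apply a b]
  ring

theorem coneFreeGradForm_single_vector (i : Fin n) :
    coneFreeGradForm (d := d) t z (mkPoint 0 (Pi.single i 1)) = t := by
  simp [coneFreeGradForm_apply]

theorem slope_mkPoint_zero_single (i j : Fin n) :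
    slope P z i (mkPoint 0 (Pi.single j 1)) = if i = j then z.y i else 0 := by
  simp [slope_apply, symPart, Pi.single_apply]

theorem kktForm_single_matrix_single_matrix (hz : z ∈ domain k P) (a b c e : Fin d) :
    kktForm P t z (Pi.single (.inl (a, b)) 1) (Pi.single (.inl (c, e)) 1) =
      kkt P t z (.inl (a, b)) (.inl (c, e)) := by
  have hsum (f g : Fin n → ℝ) : ∑ i, 1 / residual P z i * (f i + g i) =
      (∑ i, 2 / residual P z i * f i + ∑ i, 2 / residual P z i * g i) / 2 := by
    rw [← Finset.sum_add_distrib, Finset.sum_div]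
    exact Finset.sum_congr rfl fun i _ => by ring
  simp only [kktForm_apply, direction_single_matrix, mkPoint_X, mkPoint_y,
    trace_transpose_single_mul_single_mul (isSymm_inv_X hz),
    trace_transpose_single_mul_single_mul (isSymm_inv_one_sub_X hz),
    inner_applyTo_single_add_inner, Pi.zero_apply, mul_zero, sub_zero, hsum]
  simp [kkt, Finset.mul_sum, mul_left_comm]

theorem trace_single_one (a b : Fin d) :
    (Matrix.single a b (1 : ℝ)).trace = (1 : Matrix (Fin d) (Fin d) ℝ) a b := by
  rcases eq_or_ne a b with rfl | h
  · simp
  · simp [Matrix.trace_single_eq_of_ne _ _ _ h, Matrix.one_apply_ne h]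

theorem toMatrix'_kktForm (hz : z ∈ domain k P) :
    LinearMap.BilinForm.toMatrix' (kktForm P t z) = kkt P t z := by
  ext r c
  rw [LinearMap.BilinForm.toMatrix'_apply]
  rcases r with ⟨a, b⟩ | i | i | _ | _ <;> rcases c with ⟨c, e⟩ | j | j | _ | _
  · exact kktForm_single_matrix_single_matrix hz a b c e
  case inr.inl.inr.inl | inr.inl.inr.inr.inl | inr.inr.inl.inr.inl | inr.inr.inl.inr.inr.inl =>
    by_cases h : j = i <;>
    simp [kktForm_apply, coneRow_apply, direction_single_vector, direction_single_multiplier, kkt,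
      slope_mkPoint_zero_single, Pi.single_apply, h, eq_comm (a := i)]
  all_goals
    simp [kktForm_apply, coneRow_apply, direction_single_matrix, direction_single_vector,
      direction_single_multiplier, kkt, coneFreeGradForm_single_matrix hz,
      coneFreeGradForm_single_vector, slope_mkPoint_zero_single, slope_mkPoint_single,
      Pi.single_apply, trace_single_one]

theorem dotProduct_kkt_mulVec (hz : z ∈ domain k P) (w x : KktIndex n d → ℝ) :
    w ⬝ᵥ kkt P t z *ᵥ x = kktForm P t z w x := by
  rw [← toMatrix'_kktForm hz, ← Matrix.toBilin'_apply', Matrix.toBilin'_toMatrix']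

theorem kktForm_eq_sub_sum_sq (hz : z ∈ domain k P) (w x : KktIndex n d → ℝ) :
    kktForm P t z w x = hessForm P z (direction w) (direction x) +
      x (scaleIndex n d) * gradForm P t z (direction w) +
      w (scaleIndex n d) * gradForm P t z (direction x) +
      (x (traceIndex n d) * (direction w).X.trace + w (traceIndex n d) * (direction x).X.trace) -
      w (scaleIndex n d) * x (scaleIndex n d) -
      ∑ i, residual P z i ^ 2 / 4 *
        ((w (.inr (.inr (.inl i))) - 4 / residual P z i ^ 2 * coneRow P z i w) *
          (x (.inr (.inr (.inl i))) - 4 / residual P z i ^ 2 * coneRow P z i x)) := by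
  have hcone (i : Fin n) : residual P z i ^ 2 / 4 *
        ((w (.inr (.inr (.inl i))) - 4 / residual P z i ^ 2 * coneRow P z i w) *
          (x (.inr (.inr (.inl i))) - 4 / residual P z i ^ 2 * coneRow P z i x)) =
      4 / residual P z i ^ 2 * (slope P z i (direction w) * slope P z i (direction x)) -
        x (scaleIndex n d) * (2 / residual P z i * slope P z i (direction w)) -
        w (scaleIndex n d) * (2 / residual P z i * slope P z i (direction x)) +
        w (scaleIndex n d) * x (scaleIndex n d) -
        (x (.inr (.inr (.inl i))) * coneRow P z i w + w (.inr (.inr (.inl i))) * coneRow P z i x -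
          residual P z i ^ 2 / 4 * (w (.inr (.inr (.inl i))) * x (.inr (.inr (.inl i))))) := by
    have := (residual_pos hz i).ne'
    simp only [coneRow_apply]
    field_simp
    ring
  simp only [hcone, kktForm_apply, hessForm_apply, coneHessForm_apply, gradForm_apply,
    coneFreeGradForm_apply, Finset.sum_add_distrib, Finset.sum_sub_distrib, ← Finset.mul_sum,
    Finset.sum_const, Finset.card_univ, Fintype.card_fin, nsmul_eq_mul]
  ring

section Solution

variable {x : KktIndex n d → ℝ} {ρ : ℝ}

theorem multiplier_eq (hz : z ∈ domain k P) (hx : kkt P t z *ᵥ x = Pi.single (scaleIndex n d) ρ)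
    (i : Fin n) : x (.inr (.inr (.inl i))) = 4 / residual P z i ^ 2 * coneRow P z i x := by
  have h := dotProduct_kkt_mulVec (t := t) hz (Pi.single (.inr (.inr (.inl i))) 1) x
  have hq := (residual_pos hz i).ne'
  simpa [hx, kktForm_eq_sub_sum_sq hz, direction_single_multiplier, coneRow_apply,
    Pi.single_apply, hq, sub_eq_zero] using h.symm

theorem hessForm_direction_add (hz : z ∈ domain k P)
    (hx : kkt P t z *ᵥ x = Pi.single (scaleIndex n d) ρ) (w : KktIndex n d → ℝ) :
    hessForm P z (direction w) (direction x) +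
      x (scaleIndex n d) * gradForm P t z (direction w) +
      w (scaleIndex n d) * gradForm P t z (direction x) +
      (x (traceIndex n d) * (direction w).X.trace + w (traceIndex n d) * (direction x).X.trace) -
      w (scaleIndex n d) * x (scaleIndex n d) = w (scaleIndex n d) * ρ := by
  have h := dotProduct_kkt_mulVec (t := t) hz w x
  simp only [hx, dotProduct_single, kktForm_eq_sub_sum_sq hz, multiplier_eq hz hx, sub_self,
    mul_zero, Finset.sum_const_zero, sub_zero] at h
  exact h.symm

theorem trace_direction_eq_zero (hz : z ∈ domain k P)
    (hx : kkt P t z *ᵥ x = Pi.single (scaleIndex n d) ρ) : (direction x).X.trace = 0 := by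
  simpa [direction_single_multiplier] using
    hessForm_direction_add hz hx (Pi.single (traceIndex n d) 1)

theorem gradForm_direction_eq (hz : z ∈ domain k P)
    (hx : kkt P t z *ᵥ x = Pi.single (scaleIndex n d) ρ) :
    gradForm P t z (direction x) = ρ + x (scaleIndex n d) := by
  have h := hessForm_direction_add hz hx (Pi.single (scaleIndex n d) 1)
  simp [direction_single_multiplier] at h
  linarith

theorem hessForm_right_direction_eq (hz : z ∈ domain k P)
    (hx : kkt P t z *ᵥ x = Pi.single (scaleIndex n d) ρ) (v : Point n d) :
    hessForm P z v (direction x) =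
      -(x (scaleIndex n d) * gradForm P t z v + x (traceIndex n d) * v.X.trace) := by
  have hv : direction (Sum.elim (fun ab => v.X ab.1 ab.2) (Sum.elim v.y 0)) = v :=
    Point.ext_components rfl fun _ => rfl
  have h := hessForm_direction_add hz hx (Sum.elim (fun ab => v.X ab.1 ab.2) (Sum.elim v.y 0))
  simp only [hv, Sum.elim_inr, Pi.zero_apply] at h
  linarith

theorem isUnit_det_kkt (hz : z ∈ domain k P) (hd : d ≠ 0) : IsUnit (kkt P t z).det := by
  rw [isUnit_iff_ne_zero]
  intro hdet
  obtain ⟨x, hx0, hx⟩ := Matrix.exists_mulVec_eq_zero_iff.2 hdet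
  replace hx : kkt P t z *ᵥ x = Pi.single (scaleIndex n d) 0 := by rw [hx, Pi.single_zero]
  have hess := hessForm_right_direction_eq hz hx (direction x)
  rw [gradForm_direction_eq hz hx, trace_direction_eq_zero hz hx] at hess
  have hdir : direction x = 0 := eq_zero_of_hessForm_self_eq_zero hz <|
    le_antisymm (by nlinarith [mul_self_nonneg (x (scaleIndex n d))]) (hessForm_self_nonneg hz _)
  have hscale : x (scaleIndex n d) = 0 := by
    have := gradForm_direction_eq hz hx
    rwa [hdir, map_zero, zero_add, eq_comm] at this
  have htrace : x (traceIndex n d) = 0 := by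
    simpa [hdir, hscale, hd] using hessForm_right_direction_eq hz hx (mkPoint 1 0)
  refine hx0 (funext ?_)
  rintro (⟨a, b⟩ | i | i | _ | _)
  · exact congrFun₂ (congrArg Point.X hdir) a b
  · exact congrFun (congrArg Point.y hdir) i
  · rw [multiplier_eq hz hx, coneRow_apply, hdir, hscale, map_zero, mul_zero, sub_zero, mul_zero,
      Pi.zero_apply]
  · exact htrace
  · exact hscale

end Solution

section Transposition

/-- Transposition of the matrix component. -/
def Point.transpose (v : Point n d) : Point n d := mkPoint v.Xᵀ v.y

theorem slope_transpose (i : Fin n) (v : Point n d) :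
    slope P z i v.transpose = slope P z i v := by
  simp only [slope_apply, Point.transpose, mkPoint_X, mkPoint_y, symPart,
    Matrix.transpose_transpose, add_comm v.Xᵀ]

theorem trace_mul_transpose {S : Matrix (Fin d) (Fin d) ℝ} (hS : S.IsSymm)
    (U : Matrix (Fin d) (Fin d) ℝ) : (S * Uᵀ).trace = (S * U).trace := by
  rw [← Matrix.trace_transpose, Matrix.transpose_mul, hS.eq, Matrix.transpose_transpose,
    Matrix.trace_mul_comm]

theorem gradForm_transpose (hz : z ∈ domain k P) (v : Point n d) :
    gradForm P t z v.transpose = gradForm P t z v := by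
  simp only [gradForm_apply, slope_transpose]
  simp only [Point.transpose, mkPoint_X, mkPoint_y, trace_mul_transpose (isSymm_inv_X hz),
    trace_mul_transpose (isSymm_inv_one_sub_X hz)]

theorem trace_mul_mul_transpose_mul {S : Matrix (Fin d) (Fin d) ℝ} (hS : S.IsSymm)
    (U V : Matrix (Fin d) (Fin d) ℝ) : (U * S * Vᵀ * S).trace = (Uᵀ * S * V * S).trace := by
  rw [← Matrix.trace_transpose]
  simp only [Matrix.transpose_mul, Matrix.transpose_transpose, hS.eq, ← Matrix.mul_assoc]
  rw [Matrix.trace_mul_comm]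
  simp only [Matrix.mul_assoc]

theorem hessForm_transpose (hz : z ∈ domain k P) (u v : Point n d) :
    hessForm P z u.transpose v.transpose = hessForm P z u v := by
  simp only [hessForm_apply, coneHessForm_apply, slope_transpose]
  simp only [Point.transpose, mkPoint_X, mkPoint_y, Matrix.transpose_transpose,
    trace_mul_mul_transpose_mul (isSymm_inv_X hz),
    trace_mul_mul_transpose_mul (isSymm_inv_one_sub_X hz),
    add_comm (inner ℝ (applyTo u.Xᵀ _) _)]

theorem direction_mem_tangent {x : KktIndex n d → ℝ} {ρ : ℝ} (hz : z ∈ domain k P)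
    (hx : kkt P t z *ᵥ x = Pi.single (scaleIndex n d) ρ) : direction x ∈ tangent n d := by
  have hess (v : Point n d) :
      hessForm P z v (direction x).transpose = hessForm P z v (direction x) := by
    have h : hessForm P z v (direction x).transpose =
        hessForm P z v.transpose (direction x) := hessForm_transpose hz v.transpose (direction x)
    rw [h, hessForm_right_direction_eq hz hx, hessForm_right_direction_eq hz hx,
      gradForm_transpose hz]
    congr 3
  have hsub : (direction x).transpose - direction x = 0 :=
    eq_zero_of_hessForm_self_eq_zero hz <| by rw [map_sub, hess, sub_self]
  exact mem_tangent.2 ⟨congrArg Point.X (sub_eq_zero.1 hsub), trace_direction_eq_zero hz hx⟩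

end Transposition

section NewtonStep

/-- The direction `h` is `κ` times the Newton direction, where `κ = 1 / (1 + λ²)` for the Newton
decrement `λ`: this is the form in which the Newton system delivers its solution. -/
structure IsScaledNewtonStep (P : Fin n → EuclideanSpace ℝ (Fin d)) (t : ℝ) (z : Point n d)
    (κ : ℝ) (h : Point n d) : Prop where
  mem_tangent : h ∈ tangent n d
  hessForm_eq : ∀ v ∈ tangent n d, hessForm P z v h = κ * gradForm P t z v
  gradForm_eq : gradForm P t z h = 1 - κ

theorem isScaledNewtonStep_direction (hz : z ∈ domain k P) (hd : d ≠ 0) :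
    IsScaledNewtonStep P t z (-(kkt P t z)⁻¹ (scaleIndex n d) (scaleIndex n d))
      (direction ((kkt P t z)⁻¹.col (scaleIndex n d))) := by
  have hx : kkt P t z *ᵥ (kkt P t z)⁻¹.col (scaleIndex n d) = Pi.single (scaleIndex n d) 1 := by
    rw [← Matrix.mulVec_single_one, Matrix.mulVec_mulVec,
      Matrix.mul_nonsing_inv _ (isUnit_det_kkt hz hd), Matrix.one_mulVec]
  refine ⟨direction_mem_tangent hz hx, fun v hv => ?_, ?_⟩
  · rw [hessForm_right_direction_eq hz hx, (mem_tangent.1 hv).2, mul_zero, add_zero, ← neg_mul]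
    rfl
  · rw [gradForm_direction_eq hz hx, sub_neg_eq_add]
    rfl

namespace IsScaledNewtonStep

variable {κ : ℝ} {h : Point n d} (hh : IsScaledNewtonStep P t z κ h)
include hh

theorem hessForm_self_eq : hessForm P z h h = κ * (1 - κ) := by
  rw [hh.hessForm_eq h hh.mem_tangent, hh.gradForm_eq]

theorem scale_pos (hz : z ∈ domain k P) : 0 < κ := by
  have hess := hh.hessForm_self_eq
  have hnonneg := hessForm_self_nonneg hz h
  have hne : κ ≠ 0 := by
    rintro rfl
    have hgrad := hh.gradForm_eq
    rw [eq_zero_of_hessForm_self_eq_zero hz (hess.trans (zero_mul _))] at hgrad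
    simp at hgrad
  by_contra! hneg
  nlinarith [hneg.lt_of_ne hne]

theorem decrement_eq (hz : z ∈ domain k P) : decrement P t z = √((1 - κ) / κ) := by
  have hκ := (hh.scale_pos hz).ne'
  rw [decrement_eq_sqrt_gradForm hz ((tangent n d).smul_mem κ⁻¹ hh.mem_tangent) fun v hv => by
    rw [hessForm_comm hz, map_smul, hh.hessForm_eq v hv, smul_eq_mul, inv_mul_cancel_left₀ hκ],
    map_smul, hh.gradForm_eq, smul_eq_mul, inv_mul_eq_div]

theorem sub_mem_domain_and_relaxation_sub_le (hz : z ∈ domain k P) :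
    z - h ∈ domain k P ∧ relaxation P t (z - h) ≤ relaxation P t z - (1 - κ) ^ 2 := by
  have hess : hessForm P z (-h) (-h) = κ * (1 - κ) := by
    rw [map_neg, map_neg, LinearMap.neg_apply, neg_neg, hh.hessForm_self_eq]
  obtain ⟨hmem, hle⟩ := add_mem_domain_and_relaxation_add_le (t := t) hz
    (neg_mem hh.mem_tangent) (by rw [hess]; nlinarith [sq_nonneg (κ - 1 / 2)])
  rw [hess, map_neg, hh.gradForm_eq] at hle
  rw [sub_eq_add_neg]
  exact ⟨hmem, by linarith⟩

end IsScaledNewtonStep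

end NewtonStep

end NewtonSystem

section MemoryAccess

@[simp] theorem writeNat_real (s : Memory) (b i x : ℕ) : (s.writeNat b i x).real = s.real := rfl

@[simp] theorem writeReal_nat (s : Memory) (b i : ℕ) (x : ℝ) :
    (s.writeReal b i x).nat = s.nat := rfl

@[simp] theorem writeNat_nat_self (s : Memory) (b i x : ℕ) :
    (s.writeNat b i x).nat b = Function.update (s.nat b) i x := Function.update_self ..

@[simp] theorem writeReal_real_self (s : Memory) (b i : ℕ) (x : ℝ) :
    (s.writeReal b i x).real b = Function.update (s.real b) i x := Function.update_self ..

theorem writeNat_nat_of_ne (s : Memory) {b c : ℕ} (h : c ≠ b) (i x : ℕ) :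
    (s.writeNat b i x).nat c = s.nat c := Function.update_of_ne h ..

theorem writeReal_real_of_ne (s : Memory) {b c : ℕ} (h : c ≠ b) (i : ℕ) (x : ℝ) :
    (s.writeReal b i x).real c = s.real c := Function.update_of_ne h ..

/-- The memories `s` and `s'` differ at most in the arrays of natural numbers with names in `A` and
in the real arrays with names in `R`. -/
structure AgreesOff (A R : Set ℕ) (s s' : Memory) : Prop where
  nat : ∀ b ∉ A, s'.nat b = s.nat b
  real : ∀ b ∉ R, s'.real b = s.real b

namespace AgreesOff

variable {A A' R R' : Set ℕ} {s s' s'' : Memory}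

theorem refl (A R : Set ℕ) (s : Memory) : AgreesOff A R s s := ⟨fun _ _ => rfl, fun _ _ => rfl⟩

theorem trans (h : AgreesOff A R s s') (h' : AgreesOff A R s' s'') : AgreesOff A R s s'' :=
  ⟨fun b hb => (h'.nat b hb).trans (h.nat b hb), fun b hb => (h'.real b hb).trans (h.real b hb)⟩

theorem mono (h : AgreesOff A R s s') (hA : A ⊆ A') (hR : R ⊆ R') : AgreesOff A' R' s s' :=
  ⟨fun b hb => h.nat b fun hb' => hb (hA hb'), fun b hb => h.real b fun hb' => hb (hR hb')⟩

theorem writeNat (h : AgreesOff A R s s') {b : ℕ} (hb : b ∈ A) (i x : ℕ) :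
    AgreesOff A R s (s'.writeNat b i x) :=
  ⟨fun c hc => (writeNat_nat_of_ne _ (by rintro rfl; exact hc hb) _ _).trans (h.nat c hc), h.real⟩

theorem writeReal (h : AgreesOff A R s s') {b : ℕ} (hb : b ∈ R) (i : ℕ) (x : ℝ) :
    AgreesOff A R s (s'.writeReal b i x) :=
  ⟨h.nat,
    fun c hc => (writeReal_real_of_ne _ (by rintro rfl; exact hc hb) _ _).trans (h.real c hc)⟩

end AgreesOff

end MemoryAccess

section Frame

/-- A strict upper bound for the names of the arrays to which a program writes. -/
def Prog.bound : Prog → ℕ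
  | .skip => 0
  | .setNat b _ _ => b + 1
  | .setReal b _ _ => b + 1
  | .seq p q => max p.bound q.bound
  | .ite _ p q => max p.bound q.bound
  | .while _ p => p.bound

variable {p : Prog} {s s' : Memory} {τ : ℕ}

theorem Exec.agreesOff_bound (h : Exec p s s' τ) :
    AgreesOff (Set.Iio p.bound) (Set.Iio p.bound) s s' := by
  have left (p q : Prog) : Set.Iio p.bound ⊆ Set.Iio (max p.bound q.bound) :=
    Set.Iio_subset_Iio (le_max_left _ _)
  have right (p q : Prog) : Set.Iio q.bound ⊆ Set.Iio (max p.bound q.bound) :=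
    Set.Iio_subset_Iio (le_max_right _ _)
  induction h with
  | skip s => exact .refl ..
  | setNat s b i u =>
    exact (AgreesOff.refl _ _ s).writeNat (Set.mem_Iio.2 b.lt_succ_self) _ _
  | setReal s b i u =>
    exact (AgreesOff.refl _ _ s).writeReal (Set.mem_Iio.2 b.lt_succ_self) _ _
  | seq _ _ ih₁ ih₂ =>
    exact (ih₁.mono (left _ _) (left _ _)).trans (ih₂.mono (right _ _) (right _ _))
  | iteTrue _ _ ih => exact ih.mono (left _ _) (left _ _)
  | iteFalse _ _ ih => exact ih.mono (right _ _) (right _ _)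
  | whileTrue _ _ _ ih₁ ih₂ => exact ih₁.trans ih₂
  | whileFalse _ => exact .refl ..

theorem Exec.encard_changed_le (h : Exec p s s' τ) (b : ℕ) :
    {i | s'.real b i ≠ s.real b i}.encard ≤ τ := by
  have changed_trans (s s' s'' : Memory) : {i | s''.real b i ≠ s.real b i} ⊆
      {i | s'.real b i ≠ s.real b i} ∪ {i | s''.real b i ≠ s'.real b i} := by
    intro i hi
    by_contra hcon
    simp only [Set.mem_union, Set.mem_ofPred_eq, not_or, not_not] at hcon
    exact hi (hcon.2.trans hcon.1)
  induction h with
  | skip s => simp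
  | setNat s c i u => simp
  | setReal s c i u =>
    have hsub : {j | (s.writeReal c (i.eval s) (u.eval s)).real b j ≠ s.real b j} ⊆
        {i.eval s} := by
      intro j hj
      by_contra hne
      by_cases hb : b = c
      · subst hb
        exact hj (by rw [writeReal_real_self, Function.update_of_ne hne])
      · exact hj (by rw [writeReal_real_of_ne _ hb])
    calc _ ≤ ({i.eval s} : Set ℕ).encard := Set.encard_le_encard hsub
      _ ≤ _ := by rw [Set.encard_singleton]; exact_mod_cast Nat.le_add_left 1 _
  | seq _ _ ih₁ ih₂ =>
    push_cast
    exact (Set.encard_le_encard (changed_trans _ _ _)).trans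
      ((Set.encard_union_le _ _).trans (add_le_add ih₁ ih₂))
  | iteTrue _ _ ih => exact ih.trans (by exact_mod_cast Nat.le_add_left _ _)
  | iteFalse _ _ ih => exact ih.trans (by exact_mod_cast Nat.le_add_left _ _)
  | whileTrue _ _ _ ih₁ ih₂ =>
    push_cast
    exact (Set.encard_le_encard (changed_trans _ _ _)).trans ((Set.encard_union_le _ _).trans
      (add_le_add (ih₁.trans le_add_self) ih₂))
  | whileFalse _ => simp

end Frame

section RowMajor

variable {l m : ℕ}

theorem mul_add_div (i : ℕ) (j : Fin m) : (i * m + j) / m = i := by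
  rw [mul_comm, Nat.mul_add_div j.pos, Nat.div_eq_of_lt j.2, add_zero]

theorem mul_add_mod (i : ℕ) (j : Fin m) : (i * m + j) % m = j := by
  rw [mul_comm, Nat.mul_add_mod, Nat.mod_eq_of_lt j.2]

theorem mul_add_inj {i i' : ℕ} {j j' : Fin m} : i * m + j = i' * m + j' ↔ i = i' ∧ j = j' := by
  refine ⟨fun h => ⟨?_, Fin.ext ?_⟩, by rintro ⟨rfl, rfl⟩; rfl⟩
  · rw [← mul_add_div i j, h, mul_add_div]
  · rw [← mul_add_mod i j, h, mul_add_mod]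

theorem mul_add_lt (i : Fin l) (j : Fin m) : (i : ℕ) * m + j < l * m :=
  calc (i : ℕ) * m + j < (i + 1) * m := by rw [add_one_mul]; omega
    _ ≤ l * m := Nat.mul_le_mul_right _ i.2

theorem exists_eq_mul_add {r : ℕ} (hr : r < l * m) : ∃ (i : Fin l) (j : Fin m), r = i * m + j :=
  have hm : 0 < m := Nat.pos_of_mul_pos_left (Nat.zero_lt_of_lt hr)
  ⟨⟨r / m, Nat.div_lt_of_lt_mul (by rwa [mul_comm])⟩, ⟨r % m, Nat.mod_lt _ hm⟩,
    (Nat.div_add_mod' r m).symm⟩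

end RowMajor

section InversionExponent

/-- The program inverts real `m × m` matrices in time `C * m ^ ω`; see `InversionTime`. -/
def Inverts (inv : Prog) (C ω : ℝ) : Prop :=
  ∀ (m : ℕ), 1 ≤ m → ∀ A : Matrix (Fin m) (Fin m) ℝ, IsUnit A.det →
    ∀ s : Memory, s.nat 0 0 = m → (∀ i j : Fin m, s.real 0 (i * m + j) = A i j) →
      ∃ (s' : Memory) (τ : ℕ), Exec inv s s' τ ∧ (τ : ℝ) ≤ C * (m : ℝ) ^ ω ∧
        ∀ i j : Fin m, s'.real 1 (i * m + j) = A⁻¹ i j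

variable {inv : Prog} {C ω : ℝ}

-- If the output array is initially filled with the number 2, inverting the identity matrix has to
-- change each of its first `m ^ 2` cells.
theorem Inverts.sq_le (hinv : Inverts inv C ω) {m : ℕ} (hm : 1 ≤ m) :
    (m : ℝ) ^ 2 ≤ C * (m : ℝ) ^ ω := by
  let s : Memory :=
    { nat := fun _ _ => m
      real := fun b r => if b = 0 then (if r / m = r % m then 1 else 0) else 2 }
  have hs (i j : Fin m) : s.real 0 (i * m + j) = (1 : Matrix (Fin m) (Fin m) ℝ) i j := by
    simp only [s, if_true, mul_add_div, mul_add_mod, Matrix.one_apply, Fin.ext_iff]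
  obtain ⟨s', τ, hexec, hτ, hs'⟩ := hinv m hm 1 (by simp) s rfl hs
  have hsub : (Finset.range (m * m) : Set ℕ) ⊆ {r | s'.real 1 r ≠ s.real 1 r} := by
    intro r hr
    obtain ⟨i, j, rfl⟩ := exists_eq_mul_add (Finset.mem_range.1 hr)
    change s'.real 1 _ ≠ 2
    rw [hs', inv_one, Matrix.one_apply]
    split_ifs <;> norm_num
  have hcard := (Set.encard_le_encard hsub).trans (hexec.encard_changed_le 1)
  rw [Set.encard_coe_eq_coe_finsetCard, Finset.card_range] at hcard
  have hle : ((m * m : ℕ) : ℝ) ≤ τ := by exact_mod_cast hcard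
  rw [sq, ← Nat.cast_mul]
  exact hle.trans hτ

theorem Inverts.nonneg (hinv : Inverts inv C ω) : 0 ≤ C := by
  have := hinv.sq_le le_rfl
  simp only [Nat.cast_one, one_pow, Real.one_rpow, mul_one] at this
  linarith

theorem Inverts.two_le (hinv : Inverts inv C ω) : 2 ≤ ω := by
  by_contra! hω
  have htend : Filter.Tendsto (fun m : ℕ => (m : ℝ) ^ (2 - ω)) Filter.atTop Filter.atTop :=
    (tendsto_rpow_atTop (sub_pos.2 hω)).comp tendsto_natCast_atTop_atTop
  obtain ⟨m, hC, hm⟩ :=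
    ((htend.eventually_gt_atTop C).and (Filter.eventually_ge_atTop 1)).exists
  have hm0 : (0 : ℝ) < m := by exact_mod_cast hm
  rw [Real.rpow_sub hm0, lt_div_iff₀ (Real.rpow_pos_of_pos hm0 _), Real.rpow_two] at hC
  exact hC.not_ge (hinv.sq_le hm)

end InversionExponent

section Runs

/-- The program halts within time `T` in a memory satisfying `Q`. -/
def Runs (p : Prog) (s : Memory) (T : ℝ) (Q : Memory → Prop) : Prop :=
  ∃ (s' : Memory) (τ : ℕ), Exec p s s' τ ∧ (τ : ℝ) ≤ T ∧ Q s'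

variable {p q : Prog} {s : Memory} {T T' : ℝ} {Q Q' : Memory → Prop}

theorem Runs.mono (h : Runs p s T Q) (hT : T ≤ T') (hQ : ∀ s', Q s' → Q' s') :
    Runs p s T' Q' :=
  let ⟨s', τ, hexec, hτ, hs'⟩ := h
  ⟨s', τ, hexec, hτ.trans hT, hQ _ hs'⟩

theorem Runs.imp (h : Runs p s T Q) (hQ : ∀ s', Q s' → Q' s') : Runs p s T Q' :=
  h.mono le_rfl hQ

theorem Runs.seq (h : Runs p s T Q) (h' : ∀ s', Q s' → Runs q s' T' Q') :
    Runs (.seq p q) s (T + T') Q' := by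
  obtain ⟨s', τ, hexec, hτ, hs'⟩ := h
  obtain ⟨s'', τ', hexec', hτ', hs''⟩ := h' s' hs'
  exact ⟨s'', τ + τ', hexec.seq hexec', by push_cast; linarith, hs''⟩

theorem runs_setNat (s : Memory) (b : ℕ) (i u : NExp) :
    Runs (.setNat b i u) s (i.cost + u.cost + 1)
      (fun s' => s' = s.writeNat b (i.eval s) (u.eval s)) :=
  ⟨_, _, Exec.setNat s b i u, by push_cast; rfl, rfl⟩

theorem runs_setReal (s : Memory) (b : ℕ) (i : NExp) (u : RExp) :
    Runs (.setReal b i u) s (i.cost + u.cost + 1)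
      (fun s' => s' = s.writeReal b (i.eval s) (u.eval s)) :=
  ⟨_, _, Exec.setReal s b i u, by push_cast; rfl, rfl⟩

/-- The natural number in cell `0` of the array `c`. -/
abbrev NExp.var (c : ℕ) : NExp := .get c (.lit 0)

/-- A natural number as a real constant. -/
abbrev RExp.lit (c : ℕ) : RExp := .ofNat (.lit c)

theorem runs_while {c : Test} (hT : 0 ≤ T) {I : ℕ → Memory → Prop} (hzero : ∀ s, ¬ I 0 s)
    (hstep : ∀ j s, I (j + 1) s → c.Holds s → Runs p s T (I j)) (j : ℕ) (hs : I j s) :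
    Runs (.while c p) s (j * (T + c.cost)) (fun s' => ¬ c.Holds s' ∧ ∃ j, I j s') := by
  induction j generalizing s with
  | zero => exact absurd hs (hzero s)
  | succ j ih =>
    by_cases hc : c.Holds s
    · obtain ⟨s', τ, hexec, hτ, hs'⟩ := hstep j s hs hc
      obtain ⟨s'', τ', hexec', hτ', hs''⟩ := ih hs'
      exact ⟨s'', _, .whileTrue hc hexec hexec', by push_cast; linarith, hs''⟩
    · refine ⟨s, _, .whileFalse hc, ?_, hc, j + 1, hs⟩
      have : 0 ≤ (j : ℝ) * (T + c.cost) := by positivity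
      push_cast
      linarith

/-- Execute the body for `c = 0, …, N - 1`. -/
def forLoop (c : ℕ) (N : NExp) (body : Prog) : Prog :=
  .seq (.setNat c (.lit 0) (.lit 0)) (.while (.natLt (.var c) N)
    (.seq body (.setNat c (.lit 0) (.add (.var c) (.lit 1)))))

theorem runs_forLoop {c K : ℕ} {N : NExp} {body : Prog} (hT : 0 ≤ T) {I : ℕ → Memory → Prop}
    (hcounter : ∀ i s x, I i s → I i (s.writeNat c 0 x)) (hN : ∀ i s, I i s → N.eval s = K)
    (hbody : ∀ i < K, ∀ s, s.nat c 0 = i → I i s →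
      Runs body s T (fun s' => s'.nat c 0 = i ∧ I (i + 1) s')) (hs : I 0 s) :
    Runs (forLoop c N body) s ((K + 1) * (T + N.cost + 12)) (I K) := by
  let J (j : ℕ) (s : Memory) : Prop := ∃ i ≤ K, i + j = K + 1 ∧ s.nat c 0 = i ∧ I i s
  have step (j : ℕ) (s : Memory) (hJ : J (j + 1) s) (hc : (Test.natLt (.var c) N).Holds s) :
      Runs (.seq body (.setNat c (.lit 0) (.add (.var c) (.lit 1)))) s (T + 6) (J j) := by
    obtain ⟨i, -, hij, hci, hI⟩ := hJ
    have hi : i < K := by simpa [Test.Holds, NExp.eval, hci, hN i s hI] using hc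
    refine (hbody i hi s hci hI).seq fun s' ⟨hc', hI'⟩ => (runs_setNat ..).mono ?_ ?_
    · norm_num [NExp.cost]
    · rintro _ rfl
      exact ⟨i + 1, hi, by omega, by simp [NExp.eval, hc'], hcounter _ _ _ hI'⟩
  refine ((runs_setNat s c (.lit 0) (.lit 0)).seq fun s' hs' =>
    runs_while (I := J) (by positivity) ?_ step (K + 1) ?_).mono ?_ ?_
  · rintro s ⟨i, hi, hij, -⟩
    omega
  · subst hs'
    exact ⟨0, K.zero_le, by omega, by simp [NExp.eval], hcounter _ _ _ hs⟩
  · simp only [NExp.cost, Test.cost]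
    push_cast
    nlinarith [Nat.cast_nonneg (α := ℝ) K]
  · rintro s' ⟨hc, _, i, hi, -, hci, hI⟩
    have hKi : K ≤ i := by simpa [Test.Holds, NExp.eval, hci, hN i s' hI] using hc
    rwa [hi.antisymm hKi] at hI

end Runs

section ConditionalExpressions

/-- Real expressions with case distinctions. -/
inductive CExp where
  | ret (u : RExp)
  | cond (u v : NExp) (p q : CExp)

/-- Value of a conditional expression. -/
def CExp.eval (s : Memory) : CExp → ℝ
  | .ret u => u.eval s
  | .cond u v p q => if u.eval s < v.eval s then p.eval s else q.eval s

/-- Bound for the number of operations in the evaluation of a conditional expression; both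
branches count. -/
def CExp.cost : CExp → ℕ
  | .ret u => u.cost
  | .cond u v p q => u.cost + v.cost + 1 + (p.cost + q.cost)

/-- Assignment of a conditional expression. -/
def CExp.assign (b : ℕ) (i : NExp) : CExp → Prog
  | .ret u => .setReal b i u
  | .cond u v p q => .ite (.natLt u v) (p.assign b i) (q.assign b i)

/-- Case distinction on equality. -/
def CExp.ifEq (u v : NExp) (p q : CExp) : CExp := .cond u v q (.cond v u q p)

theorem CExp.eval_ifEq (s : Memory) (u v : NExp) (p q : CExp) :
    (CExp.ifEq u v p q).eval s = if u.eval s = v.eval s then p.eval s else q.eval s := by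
  simp only [CExp.ifEq, CExp.eval]
  split_ifs <;> first | rfl | omega

theorem runs_assign (s : Memory) (b : ℕ) (i : NExp) (e : CExp) :
    Runs (e.assign b i) s (i.cost + e.cost + 1)
      (fun s' => s' = s.writeReal b (i.eval s) (e.eval s)) := by
  induction e with
  | ret u => exact runs_setReal s b i u
  | cond u v p q ihp ihq =>
    by_cases h : u.eval s < v.eval s
    · obtain ⟨s', τ, hexec, hτ, hs'⟩ := ihp
      refine ⟨s', _, .iteTrue h hexec, ?_, by simpa [CExp.eval, h] using hs'⟩
      simp only [Test.cost, CExp.cost]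
      push_cast
      linarith [Nat.cast_nonneg (α := ℝ) q.cost]
    · obtain ⟨s', τ, hexec, hτ, hs'⟩ := ihq
      refine ⟨s', _, .iteFalse h hexec, ?_, by simpa [CExp.eval, h] using hs'⟩
      simp only [Test.cost, CExp.cost]
      push_cast
      linarith [Nat.cast_nonneg (α := ℝ) p.cost]

end ConditionalExpressions

section ArrayLoops

variable {c c₁ c₂ b K M : ℕ} {N L : NExp} {s : Memory} {A : Set ℕ} {Φ : ℕ → ℝ → Prop}

theorem runs_forLoop_cells {body : Prog} {T : ℝ} (hT : 0 ≤ T) (hc : c ∈ A)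
    (hN : ∀ s', AgreesOff A {b} s s' → N.eval s' = K)
    (hbody : ∀ r < K, ∀ s', AgreesOff A {b} s s' → s'.nat c 0 = r → s'.real b r = s.real b r →
      Runs body s' T (fun s'' => AgreesOff (A \ {c}) {b} s' s'' ∧
        (∀ r', r' ≠ r → s''.real b r' = s'.real b r') ∧ Φ r (s''.real b r))) :
    Runs (forLoop c N body) s ((K + 1) * (T + N.cost + 12))
      (fun s' => AgreesOff A {b} s s' ∧ ∀ r < K, Φ r (s'.real b r)) := by
  refine (runs_forLoop hT (I := fun i s' => AgreesOff A {b} s s' ∧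
      (∀ r < i, Φ r (s'.real b r)) ∧ ∀ r, i ≤ r → s'.real b r = s.real b r)
    (fun i s' x ⟨hs', hΦ, hrest⟩ => ⟨hs'.writeNat hc _ _, hΦ, hrest⟩) (fun i s' hI => hN s' hI.1)
    (fun i hi s' hci ⟨hs', hΦ, hrest⟩ => (hbody i hi s' hs' hci (hrest i le_rfl)).imp ?_)
    ⟨.refl .., by simp, fun _ _ => rfl⟩).imp fun s' hs' => ⟨hs'.1, hs'.2.1⟩
  rintro s'' ⟨hs'', hother, hcell⟩
  refine ⟨by rw [hs''.nat c (by simp), hci], hs'.trans (hs''.mono Set.sdiff_subset le_rfl),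
    fun r hr => ?_, fun r hr => by rw [hother r (by omega), hrest r (by omega)]⟩
  obtain rfl | hne := eq_or_ne r i
  · exact hcell
  · rw [hother r hne]
    exact hΦ r (by omega)

/-- `b[r] := e` for `r < N`; the counter `c` holds `r`. -/
def fill (c b : ℕ) (N : NExp) (e : CExp) : Prog := forLoop c N (e.assign b (.var c))

theorem runs_fill {e : CExp} (hc : c ∈ A) (hN : ∀ s', AgreesOff A {b} s s' → N.eval s' = K)
    (he : ∀ r < K, ∀ s', AgreesOff A {b} s s' → s'.nat c 0 = r → s'.real b r = s.real b r →
      Φ r (e.eval s')) :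
    Runs (fill c b N e) s ((K + 1) * (e.cost + N.cost + 15))
      (fun s' => AgreesOff A {b} s s' ∧ ∀ r < K, Φ r (s'.real b r)) := by
  refine (runs_forLoop_cells (T := e.cost + 3) (by positivity) hc hN
    fun r hr s' hs' hcr hbr => (runs_assign s' b (.var c) e).mono ?_ ?_).mono
    (le_of_eq (by ring)) fun _ h => h
  · simp only [NExp.cost]
    push_cast
    linarith
  · rintro _ rfl
    simp only [NExp.eval, hcr, writeReal_real_self, Function.update_self]
    exact ⟨(AgreesOff.refl _ _ s').writeReal (Set.mem_singleton b) _ _,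
      fun r' hr' => Function.update_of_ne hr' _ _,
      he r hr s' hs' hcr hbr⟩

theorem runs_forLoop_sum {e : RExp} {r : ℕ} (f : Fin M → ℝ) (hc : c₁ ≠ c₂)
    (hr : s.nat c₁ 0 = r) (hzero : s.real b r = 0)
    (hL : ∀ s', AgreesOff {c₂} {b} s s' → L.eval s' = M)
    (he : ∀ (l : Fin M) s', AgreesOff {c₂} {b} s s' → s'.nat c₂ 0 = l → e.eval s' = f l) :
    Runs (forLoop c₂ L (.setReal b (.var c₁) (.add (.get b (.var c₁)) e))) s
      ((M + 1) * (e.cost + L.cost + 20))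
      (fun s' => AgreesOff {c₂} {b} s s' ∧ (∀ r', r' ≠ r → s'.real b r' = s.real b r') ∧
        s'.real b r = ∑ l, f l) := by
  let g (l : ℕ) : ℝ := if h : l < M then f ⟨l, h⟩ else 0
  have hsum : ∑ l, f l = ∑ l ∈ Finset.range M, g l := by simp [Finset.sum_range, g]
  rw [hsum]
  refine (runs_forLoop (K := M) (T := e.cost + 8) (by positivity)
    (I := fun i s' => AgreesOff {c₂} {b} s s' ∧ (∀ r', r' ≠ r → s'.real b r' = s.real b r') ∧
      s'.real b r = ∑ l ∈ Finset.range i, g l)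
    (fun i s' x ⟨hs', hother, hcell⟩ =>
      ⟨hs'.writeNat (Set.mem_singleton c₂) _ _, hother, hcell⟩)
    (fun i s' hI => hL s' hI.1) (fun i hi s' hci ⟨hs', hother, hcell⟩ =>
      (runs_setReal s' b (.var c₁) (.add (.get b (.var c₁)) e)).mono ?_ ?_)
    ⟨.refl .., fun _ _ => rfl, by simpa using hzero⟩).mono (le_of_eq (by ring)) fun _ h => h
  · simp only [NExp.cost, RExp.cost]
    push_cast
    linarith
  · rintro _ rfl
    have hc₁ : s'.nat c₁ 0 = r := by rw [hs'.nat c₁ hc, hr]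
    have hei : e.eval s' = g i := by simpa [g, hi] using he ⟨i, hi⟩ s' hs' hci
    simp only [NExp.eval, RExp.eval, hc₁, hcell, hei, writeReal_nat, writeReal_real_self,
      Function.update_self, Finset.sum_range_succ, and_true]
    exact ⟨hci, hs'.writeReal (Set.mem_singleton b) _ _,
      fun r' hr' => by rw [Function.update_of_ne hr', hother r' hr']⟩

/-- `b[r] := ∑ e` for `r < N`, where the sum extends over `l < L`; the counters `c₁` and `c₂` hold
`r` and `l`. -/
def fillSum (c₁ c₂ b : ℕ) (N L : NExp) (e : RExp) : Prog :=
  forLoop c₁ N (.seq (.setReal b (.var c₁) (.lit 0))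
    (forLoop c₂ L (.setReal b (.var c₁) (.add (.get b (.var c₁)) e))))

theorem runs_fillSum {e : RExp} (hc : c₁ ≠ c₂)
    (hN : ∀ s', AgreesOff {c₁, c₂} {b} s s' → N.eval s' = K)
    (hL : ∀ s', AgreesOff {c₁, c₂} {b} s s' → L.eval s' = M)
    (he : ∀ r < K, ∃ f : Fin M → ℝ, Φ r (∑ l, f l) ∧ ∀ (l : Fin M) s', AgreesOff {c₁, c₂} {b} s s' →
      s'.nat c₁ 0 = r → s'.nat c₂ 0 = l → e.eval s' = f l) :
    Runs (fillSum c₁ c₂ b N L e) s ((K + 1) * (M + 1) * (e.cost + N.cost + L.cost + 40))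
      (fun s' => AgreesOff {c₁, c₂} {b} s s' ∧ ∀ r < K, Φ r (s'.real b r)) := by
  have hsub : ({c₂} : Set ℕ) ⊆ {c₁, c₂} := by simp
  have hsub' : ({c₂} : Set ℕ) ⊆ {c₁, c₂} \ {c₁} := by simp [hc.symm]
  refine (runs_forLoop_cells (T := 5 + (M + 1) * (e.cost + L.cost + 20)) (by positivity)
    (by simp) hN fun r hr s' hs' hcr _ => ?_).mono ?_ fun _ h => h
  · obtain ⟨f, hΦ, hf⟩ := he r hr
    refine ((runs_setReal s' b (.var c₁) (.lit 0)).mono (T' := 5) ?_ fun _ h => h).seq ?_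
    · norm_num [NExp.cost, RExp.cost]
    · rintro _ rfl
      simp only [NExp.eval, RExp.eval, hcr, Nat.cast_zero]
      have hzeroed : AgreesOff ({c₁, c₂} \ {c₁}) {b} s' (s'.writeReal b r 0) :=
        (AgreesOff.refl _ _ s').writeReal (Set.mem_singleton b) _ _
      have lift {s''} (h : AgreesOff {c₂} {b} (s'.writeReal b r 0) s'') :
          AgreesOff {c₁, c₂} {b} s s'' :=
        (hs'.trans (hzeroed.mono Set.sdiff_subset le_rfl)).trans (h.mono hsub le_rfl)
      refine (runs_forLoop_sum (s := s'.writeReal b r 0) f hc hcr (by simp)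
        (fun s'' h => hL s'' (lift h)) fun l s'' h hl => hf l s'' (lift h) ?_ hl).imp ?_
      · rw [h.nat c₁ hc, writeReal_nat, hcr]
      · rintro s'' ⟨hs'', hother, hcell⟩
        refine ⟨hzeroed.trans (hs''.mono hsub' le_rfl), fun r' hr' => ?_, by rwa [hcell]⟩
        rw [hother r' hr', writeReal_real_self, Function.update_of_ne hr']
  · rw [mul_assoc]
    refine mul_le_mul_of_nonneg_left ?_ (by positivity)
    nlinarith [mul_nonneg (Nat.cast_nonneg (α := ℝ) M) (Nat.cast_nonneg (α := ℝ) N.cost)]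

/-- Tables `hi` and `lo` of the quotients and the remainders modulo `D` of all numbers below
`N * D`. -/
def divTable (c₁ c₂ hi lo : ℕ) (N D : NExp) : Prog :=
  forLoop c₁ N (forLoop c₂ D
    (.seq (.setNat hi (.add (.mul (.var c₁) D) (.var c₂)) (.var c₁))
      (.setNat lo (.add (.mul (.var c₁) D) (.var c₂)) (.var c₂))))

/-- The tables `hi` and `lo` contain the quotients and the remainders modulo `m` of all numbers
below `r`. -/
def HoldsDivTable (hi lo m r : ℕ) (s : Memory) : Prop :=
  ∀ i (j : Fin m), i * m + j < r → s.nat hi (i * m + j) = i ∧ s.nat lo (i * m + j) = j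

theorem HoldsDivTable.congr {hi lo m r : ℕ} {s' : Memory} (h : HoldsDivTable hi lo m r s)
    (hhi : s'.nat hi = s.nat hi) (hlo : s'.nat lo = s.nat lo) : HoldsDivTable hi lo m r s' := by
  simpa only [HoldsDivTable, hhi, hlo] using h

theorem HoldsDivTable.succ {hi lo m i : ℕ} {j : Fin m} (h : HoldsDivTable hi lo m (i * m + j) s)
    (hne : hi ≠ lo) : HoldsDivTable hi lo m (i * m + j + 1)
      ((s.writeNat hi (i * m + j) i).writeNat lo (i * m + j) j) := by
  intro i' j' hlt
  rw [writeNat_nat_of_ne _ hne, writeNat_nat_self, writeNat_nat_self,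
    writeNat_nat_of_ne _ hne.symm]
  obtain heq | hne' := eq_or_ne (i' * m + (j' : ℕ)) (i * m + j)
  · obtain ⟨rfl, rfl⟩ := mul_add_inj.1 heq
    simp
  · rw [Function.update_of_ne hne', Function.update_of_ne hne']
    exact h i' j' (by omega)

theorem runs_divTable_row {hi lo m i : ℕ} {D : NExp} (h₁₂ : c₁ ≠ c₂) (h₁hi : c₁ ≠ hi)
    (h₁lo : c₁ ≠ lo) (h₂hi : c₂ ≠ hi) (h₂lo : c₂ ≠ lo) (hne : hi ≠ lo) (hi' : s.nat c₁ 0 = i)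
    (hD : ∀ s', AgreesOff {c₂, hi, lo} ∅ s s' → D.eval s' = m)
    (htable : HoldsDivTable hi lo m (i * m) s) :
    Runs (forLoop c₂ D (.seq (.setNat hi (.add (.mul (.var c₁) D) (.var c₂)) (.var c₁))
        (.setNat lo (.add (.mul (.var c₁) D) (.var c₂)) (.var c₂)))) s
      ((m + 1) * (3 * D.cost + 40))
      (fun s' => AgreesOff {c₂, hi, lo} ∅ s s' ∧ HoldsDivTable hi lo m ((i + 1) * m) s') := by
  refine (runs_forLoop (K := m) (T := 2 * D.cost + 28) (by positivity)
    (I := fun j s' => AgreesOff {c₂, hi, lo} ∅ s s' ∧ HoldsDivTable hi lo m (i * m + j) s')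
    (fun j s' x h => ⟨h.1.writeNat (by simp) _ _,
      h.2.congr (writeNat_nat_of_ne _ h₂hi.symm _ _) (writeNat_nat_of_ne _ h₂lo.symm _ _)⟩)
    (fun j s' h => hD s' h.1) (fun j hj s' hcj h => ?_) ⟨.refl .., htable⟩).mono
    (le_of_eq (by ring)) fun s' h => by rwa [add_one_mul]
  have hc₁ : s'.nat c₁ 0 = i := by rw [h.1.nat c₁ (by simp [h₁₂, h₁hi, h₁lo]), hi']
  have hquot := h.1.writeNat (b := hi) (by simp) (i * m + j) i
  refine ((runs_setNat s' hi _ _).seq (T' := D.cost + 9) fun s₁ hs₁ =>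
    (runs_setNat s₁ lo _ _).mono ?_ ?_).mono ?_ fun _ h => h
  · simp only [NExp.cost]
    push_cast
    linarith
  · rintro _ rfl
    subst hs₁
    simp only [NExp.eval, hc₁, hcj, hD s' h.1, hD _ hquot, writeNat_nat_of_ne _ h₁hi,
      writeNat_nat_of_ne _ h₂hi, writeNat_nat_of_ne _ h₂lo, true_and]
    exact ⟨hquot.writeNat (by simp) _ _, HoldsDivTable.succ (j := ⟨j, hj⟩) h.2 hne⟩
  · simp only [NExp.cost]
    push_cast
    linarith

theorem runs_divTable {hi lo m : ℕ} {D : NExp} (hnodup : [c₁, c₂, hi, lo].Nodup)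
    (hN : ∀ s', AgreesOff {c₁, c₂, hi, lo} ∅ s s' → N.eval s' = K)
    (hD : ∀ s', AgreesOff {c₁, c₂, hi, lo} ∅ s s' → D.eval s' = m) :
    Runs (divTable c₁ c₂ hi lo N D) s ((K + 1) * (m + 1) * (N.cost + 3 * D.cost + 60))
      (fun s' => AgreesOff {c₁, c₂, hi, lo} ∅ s s' ∧ HoldsDivTable hi lo m (K * m) s') := by
  simp only [List.nodup_cons, List.mem_cons, List.not_mem_nil, not_or, not_false_eq_true,
    List.nodup_nil, and_true] at hnodup
  obtain ⟨⟨h₁₂, h₁hi, h₁lo⟩, ⟨h₂hi, h₂lo⟩, hne⟩ := hnodup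
  have hsub : ({c₂, hi, lo} : Set ℕ) ⊆ {c₁, c₂, hi, lo} := Set.subset_insert _ _
  refine (runs_forLoop (K := K) (T := (m + 1) * (3 * D.cost + 40)) (by positivity)
    (I := fun i s' => AgreesOff {c₁, c₂, hi, lo} ∅ s s' ∧ HoldsDivTable hi lo m (i * m) s')
    (fun i s' x h => ⟨h.1.writeNat (by simp) _ _,
      h.2.congr (writeNat_nat_of_ne _ (Ne.symm h₁hi) _ _)
        (writeNat_nat_of_ne _ (Ne.symm h₁lo) _ _)⟩)
    (fun i s' h => hN s' h.1) (fun i _ s' hci h => ?_)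
    ⟨.refl .., fun i j hij => absurd hij (by simp)⟩).mono ?_ fun _ h => h
  · refine (runs_divTable_row h₁₂ h₁hi h₁lo h₂hi h₂lo hne hci
      (fun s'' h' => hD s'' (h.1.trans (h'.mono hsub le_rfl))) h.2).imp fun s'' h' =>
        ⟨?_, h.1.trans (h'.1.mono hsub le_rfl), h'.2⟩
    rw [h'.1.nat c₁ (by simp [h₁₂, h₁hi, h₁lo]), hci]
  · rw [mul_assoc]
    refine mul_le_mul_of_nonneg_left ?_ (by positivity)
    nlinarith [mul_nonneg (Nat.cast_nonneg (α := ℝ) m) (Nat.cast_nonneg (α := ℝ) N.cost)]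

end ArrayLoops

section KktNumbering

/-- The row-major numbering of the entries of a matrix. -/
def rowMajor (l m : ℕ) : Fin l × Fin m ≃ Fin (l * m) := finProdFinEquiv

theorem coe_rowMajor {l m : ℕ} (p : Fin l × Fin m) : (rowMajor l m p : ℕ) = p.1 * m + p.2 := by
  rw [rowMajor, finProdFinEquiv_apply_val, add_comm, mul_comm]

/-- The order of the matrix `kkt`. -/
abbrev kktSize (n d : ℕ) : ℕ := d * d + (n + (n + (1 + 1)))

/-- The numbering of the rows and columns of the matrix `kkt`. -/
def kktEquiv (n d : ℕ) : KktIndex n d ≃ Fin (kktSize n d) :=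
  (Equiv.sumCongr (rowMajor d d) ((Equiv.sumCongr (Equiv.refl _) ((Equiv.sumCongr (Equiv.refl _)
    ((Equiv.sumCongr finOneEquiv.symm finOneEquiv.symm).trans finSumFinEquiv)).trans
      finSumFinEquiv)).trans finSumFinEquiv)).trans finSumFinEquiv

variable {n d : ℕ}

theorem coe_kktEquiv_matrix (a b : Fin d) : (kktEquiv n d (.inl (a, b)) : ℕ) = a * d + b := by
  simp [kktEquiv, coe_rowMajor]

theorem coe_kktEquiv_slack (i : Fin n) : (kktEquiv n d (.inr (.inl i)) : ℕ) = d * d + i := by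
  simp [kktEquiv]

theorem coe_kktEquiv_cone (i : Fin n) :
    (kktEquiv n d (.inr (.inr (.inl i))) : ℕ) = d * d + (n + i) := by
  simp [kktEquiv]

theorem coe_kktEquiv_trace (u : Unit) :
    (kktEquiv n d (.inr (.inr (.inr (.inl u)))) : ℕ) = d * d + (n + n) := by
  simp only [kktEquiv, Equiv.trans_apply, Equiv.sumCongr_apply, Sum.map_inr, Sum.map_inl,
    finSumFinEquiv_apply_right, finSumFinEquiv_apply_left, Fin.val_natAdd, Fin.val_castAdd]
  rfl

theorem coe_kktEquiv_scale (u : Unit) :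
    (kktEquiv n d (.inr (.inr (.inr (.inr u)))) : ℕ) = d * d + (n + (n + 1)) := by
  simp only [kktEquiv, Equiv.trans_apply, Equiv.sumCongr_apply, Sum.map_inr,
    finSumFinEquiv_apply_right, Fin.val_natAdd]
  rfl

theorem coe_kktEquiv_scaleIndex : (kktEquiv n d (scaleIndex n d) : ℕ) = kktSize n d - 1 := by
  rw [scaleIndex, coe_kktEquiv_scale, kktSize]
  omega

end KktNumbering

section Layout

/-- The working arrays of natural numbers: `n`, `d`, the order of `kkt`, the tables of quotients
and remainders modulo `d` and modulo the order of `kkt`, and two loop counters. -/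
inductive NatArray where
  | numPoints | dim | order | hi | lo | kktHi | kktLo | outer | inner

/-- The working arrays of real numbers; see `Content` for what they contain. -/
inductive RealArray where
  | points | matrix | slack | parameter | images | sqNorms | residuals | invX | invOneSubX | gram
  | identity

/-- The name of a working array. The names below `B` are left to the input, the output and the
inversion subroutine. -/
def NatArray.name (B : ℕ) (v : NatArray) : ℕ := B + v.ctorIdx

/-- The name of a working array; see `NatArray.name`. -/
def RealArray.name (B : ℕ) (a : RealArray) : ℕ := B + a.ctorIdx

@[simp] theorem NatArray.name_inj {B : ℕ} {v w : NatArray} : v.name B = w.name B ↔ v = w := by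
  cases v <;> cases w <;> simp [NatArray.name, NatArray.ctorIdx]

@[simp] theorem RealArray.name_inj {B : ℕ} {a b : RealArray} : a.name B = b.name B ↔ a = b := by
  cases a <;> cases b <;> simp [RealArray.name, RealArray.ctorIdx]

theorem NatArray.le_name (B : ℕ) (v : NatArray) : B ≤ v.name B := Nat.le_add_right _ _

theorem RealArray.le_name (B : ℕ) (a : RealArray) : B ≤ a.name B := Nat.le_add_right _ _

/-- The names of the loop counters. -/
def counters (B : ℕ) : Set ℕ := {NatArray.outer.name B, NatArray.inner.name B}

theorem NatArray.name_notMem {B : ℕ} {v : NatArray} (houter : v ≠ .outer) (hinner : v ≠ .inner) :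
    v.name B ∉ counters B ∪ Set.Iio B := by
  simp [counters, houter, hinner, v.le_name B]

variable {n d : ℕ} {P : Fin n → EuclideanSpace ℝ (Fin d)} {t : ℝ} {z : Point n d} {B : ℕ}
  {J J' : Set RealArray} {R : Set ℕ} {a : RealArray} {s s' : Memory}

/-- The sizes of the input and of `kkt` are in place. -/
structure Sizes (B n d : ℕ) (s : Memory) : Prop where
  numPoints : s.nat (NatArray.numPoints.name B) 0 = n
  dim : s.nat (NatArray.dim.name B) 0 = d
  order : s.nat (NatArray.order.name B) 0 = kktSize n d

theorem Sizes.of_agreesOff {A : Set ℕ} (h : Sizes B n d s) (hs : AgreesOff A R s s')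
    (hA : ∀ v ∈ [NatArray.numPoints, .dim, .order], v.name B ∉ A) : Sizes B n d s' := by
  refine ⟨?_, ?_, ?_⟩
  · rw [hs.nat _ (hA _ (by simp)), h.numPoints]
  · rw [hs.nat _ (hA _ (by simp)), h.dim]
  · rw [hs.nat _ (hA _ (by simp)), h.order]

/-- The sizes and the tables of quotients and remainders are in place. -/
structure Tables (B n d : ℕ) (s : Memory) : Prop extends Sizes B n d s where
  divTable : HoldsDivTable (NatArray.hi.name B) (NatArray.lo.name B) d ((n + d) * d) s
  kktDivTable : HoldsDivTable (NatArray.kktHi.name B) (NatArray.kktLo.name B) (kktSize n d)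
    (kktSize n d * kktSize n d) s

theorem Tables.of_agreesOff (h : Tables B n d s)
    (hs : AgreesOff (counters B ∪ Set.Iio B) R s s') : Tables B n d s' := by
  have eq {v : NatArray} (houter : v ≠ .outer) (hinner : v ≠ .inner) :
      s'.nat (v.name B) = s.nat (v.name B) :=
    hs.nat _ (NatArray.name_notMem houter hinner)
  refine ⟨h.toSizes.of_agreesOff hs ?_, h.divTable.congr ?_ ?_, h.kktDivTable.congr ?_ ?_⟩
  · simp only [List.forall_mem_cons, List.not_mem_nil, false_implies, implies_true, and_true]
    exact ⟨NatArray.name_notMem (by simp) (by simp), NatArray.name_notMem (by simp) (by simp),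
      NatArray.name_notMem (by simp) (by simp)⟩
  all_goals exact eq (by simp) (by simp)

theorem Tables.hi_lo {l : ℕ} (h : Tables B n d s) (hl : l ≤ n + d) (i : Fin l) (b : Fin d) :
    s.nat (NatArray.hi.name B) (i * d + b) = i ∧ s.nat (NatArray.lo.name B) (i * d + b) = b :=
  h.divTable i b ((mul_add_lt i b).trans_le (Nat.mul_le_mul_right _ hl))

/-- The intended contents `x` of a working array when the current point is `z`. -/
def Content (P : Fin n → EuclideanSpace ℝ (Fin d)) (t : ℝ) (z : Point n d) (a : RealArray)
    (x : ℕ → ℝ) : Prop :=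
  match a with
  | .points => ∀ (i : Fin n) (b : Fin d), x (i * d + b) = P i b
  | .matrix => ∀ b c : Fin d, x (b * d + c) = z.X b c
  | .slack => ∀ i : Fin n, x i = z.y i
  | .parameter => x 0 = t
  | .images => ∀ (i : Fin n) (b : Fin d), x (i * d + b) = applyTo z.X (P i) b
  | .sqNorms => ∀ i : Fin n, x i = ‖applyTo z.X (P i)‖ ^ 2
  | .residuals => ∀ i : Fin n, x i = residual P z i
  | .invX => ∀ b c : Fin d, x (b * d + c) = z.X⁻¹ b c
  | .invOneSubX => ∀ b c : Fin d, x (b * d + c) = (1 - z.X)⁻¹ b c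
  | .gram => ∀ b c : Fin d, x (b * d + c) = ∑ i, 2 / residual P z i * (P i b * P i c)
  | .identity => ∀ b c : Fin d, x (b * d + c) = (1 : Matrix (Fin d) (Fin d) ℝ) b c

/-- The tables and the working arrays in `J` have the intended contents. -/
structure Holds (B : ℕ) (P : Fin n → EuclideanSpace ℝ (Fin d)) (t : ℝ) (z : Point n d)
    (J : Set RealArray) (s : Memory) : Prop where
  tables : Tables B n d s
  content : ∀ a ∈ J, Content P t z a (s.real (a.name B))

theorem Holds.of_agreesOff (h : Holds B P t z J s)
    (hs : AgreesOff (counters B ∪ Set.Iio B) R s s') (hJ : ∀ a ∈ J', a ∈ J ∧ a.name B ∉ R) :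
    Holds B P t z J' s' :=
  ⟨h.tables.of_agreesOff hs, fun a ha => by
    rw [hs.real _ (hJ a ha).2]
    exact h.content a (hJ a ha).1⟩

theorem Holds.mono (h : Holds B P t z J s) (hJ : J' ⊆ J) : Holds B P t z J' s :=
  ⟨h.tables, fun a ha => h.content a (hJ ha)⟩

theorem Holds.of_agreesOff_Iio (h : Holds B P t z J s)
    (hs : AgreesOff (counters B ∪ Set.Iio B) (Set.Iio B) s s') : Holds B P t z J s' :=
  h.of_agreesOff hs fun a ha => ⟨ha, by simp [a.le_name B]⟩

theorem Holds.sdiff (h : Holds B P t z J s) (hs : AgreesOff (counters B) {a.name B} s s') :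
    Holds B P t z (J \ {a}) s' :=
  h.of_agreesOff (hs.mono Set.subset_union_left le_rfl) fun b hb => ⟨hb.1, by simpa using hb.2⟩

theorem Holds.insert (h : Holds B P t z J s) (hs : AgreesOff (counters B) {a.name B} s s')
    (ha : Content P t z a (s'.real (a.name B))) : Holds B P t z (insert a J) s' := by
  refine ⟨(h.sdiff hs).tables, fun b hb => ?_⟩
  obtain rfl | hne := eq_or_ne b a
  · exact ha
  · exact (h.sdiff hs).content b ⟨hb.resolve_left hne, hne⟩

end Layout

section LoopsOverWorkingArrays

/-- The content of cell `0` of a working array of natural numbers. -/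
abbrev natVar (B : ℕ) (v : NatArray) : NExp := .var (v.name B)

variable {n d : ℕ} {B b K M : ℕ} {ι : Type*} {N L : NExp} {s : Memory}

theorem outer_ne_inner (B : ℕ) : NatArray.outer.name B ≠ NatArray.inner.name B := by simp

theorem one_le_kktSize : 1 ≤ kktSize n d := by
  rw [kktSize]
  omega

theorem one_le_kktSize_sq : 1 ≤ kktSize n d ^ 2 := Nat.one_le_pow _ _ one_le_kktSize

theorem Tables.runs_fill {e : CExp} (h : Tables B n d s) (idx : ι ≃ Fin K)
    (hcost : e.cost + N.cost ≤ 4000) (hK : K ≤ kktSize n d ^ 2)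
    (hN : ∀ s', Tables B n d s' → N.eval s' = K) {G : ι → ℝ}
    (he : ∀ i s', AgreesOff (counters B) {b} s s' → s'.nat (NatArray.outer.name B) 0 = idx i →
      s'.real b (idx i) = s.real b (idx i) → e.eval s' = G i) :
    Runs (fill (NatArray.outer.name B) b N e) s (10000 * (kktSize n d : ℝ) ^ 2)
      (fun s' => AgreesOff (counters B) {b} s s' ∧ ∀ i, s'.real b (idx i) = G i) := by
  refine (KSM.runs_fill (Φ := fun r x => ∀ i, (idx i : ℕ) = r → x = G i)
    (Set.mem_insert _ {NatArray.inner.name B})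
    (fun s' hs' => hN s' (h.of_agreesOff (hs'.mono Set.subset_union_left le_rfl)))
    fun r _ s' hs' hr hb i hi => ?_).mono ?_ fun s' ⟨hs', hG⟩ =>
      ⟨hs', fun i => hG _ (idx i).2 i rfl⟩
  · subst hi
    exact he i s' hs' hr hb
  · have hcost' : (e.cost : ℝ) + N.cost + 15 ≤ 5000 := by exact_mod_cast (by omega : _ ≤ 5000)
    have hK' : (K : ℝ) + 1 ≤ 2 * (kktSize n d : ℝ) ^ 2 := by
      exact_mod_cast (by linarith [one_le_kktSize_sq (n := n) (d := d)] : _ ≤ 2 * kktSize n d ^ 2)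
    calc ((K : ℝ) + 1) * (e.cost + N.cost + 15) ≤ 2 * (kktSize n d : ℝ) ^ 2 * 5000 := by gcongr
      _ = _ := by ring

theorem Tables.runs_fillSum {e : RExp} (h : Tables B n d s) (idx : ι ≃ Fin K)
    (hcost : e.cost + N.cost + L.cost ≤ 4000) (hK : (K + 1) * (M + 1) ≤ 2 * kktSize n d ^ 2)
    (hN : ∀ s', Tables B n d s' → N.eval s' = K) (hL : ∀ s', Tables B n d s' → L.eval s' = M)
    {F : ι → Fin M → ℝ} (he : ∀ i l s', AgreesOff (counters B) {b} s s' →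
      s'.nat (NatArray.outer.name B) 0 = idx i → s'.nat (NatArray.inner.name B) 0 = (l : Fin M) →
      e.eval s' = F i l) :
    Runs (fillSum (NatArray.outer.name B) (NatArray.inner.name B) b N L e) s
      (10000 * (kktSize n d : ℝ) ^ 2)
      (fun s' => AgreesOff (counters B) {b} s s' ∧ ∀ i, s'.real b (idx i) = ∑ l, F i l) := by
  have tables {s'} (hs' : AgreesOff (counters B) {b} s s') : Tables B n d s' :=
    h.of_agreesOff (hs'.mono Set.subset_union_left le_rfl)
  refine (KSM.runs_fillSum (Φ := fun r x => ∀ i, (idx i : ℕ) = r → x = ∑ l, F i l) (M := M)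
    (outer_ne_inner B) (fun s' hs' => hN s' (tables hs')) (fun s' hs' => hL s' (tables hs'))
    fun r hr => ?_).mono ?_ fun s' ⟨hs', hG⟩ => ⟨hs', fun i => hG _ (idx i).2 i rfl⟩
  · obtain ⟨i, hi⟩ := idx.surjective ⟨r, hr⟩
    refine ⟨F i, fun i' hi' => ?_, fun l s' hs' ho hl => he i l s' hs' (by rw [ho, hi]) hl⟩
    rw [idx.injective (hi.trans (Fin.ext hi'.symm))]
  · have hcost' : (e.cost : ℝ) + N.cost + L.cost + 40 ≤ 5000 := by
      exact_mod_cast (by omega : _ ≤ 5000)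
    have hK' : ((K : ℝ) + 1) * (M + 1) ≤ 2 * (kktSize n d : ℝ) ^ 2 := by exact_mod_cast hK
    calc ((K : ℝ) + 1) * (M + 1) * (e.cost + N.cost + L.cost + 40)
        ≤ 2 * (kktSize n d : ℝ) ^ 2 * 5000 := by gcongr
      _ = _ := by ring

end LoopsOverWorkingArrays

section Programs

attribute [local simp] NExp.eval RExp.eval CExp.eval NExp.cost RExp.cost CExp.cost

section PointPrograms

/-- A cell of a working array of natural numbers. -/
abbrev natAt (B : ℕ) (v : NatArray) (u : NExp) : NExp := .get (v.name B) u

/-- A cell of a working array of real numbers. -/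
abbrev realAt (B : ℕ) (a : RealArray) (u : NExp) : RExp := .get (a.name B) u

/-- The entry in row `u` and column `v` of a working array that holds a matrix with `d` columns. -/
abbrev entryAt (B : ℕ) (a : RealArray) (u v : NExp) : RExp :=
  realAt B a (.add (.mul u (natVar B .dim)) v)

/-- Computes the vectors `X p_i`. -/
def imageProg (B : ℕ) : Prog :=
  fillSum (NatArray.outer.name B) (NatArray.inner.name B) (RealArray.images.name B)
    (.mul (natVar B .numPoints) (natVar B .dim)) (natVar B .dim)
    (.mul (entryAt B .matrix (natAt B .lo (natVar B .outer)) (natVar B .inner))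
      (entryAt B .points (natAt B .hi (natVar B .outer)) (natVar B .inner)))

/-- Computes the numbers `‖X p_i‖ ^ 2`. -/
def normProg (B : ℕ) : Prog :=
  fillSum (NatArray.outer.name B) (NatArray.inner.name B) (RealArray.sqNorms.name B)
    (natVar B .numPoints) (natVar B .dim)
    (.mul (entryAt B .images (natVar B .outer) (natVar B .inner))
      (entryAt B .images (natVar B .outer) (natVar B .inner)))

/-- Computes the numbers `residual P z i`. -/
def residualProg (B : ℕ) : Prog :=
  fill (NatArray.outer.name B) (RealArray.residuals.name B) (natVar B .numPoints)
    (.ret (.sub (.mul (realAt B .slack (natVar B .outer)) (realAt B .slack (natVar B .outer)))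
      (realAt B .sqNorms (natVar B .outer))))

/-- Computes the matrix `∑ i, (2 / residual P z i) p_i p_iᵀ`. -/
def gramProg (B : ℕ) : Prog :=
  fillSum (NatArray.outer.name B) (NatArray.inner.name B) (RealArray.gram.name B)
    (.mul (natVar B .dim) (natVar B .dim)) (natVar B .numPoints)
    (.mul (.div (.lit 2) (realAt B .residuals (natVar B .inner)))
      (.mul (entryAt B .points (natVar B .inner) (natAt B .hi (natVar B .outer)))
        (entryAt B .points (natVar B .inner) (natAt B .lo (natVar B .outer)))))

variable {n d : ℕ} {P : Fin n → EuclideanSpace ℝ (Fin d)} {t : ℝ} {z : Point n d} {B : ℕ}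
  {J : Set RealArray} {s : Memory}

theorem runs_imageProg (h : Holds B P t z J s) (hpoints : .points ∈ J) (hmatrix : .matrix ∈ J) :
    Runs (imageProg B) s (10000 * (kktSize n d : ℝ) ^ 2)
      (Holds B P t z (insert .images J)) := by
  refine (h.tables.runs_fillSum (rowMajor n d) (by simp)
    (by rw [kktSize]; nlinarith [Nat.le_mul_self d, Nat.mul_le_mul_left n (Nat.le_mul_self d)])
    (fun s' hs' => by simp [hs'.numPoints, hs'.dim]) (fun s' hs' => by simp [hs'.dim])
    (F := fun p l => z.X p.2 l * P p.1 l) ?_).imp fun s' ⟨hs', hw⟩ => h.insert hs' fun i a => ?_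
  · rintro ⟨i, a⟩ l s' hs' ho hl
    have h' := h.sdiff hs'
    have hpts : ∀ (i : Fin n) (a : Fin d), s'.real (RealArray.points.name B) (i * d + a) = P i a :=
      h'.content .points ⟨hpoints, by simp⟩
    have hmat : ∀ a b : Fin d, s'.real (RealArray.matrix.name B) (a * d + b) = z.X a b :=
      h'.content .matrix ⟨hmatrix, by simp⟩
    have hhi := h'.tables.hi_lo (by omega) i a
    simp [ho, hl, coe_rowMajor, h'.tables.dim, hhi, hpts, hmat]
  · simpa only [coe_rowMajor, applyTo_apply] using hw (i, a)

theorem runs_normProg (h : Holds B P t z J s) (himages : .images ∈ J) :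
    Runs (normProg B) s (10000 * (kktSize n d : ℝ) ^ 2)
      (Holds B P t z (insert .sqNorms J)) := by
  refine (h.tables.runs_fillSum (.refl (Fin n)) (by simp)
    (by rw [kktSize]; nlinarith [Nat.le_mul_self d, Nat.mul_le_mul_left n (Nat.le_mul_self d)])
    (fun s' hs' => by simp [hs'.numPoints]) (fun s' hs' => by simp [hs'.dim])
    (F := fun i l => applyTo z.X (P i) l ^ 2) fun i l s' hs' ho hl => ?_).imp
    fun s' ⟨hs', hw⟩ => h.insert hs' fun i => ?_
  · have h' := h.sdiff hs'
    have himg : ∀ (i : Fin n) (a : Fin d),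
        s'.real (RealArray.images.name B) (i * d + a) = applyTo z.X (P i) a :=
      h'.content .images ⟨himages, by simp⟩
    simp [ho, hl, h'.tables.dim, himg, sq]
  · exact (hw i).trans (EuclideanSpace.real_norm_sq_eq _).symm

theorem runs_residualProg (h : Holds B P t z J s) (hslack : .slack ∈ J) (hsq : .sqNorms ∈ J) :
    Runs (residualProg B) s (10000 * (kktSize n d : ℝ) ^ 2)
      (Holds B P t z (insert .residuals J)) := by
  refine (h.tables.runs_fill (.refl (Fin n)) (by simp) (by rw [kktSize]; nlinarith)
    (fun s' hs' => by simp [hs'.numPoints]) (G := fun i => residual P z i)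
    fun i s' hs' ho _ => ?_).imp fun s' ⟨hs', hq⟩ => h.insert hs' hq
  have h' := h.sdiff hs'
  have hy : ∀ i : Fin n, s'.real (RealArray.slack.name B) i = z.y i :=
    h'.content .slack ⟨hslack, by simp⟩
  have hw : ∀ i : Fin n, s'.real (RealArray.sqNorms.name B) i = ‖applyTo z.X (P i)‖ ^ 2 :=
    h'.content .sqNorms ⟨hsq, by simp⟩
  simp [ho, hy, hw, residual, ← sq]

theorem runs_gramProg (h : Holds B P t z J s) (hpoints : .points ∈ J) (hres : .residuals ∈ J) :
    Runs (gramProg B) s (10000 * (kktSize n d : ℝ) ^ 2) (Holds B P t z (insert .gram J)) := by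
  refine (h.tables.runs_fillSum (rowMajor d d) (by simp) (by rw [kktSize]; nlinarith)
    (fun s' hs' => by simp [hs'.dim]) (fun s' hs' => by simp [hs'.numPoints])
    (F := fun p i => 2 / residual P z i * (P i p.1 * P i p.2)) ?_).imp
    fun s' ⟨hs', hC⟩ => h.insert hs' fun a b => by simpa only [coe_rowMajor] using hC (a, b)
  rintro ⟨a, b⟩ i s' hs' ho hi
  have h' := h.sdiff hs'
  have hpts : ∀ (i : Fin n) (a : Fin d), s'.real (RealArray.points.name B) (i * d + a) = P i a :=
    h'.content .points ⟨hpoints, by simp⟩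
  have hq : ∀ i : Fin n, s'.real (RealArray.residuals.name B) i = residual P z i :=
    h'.content .residuals ⟨hres, by simp⟩
  have hhi := h'.tables.hi_lo (by omega) a b
  simp [ho, hi, coe_rowMajor, h'.tables.dim, hhi, hpts, hq]

end PointPrograms

section InversionPrograms

variable {n d k : ℕ} {P : Fin n → EuclideanSpace ℝ (Fin d)} {t : ℝ} {z : Point n d} {B : ℕ}
  {J : Set RealArray} {s : Memory} {inv : Prog} {C ω : ℝ}

/-- Fills the low array `0` with the entries `e` of a matrix of order `N` and inverts this matrix.
-/
def invertProg (inv : Prog) (B : ℕ) (N : NExp) (e : CExp) : Prog :=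
  .seq (fill (NatArray.outer.name B) 0 (.mul N N) e) (.seq (.setNat 0 (.lit 0) N) inv)

theorem runs_inverse {m : ℕ} {ι : Type*} [Fintype ι] [DecidableEq ι] {A : Matrix ι ι ℝ} {N : NExp}
    (hinv : Inverts inv C ω) (hB : inv.bound ≤ B) (hB0 : 0 < B) (idx : ι ≃ Fin m) (hm : 1 ≤ m)
    (hA : IsUnit A.det) (hN : N.eval s = m) (hs : ∀ i j, s.real 0 (idx i * m + idx j) = A i j) :
    Runs (.seq (.setNat 0 (.lit 0) N) inv) s (N.cost + 2 + C * (m : ℝ) ^ ω)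
      (fun s' => AgreesOff (Set.Iio B) (Set.Iio B) s s' ∧
        ∀ i j, s'.real 1 (idx i * m + idx j) = A⁻¹ i j) := by
  refine ((runs_setNat s 0 (.lit 0) N).mono (T' := N.cost + 2) ?_ fun _ h => h).seq ?_
  · simp only [NExp.cost]
    push_cast
    linarith
  · rintro _ rfl
    obtain ⟨s', τ, hexec, hτ, hs'⟩ := hinv m hm (A.submatrix idx.symm idx.symm)
      (by rwa [Matrix.det_submatrix_equiv_self]) (s.writeNat 0 0 m) (by simp)
      fun i j => by simpa using hs (idx.symm i) (idx.symm j)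
    have hlow := Set.Iio_subset_Iio hB
    simp only [NExp.eval, hN]
    have hsize : AgreesOff (Set.Iio B) (Set.Iio B) s (s.writeNat 0 0 m) :=
      (AgreesOff.refl _ _ s).writeNat (Set.mem_Iio.2 hB0) 0 m
    refine ⟨s', τ, hexec, hτ, hsize.trans (hexec.agreesOff_bound.mono hlow hlow), fun i j => ?_⟩
    rw [hs', Matrix.inv_submatrix_equiv]
    simp

theorem Tables.runs_invertProg {m : ℕ} {ι : Type*} [Fintype ι] [DecidableEq ι] {A : Matrix ι ι ℝ}
    {N : NExp} {e : CExp} (h : Tables B n d s) (hinv : Inverts inv C ω) (hB : inv.bound ≤ B)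
    (hB0 : 0 < B) (idx : ι ≃ Fin m) (hm : 1 ≤ m) (hle : m ≤ kktSize n d)
    (hcost : e.cost + 2 * N.cost + 1 ≤ 4000) (hA : IsUnit A.det)
    (hN : ∀ s', Tables B n d s' → N.eval s' = m)
    (he : ∀ i j s', AgreesOff (counters B ∪ Set.Iio B) (Set.Iio B) s s' →
      s'.nat (NatArray.outer.name B) 0 = idx i * m + idx j → e.eval s' = A i j) :
    Runs (invertProg inv B N e) s (15000 * (kktSize n d : ℝ) ^ 2 + C * (m : ℝ) ^ ω)
      (fun s' => AgreesOff (counters B ∪ Set.Iio B) (Set.Iio B) s s' ∧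
        ∀ i j, s'.real 1 (idx i * m + idx j) = A⁻¹ i j) := by
  have hzero : ({0} : Set ℕ) ⊆ Set.Iio B := Set.singleton_subset_iff.2 hB0
  have hfill := h.runs_fill (e := e) (b := 0) (N := .mul N N)
    ((idx.prodCongr idx).trans (rowMajor m m)) (G := fun p => A p.1 p.2)
    (by simp only [NExp.cost]; omega) (by nlinarith) (fun s' hs' => by simp [hN s' hs'])
    fun p s' hs' ho _ => he p.1 p.2 s' (hs'.mono Set.subset_union_left hzero)
      (by simpa [coe_rowMajor] using ho)
  refine (hfill.seq (T' := N.cost + 2 + C * (m : ℝ) ^ ω) fun s₁ ⟨hs₁, hA₁⟩ => ?_).mono ?_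
    fun _ h => h
  · have hs₁' := hs₁.mono (A' := counters B ∪ Set.Iio B) Set.subset_union_left hzero
    refine (runs_inverse hinv hB hB0 idx hm hA (hN _ (h.of_agreesOff hs₁')) fun i j => ?_).imp
      fun s₂ ⟨hs₂, hA₂⟩ => ⟨hs₁'.trans (hs₂.mono Set.subset_union_right le_rfl), hA₂⟩
    simpa [coe_rowMajor] using hA₁ (i, j)
  · have hcost' : (N.cost : ℝ) ≤ 2000 := by exact_mod_cast (by omega : N.cost ≤ 2000)
    have hone : (1 : ℝ) ≤ (kktSize n d : ℝ) ^ 2 := by exact_mod_cast one_le_kktSize_sq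
    linarith

/-- Inverts the `d × d` matrix with the entries `e` and stores the inverse in the array `a`. -/
def inverseProg (inv : Prog) (B : ℕ) (a : RealArray) (e : CExp) : Prog :=
  .seq (invertProg inv B (natVar B .dim) e)
    (fill (NatArray.outer.name B) (a.name B) (.mul (natVar B .dim) (natVar B .dim))
      (.ret (.get 1 (natVar B .outer))))

theorem runs_inverseProg {a : RealArray} {e : CExp} {A : Matrix (Fin d) (Fin d) ℝ}
    (h : Holds B P t z J s) (hinv : Inverts inv C ω) (hB : inv.bound ≤ B) (hB1 : 1 < B) (hd : d ≠ 0)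
    (hcost : e.cost ≤ 3000) (hA : IsUnit A.det)
    (he : ∀ (p q : Fin d) s', Holds B P t z J s' →
      s'.nat (NatArray.outer.name B) 0 = p * d + q → e.eval s' = A p q)
    (ha : ∀ x : ℕ → ℝ, (∀ p q : Fin d, x (p * d + q) = A⁻¹ p q) → Content P t z a x) :
    Runs (inverseProg inv B a e) s (25000 * (kktSize n d : ℝ) ^ 2 + C * (d : ℝ) ^ ω)
      (Holds B P t z (insert a J)) := by
  have hsize : d * d ≤ kktSize n d := Nat.le_add_right _ _
  have hinvert := h.tables.runs_invertProg (N := natVar B .dim) (e := e) hinv hB (by omega)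
    (.refl (Fin d)) (Nat.pos_of_ne_zero hd) ((Nat.le_mul_self d).trans hsize)
    (by simp only [NExp.cost]; omega) hA (fun s' hs' => by simp [hs'.dim])
    fun p q s' hs' ho => he p q s' (h.of_agreesOff_Iio hs') ho
  refine (hinvert.seq (T' := 10000 * (kktSize n d : ℝ) ^ 2) fun s₁ ⟨hs₁, hA₁⟩ => ?_).mono
    (le_of_eq (by ring)) fun _ h => h
  have h₁ := h.of_agreesOff_Iio hs₁
  refine (h₁.tables.runs_fill (rowMajor d d) (by simp) (by nlinarith)
    (fun s' hs' => by simp [hs'.dim]) (G := fun p => A⁻¹ p.1 p.2) fun p s' hs' ho _ => ?_).imp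
    fun s₂ ⟨hs₂, hA₂⟩ => h₁.insert hs₂ (ha _ fun p q => ?_)
  · have hne : 1 ∉ ({a.name B} : Set ℕ) := (hB1.trans_le (a.le_name B)).ne
    simpa [ho, coe_rowMajor, hs'.real 1 hne] using hA₁ p.1 p.2
  · simpa only [coe_rowMajor] using hA₂ (p, q)

/-- Selects one of five expressions, according to the block of `KktIndex` that contains the index
with the number `u`. -/
def byBlock (B : ℕ) (u : NExp) (matrix slack cone trace scale : CExp) : CExp :=
  let dimSq : NExp := .mul (natVar B .dim) (natVar B .dim)
  let numPoints : NExp := natVar B .numPoints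
  .cond u dimSq matrix
    (.cond u (.add dimSq numPoints) slack
      (.cond u (.add dimSq (.add numPoints numPoints)) cone
        (.cond u (.add dimSq (.add numPoints (.add numPoints (.lit 1)))) trace scale)))

theorem Tables.eval_byBlock {u : NExp} {r : KktIndex n d} (h : Tables B n d s)
    (hu : u.eval s = kktEquiv n d r) (matrix slack cone trace scale : CExp) :
    (byBlock B u matrix slack cone trace scale).eval s =
      match r with
      | .inl _ => matrix.eval s
      | .inr (.inl _) => slack.eval s
      | .inr (.inr (.inl _)) => cone.eval s
      | .inr (.inr (.inr (.inl _))) => trace.eval s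
      | .inr (.inr (.inr (.inr _))) => scale.eval s := by
  have hlt : ∀ a b : Fin d, (a : ℕ) * d + b < d * d := mul_add_lt
  rcases r with ⟨a, b⟩ | i | i | u | u <;>
    simp [byBlock, hu, h.dim, h.numPoints, coe_kktEquiv_matrix, coe_kktEquiv_slack,
      coe_kktEquiv_cone, coe_kktEquiv_trace, coe_kktEquiv_scale, hlt]

/-- The entry of `kkt P t z` in the row and the column with the numbers `row` and `col`. -/
def kktEntry (B : ℕ) (row col : NExp) : CExp :=
  let hi (u : NExp) : NExp := natAt B .hi u
  let lo (u : NExp) : NExp := natAt B .lo u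
  let slackOf (u : NExp) : NExp := .sub u (.mul (natVar B .dim) (natVar B .dim))
  let coneOf (u : NExp) : NExp := .sub (slackOf u) (natVar B .numPoints)
  let neg (x : RExp) : CExp := .ret (.sub (.lit 0) x)
  let kron (a b : RealArray) (u u' v v' : NExp) : RExp := .mul (entryAt B a u v) (entryAt B b u' v')
  let zero : CExp := .ret (.lit 0)
  let matrixMatrix : CExp :=
    .ret (.add (.add (kron .invX .invX (hi row) (lo row) (hi col) (lo col))
        (kron .invOneSubX .invOneSubX (hi row) (lo row) (hi col) (lo col)))
      (.div (.add (kron .identity .gram (hi row) (lo row) (hi col) (lo col))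
        (kron .identity .gram (lo row) (hi row) (lo col) (hi col))) (.lit 2)))
  let matrixCone (u i : NExp) : CExp :=
    neg (.div (.add (kron .images .points i i (hi u) (lo u))
      (kron .points .images i i (hi u) (lo u))) (.lit 2))
  let matrixTrace (u : NExp) : CExp := .ret (realAt B .identity u)
  let matrixScale (u : NExp) : CExp :=
    .ret (.sub (realAt B .invOneSubX u) (realAt B .invX u))
  let slackCone (i j : NExp) : CExp := .ifEq i j (.ret (realAt B .slack i)) zero
  let slackScale : CExp := .ret (realAt B .parameter (.lit 0))
  let coneScale (i : NExp) : CExp := neg (.div (realAt B .residuals i) (.lit 2))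
  byBlock B row
    (byBlock B col matrixMatrix zero (matrixCone row (coneOf col)) (matrixTrace row)
      (matrixScale row))
    (byBlock B col zero
      (.ifEq (slackOf row) (slackOf col)
        (neg (.div (.lit 2) (realAt B .residuals (slackOf row)))) zero)
      (slackCone (slackOf row) (coneOf col)) zero slackScale)
    (byBlock B col (matrixCone col (coneOf row)) (slackCone (coneOf row) (slackOf col))
      (.ifEq (coneOf row) (coneOf col)
        (neg (.div (.mul (realAt B .residuals (coneOf row)) (realAt B .residuals (coneOf row)))
          (.lit 4))) zero) zero (coneScale (coneOf row)))
    (byBlock B col (matrixTrace col) zero zero zero zero)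
    (byBlock B col (matrixScale col) slackScale (coneScale (coneOf col)) zero
      (neg (.add (.ofNat (natVar B .numPoints)) (.lit 1))))

theorem Holds.eval_kktEntry {row col : NExp} {r c : KktIndex n d} (h : Holds B P t z Set.univ s)
    (hr : row.eval s = kktEquiv n d r) (hc : col.eval s = kktEquiv n d c) :
    (kktEntry B row col).eval s = kkt P t z r c := by
  have hhi := h.tables.hi_lo (Nat.le_add_left d n)
  have hpts : ∀ (i : Fin n) (a : Fin d), s.real (RealArray.points.name B) (i * d + a) = P i a :=
    h.content .points trivial
  have hslack : ∀ i : Fin n, s.real (RealArray.slack.name B) i = z.y i :=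
    h.content .slack trivial
  have hpar : s.real (RealArray.parameter.name B) 0 = t := h.content .parameter trivial
  have himg : ∀ (i : Fin n) (a : Fin d),
      s.real (RealArray.images.name B) (i * d + a) = applyTo z.X (P i) a :=
    h.content .images trivial
  have hres : ∀ i : Fin n, s.real (RealArray.residuals.name B) i = residual P z i :=
    h.content .residuals trivial
  have hinvX : ∀ a b : Fin d, s.real (RealArray.invX.name B) (a * d + b) = z.X⁻¹ a b :=
    h.content .invX trivial
  have hinvY : ∀ a b : Fin d,
      s.real (RealArray.invOneSubX.name B) (a * d + b) = (1 - z.X)⁻¹ a b :=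
    h.content .invOneSubX trivial
  have hgram : ∀ a b : Fin d, s.real (RealArray.gram.name B) (a * d + b) =
      ∑ i, 2 / residual P z i * (P i a * P i b) :=
    h.content .gram trivial
  have hone : ∀ a b : Fin d,
      s.real (RealArray.identity.name B) (a * d + b) = (1 : Matrix (Fin d) (Fin d) ℝ) a b :=
    h.content .identity trivial
  simp only [kktEntry, h.tables.eval_byBlock hr, h.tables.eval_byBlock hc]
  rcases r with ⟨a, b⟩ | i | i | u | u <;> rcases c with ⟨a', b'⟩ | j | j | u' | u' <;>
    simp [CExp.eval_ifEq, hr, hc, h.tables.dim, h.tables.numPoints, coe_kktEquiv_matrix,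
      coe_kktEquiv_slack, coe_kktEquiv_cone, kkt, hhi, hpts, hslack, hpar, himg, hres, hinvX, hinvY,
      hgram, hone, Fin.ext_iff, sq]

end InversionPrograms

section NewtonIteration

variable {n d k : ℕ} {P : Fin n → EuclideanSpace ℝ (Fin d)} {t : ℝ} {z : Point n d} {B : ℕ}
  {s : Memory} {inv : Prog} {C ω : ℝ}

/-- The working arrays that determine the current point. -/
abbrev baseArrays : Set RealArray := {.points, .matrix, .slack, .parameter, .identity}

/-- The memory holds the current point `z` and, in the low array `1`, the inverse of
`kkt P t z`. -/
structure HoldsNewton (B : ℕ) (P : Fin n → EuclideanSpace ℝ (Fin d)) (t : ℝ) (z : Point n d)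
    (s : Memory) : Prop where
  holds : Holds B P t z baseArrays s
  kktInv : ∀ r c : KktIndex n d,
    s.real 1 (kktEquiv n d r * kktSize n d + kktEquiv n d c) = (kkt P t z)⁻¹ r c

/-- Inverts the matrix `kkt P t z`. -/
def systemProg (inv : Prog) (B : ℕ) : Prog :=
  invertProg inv B (natVar B .order)
    (kktEntry B (natAt B .kktHi (natVar B .outer)) (natAt B .kktLo (natVar B .outer)))

theorem runs_systemProg (hinv : Inverts inv C ω) (hB : inv.bound ≤ B) (hB0 : 0 < B) (hd : d ≠ 0)
    (hz : z ∈ domain k P) (h : Holds B P t z Set.univ s) :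
    Runs (systemProg inv B) s
      (15000 * (kktSize n d : ℝ) ^ 2 + C * (kktSize n d : ℝ) ^ ω) (HoldsNewton B P t z) := by
  refine (h.tables.runs_invertProg (N := natVar B .order) hinv hB hB0 (kktEquiv n d)
    one_le_kktSize le_rfl (by simp [kktEntry, byBlock, CExp.ifEq]) (isUnit_det_kkt (t := t) hz hd)
    (fun s' hs' => by simp [hs'.order]) fun r c s' hs' ho => ?_).imp fun s' ⟨hs', hK⟩ =>
      ⟨(h.of_agreesOff_Iio hs').mono (Set.subset_univ _), hK⟩
  have h' := h.of_agreesOff_Iio hs'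
  have hrc := h'.tables.kktDivTable (kktEquiv n d r) (kktEquiv n d c) (mul_add_lt _ _)
  exact h'.eval_kktEntry (by simp [ho, hrc]) (by simp [ho, hrc])

/-- Inverts `kkt P t z`, starting from the point `z`. -/
def computeProg (inv : Prog) (B : ℕ) : Prog :=
  .seq (imageProg B) (.seq (normProg B) (.seq (residualProg B) (.seq (gramProg B)
    (.seq (inverseProg inv B .invX (.ret (realAt B .matrix (natVar B .outer))))
      (.seq (inverseProg inv B .invOneSubX (.ret (.sub (realAt B .identity (natVar B .outer))
          (realAt B .matrix (natVar B .outer)))))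
        (systemProg inv B))))))

theorem runs_computeProg (hinv : Inverts inv C ω) (hB : inv.bound ≤ B) (hB1 : 1 < B) (hd : d ≠ 0)
    (hz : z ∈ domain k P) (h : Holds B P t z baseArrays s) :
    Runs (computeProg inv B) s (110000 * (C * (kktSize n d : ℝ) ^ ω)) (HoldsNewton B P t z) := by
  refine ((runs_imageProg h (by simp) (by simp)).seq fun s₁ h₁ =>
    (runs_normProg h₁ (by simp)).seq fun s₂ h₂ =>
    (runs_residualProg h₂ (by simp) (by simp)).seq fun s₃ h₃ =>
    (runs_gramProg h₃ (by simp) (by simp)).seq fun s₄ h₄ =>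
    (runs_inverseProg (A := z.X) (a := .invX) h₄ hinv hB hB1 hd (by simp) hz.1.det_pos.ne'.isUnit
      (fun p q s' h' ho => ?_) fun _ hx => hx).seq fun s₅ h₅ =>
    (runs_inverseProg (A := 1 - z.X) (a := .invOneSubX) h₅ hinv hB hB1 hd (by simp)
      hz.2.1.det_pos.ne'.isUnit (fun p q s' h' ho => ?_) fun _ hx => hx).seq fun s₆ h₆ =>
    runs_systemProg hinv hB (by omega) hd hz
      (h₆.mono fun a _ => by cases a <;> simp)).mono ?_ fun _ h => h
  · have hX := h'.content .matrix (by simp) p q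
    simpa [ho] using hX
  · have hX := h'.content .matrix (by simp) p q
    have hone := h'.content .identity (by simp) p q
    simp [ho, hX, hone]
  · have hsq : (kktSize n d : ℝ) ^ 2 ≤ C * (kktSize n d : ℝ) ^ ω := hinv.sq_le one_le_kktSize
    have hle : (d : ℝ) ≤ kktSize n d := by
      exact_mod_cast (Nat.le_mul_self d).trans (Nat.le_add_right _ _)
    have hpow : C * (d : ℝ) ^ ω ≤ C * (kktSize n d : ℝ) ^ ω :=
      mul_le_mul_of_nonneg_left
        (Real.rpow_le_rpow d.cast_nonneg hle (by linarith [hinv.two_le])) hinv.nonneg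
    linarith [(sq_nonneg (kktSize n d : ℝ)).trans hsq]

/-- The point that results from a damped Newton step at `z`. -/
def newtonPoint (P : Fin n → EuclideanSpace ℝ (Fin d)) (t : ℝ) (z : Point n d) : Point n d :=
  z - direction ((kkt P t z)⁻¹.col (scaleIndex n d))

theorem HoldsNewton.lastColumn (h : HoldsNewton B P t z s) (r : KktIndex n d) :
    s.real 1 (kktEquiv n d r * kktSize n d + (kktSize n d - 1)) =
      (kkt P t z)⁻¹.col (scaleIndex n d) r := by
  rw [← coe_kktEquiv_scaleIndex, h.kktInv, Matrix.col_apply]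

/-- Replaces the current point `z` by `newtonPoint P t z`. -/
def updateProg (B : ℕ) : Prog :=
  let dimSq : NExp := .mul (natVar B .dim) (natVar B .dim)
  let lastColumn (u : NExp) : RExp :=
    .get 1 (.add (.mul u (natVar B .order)) (.sub (natVar B .order) (.lit 1)))
  .seq
    (fill (NatArray.outer.name B) (RealArray.matrix.name B) dimSq
      (.ret (.sub (realAt B .matrix (natVar B .outer)) (lastColumn (natVar B .outer)))))
    (fill (NatArray.outer.name B) (RealArray.slack.name B) (natVar B .numPoints)
      (.ret (.sub (realAt B .slack (natVar B .outer))
        (lastColumn (.add dimSq (natVar B .outer))))))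

theorem runs_updateProg (hB1 : 1 < B) (h : HoldsNewton B P t z s) :
    Runs (updateProg B) s (20000 * (kktSize n d : ℝ) ^ 2)
      (Holds B P t (newtonPoint P t z) baseArrays) := by
  have hsize : d * d ≤ kktSize n d := Nat.le_add_right _ _
  have hone (a : RealArray) : 1 ∉ ({a.name B} : Set ℕ) := (hB1.trans_le (a.le_name B)).ne
  have hX : ∀ a b : Fin d, s.real (RealArray.matrix.name B) (a * d + b) = z.X a b :=
    h.holds.content .matrix (by simp)
  have hy : ∀ i : Fin n, s.real (RealArray.slack.name B) i = z.y i :=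
    h.holds.content .slack (by simp)
  have h₀ : Holds B P t (newtonPoint P t z) {.points, .parameter, .identity} s :=
    ⟨h.holds.tables, by
      rintro a (rfl | rfl | rfl)
      exacts [h.holds.content .points (by simp), h.holds.content .parameter (by simp),
        h.holds.content .identity (by simp)]⟩
  refine ((h₀.tables.runs_fill (rowMajor d d) (by simp) (by nlinarith [hsize])
    (fun s' hs' => by simp [hs'.dim]) (G := fun p => (newtonPoint P t z).X p.1 p.2)
    fun p s' hs' ho hcell => ?_).seq (T' := 10000 * (kktSize n d : ℝ) ^ 2)
    fun s₁ ⟨hs₁, hX₁⟩ => ?_).mono (le_of_eq (by ring)) fun _ h => h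
  · have h' := (h₀.sdiff hs').tables
    have hcol := h.lastColumn (.inl (p.1, p.2))
    rw [coe_kktEquiv_matrix, ← hs'.real 1 (hone _)] at hcol
    rw [coe_rowMajor, hX] at hcell
    simp [ho, coe_rowMajor, hcell, h'.order, hcol, newtonPoint, Point.X_sub]
    rfl
  · have h₁ := h₀.insert hs₁ fun a b => by simpa only [coe_rowMajor] using hX₁ (a, b)
    refine (h₁.tables.runs_fill (.refl (Fin n)) (by simp) (by rw [kktSize]; nlinarith)
      (fun s' hs' => by simp [hs'.numPoints]) (G := (newtonPoint P t z).y)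
      fun i s' hs' ho hcell => ?_).imp fun s₂ ⟨hs₂, hy₂⟩ =>
        (h₁.insert hs₂ hy₂).mono fun a ha => by
          rcases ha with rfl | rfl | rfl | rfl | rfl <;> simp
    have h' := (h₁.sdiff hs').tables
    have hcol := h.lastColumn (.inr (.inl i))
    rw [coe_kktEquiv_slack, ← hs₁.real 1 (hone _), ← hs'.real 1 (hone _)] at hcol
    rw [Equiv.refl_apply, hs₁.real _ (by simp), hy] at hcell
    simp [ho, hcell, h'.order, h'.dim, hcol, newtonPoint, Point.y_sub]
    rfl

/-- The Newton decrement `λ` exceeds `1 / 100`. The last entry of the inverse of `kkt` is `-κ` with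
`λ ^ 2 = (1 - κ) / κ`, so this means `10001 * κ < 10000`. -/
def continueTest (B : ℕ) : Test :=
  .realLt (.mul (.lit 10001) (.sub (.lit 0)
    (.get 1 (.sub (.mul (natVar B .order) (natVar B .order)) (.lit 1))))) (.lit 10000)

theorem HoldsNewton.holds_continueTest_iff (h : HoldsNewton B P t z s) :
    (continueTest B).Holds s ↔
      10001 * -(kkt P t z)⁻¹ (scaleIndex n d) (scaleIndex n d) < 10000 := by
  have hlast : kktSize n d * kktSize n d - 1 =
      kktEquiv n d (scaleIndex n d) * kktSize n d + (kktSize n d - 1) := by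
    rw [coe_kktEquiv_scaleIndex, Nat.sub_mul, one_mul]
    have := Nat.le_mul_self (kktSize n d)
    have := one_le_kktSize (n := n) (d := d)
    omega
  have hcol := h.lastColumn (scaleIndex n d)
  rw [← hlast, Matrix.col_apply] at hcol
  simp [continueTest, Test.Holds, h.holds.tables.order, hcol]

/-- Damped Newton steps until the Newton decrement is at most `1 / 100`. -/
def newtonProg (inv : Prog) (B : ℕ) : Prog :=
  .while (continueTest B) (.seq (updateProg B) (computeProg inv B))

theorem newtonPoint_mem_domain_and_relaxation_le (hd : d ≠ 0) (hz : z ∈ domain k P)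
    (h : HoldsNewton B P t z s) (htest : (continueTest B).Holds s) :
    newtonPoint P t z ∈ domain k P ∧
      relaxation P t (newtonPoint P t z) ≤ relaxation P t z - (1 / 10001) ^ 2 := by
  have hstep := isScaledNewtonStep_direction (t := t) hz hd
  obtain ⟨hmem, hle⟩ := hstep.sub_mem_domain_and_relaxation_sub_le hz
  refine ⟨hmem, hle.trans (sub_le_sub_left ?_ _)⟩
  have := h.holds_continueTest_iff.1 htest
  gcongr
  linarith

theorem decrement_le_of_not_holds_continueTest (hd : d ≠ 0) (hz : z ∈ domain k P)
    (h : HoldsNewton B P t z s) (htest : ¬ (continueTest B).Holds s) :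
    decrement P t z ≤ 1 / 100 := by
  have hstep := isScaledNewtonStep_direction (t := t) hz hd
  have hκ := hstep.scale_pos hz
  rw [h.holds_continueTest_iff, not_lt] at htest
  rw [hstep.decrement_eq hz, Real.sqrt_le_left (by norm_num), div_le_iff₀ hκ]
  linarith

theorem runs_newtonProg (hinv : Inverts inv C ω) (hB : inv.bound ≤ B) (hB1 : 1 < B) (hd : d ≠ 0)
    (hz : z ∈ domain k P) (h : HoldsNewton B P t z s) {m : ℝ} {j : ℕ}
    (hm : ∀ z' ∈ domain k P, m ≤ relaxation P t z')
    (hj : relaxation P t z < m + j * (1 / 10001) ^ 2) :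
    Runs (newtonProg inv B) s (j * (140000 * (C * (kktSize n d : ℝ) ^ ω)))
      (fun s' => ∃ z' ∈ domain k P, Holds B P t z' baseArrays s' ∧ decrement P t z' ≤ 1 / 100) := by
  have hsq : (kktSize n d : ℝ) ^ 2 ≤ C * (kktSize n d : ℝ) ^ ω := hinv.sq_le one_le_kktSize
  have hone : (1 : ℝ) ≤ (kktSize n d : ℝ) ^ 2 := by exact_mod_cast one_le_kktSize_sq
  refine (runs_while (T := 130000 * (C * (kktSize n d : ℝ) ^ ω)) (by linarith)
    (I := fun j s' => ∃ z' ∈ domain k P, HoldsNewton B P t z' s' ∧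
      relaxation P t z' < m + j * (1 / 10001) ^ 2) ?_ ?_ j ⟨z, hz, h, hj⟩).mono ?_ ?_
  · rintro s' ⟨z', hz', -, hlt⟩
    have := hm z' hz'
    norm_num at hlt
    linarith
  · rintro j s' ⟨z', hz', h', hlt⟩ htest
    obtain ⟨hmem, hle⟩ := newtonPoint_mem_domain_and_relaxation_le hd hz' h' htest
    refine ((runs_updateProg hB1 h').seq fun s₁ h₁ =>
      runs_computeProg hinv hB hB1 hd hmem h₁).mono (by linarith) fun s₂ h₂ => ⟨_, hmem, h₂, ?_⟩
    push_cast at hlt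
    linarith
  · have hcost : ((continueTest B).cost : ℝ) ≤ 100 := by norm_num [continueTest, Test.cost]
    exact mul_le_mul_of_nonneg_left (by linarith) j.cast_nonneg
  · rintro s' ⟨htest, _, z', hz', h', -⟩
    exact ⟨z', hz', h'.holds, decrement_le_of_not_holds_continueTest hd hz' h' htest⟩

end NewtonIteration

section MainProgram

variable {n d k : ℕ} {P : Fin n → EuclideanSpace ℝ (Fin d)} {t : ℝ} {z : Point n d} {B : ℕ}
  {J : Set RealArray} {A R : Set ℕ} {s s' : Memory} {inv : Prog} {C ω : ℝ}

theorem HoldsInput.of_agreesOff (h : HoldsInput s k P) (hs : AgreesOff A R s s') (hA : 0 ∉ A)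
    (hR : 0 ∉ R) : HoldsInput s' k P := by
  simpa only [HoldsInput, hs.nat 0 hA, hs.real 0 hR] using h

/-- Reads the sizes. -/
def sizeProg (B : ℕ) : Prog :=
  .seq (.setNat (NatArray.numPoints.name B) (.lit 0) (.get 0 (.lit 0)))
    (.seq (.setNat (NatArray.dim.name B) (.lit 0) (.get 0 (.lit 1)))
      (.setNat (NatArray.order.name B) (.lit 0) (.add (.mul (natVar B .dim) (natVar B .dim))
        (.add (natVar B .numPoints) (.add (natVar B .numPoints) (.lit (1 + 1)))))))

theorem runs_sizeProg (hB : 0 < B) (h : HoldsInput s k P) :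
    Runs (sizeProg B) s 30 (fun s' => Sizes B n d s' ∧ AgreesOff (Set.Ici B) ∅ s s') := by
  have hzero (v : NatArray) : 0 ≠ v.name B := (hB.trans_le (v.le_name B)).ne
  refine ((runs_setNat s _ _ _).seq fun s₁ h₁ => (runs_setNat s₁ _ _ _).seq fun s₂ h₂ =>
    (runs_setNat s₂ _ _ _).imp fun s₃ h₃ => ?_).mono (by norm_num) fun _ h => h
  subst h₁ h₂ h₃
  refine ⟨?_, (((AgreesOff.refl _ _ s).writeNat (NatArray.le_name B _) _ _).writeNat
    (NatArray.le_name B _) _ _).writeNat (NatArray.le_name B _) _ _⟩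
  constructor <;> simp [writeNat_nat_of_ne, hzero, h.1, h.2.1]

theorem Sizes.runs_divTable (h : Sizes B n d s) {u v : NatArray}
    (hnodup : [NatArray.numPoints, .dim, .order, .outer, .inner, u, v].Nodup) {N D : NExp}
    {K m : ℕ} (hN : ∀ s', Sizes B n d s' → N.eval s' = K)
    (hD : ∀ s', Sizes B n d s' → D.eval s' = m)
    (hcost : N.cost + 3 * D.cost ≤ 20) (hsize : (K + 1) * (m + 1) ≤ 4 * kktSize n d ^ 2) :
    Runs (divTable (NatArray.outer.name B) (NatArray.inner.name B) (u.name B) (v.name B) N D) s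
      (320 * (kktSize n d : ℝ) ^ 2)
      (fun s' => Sizes B n d s' ∧
        AgreesOff {NatArray.outer.name B, NatArray.inner.name B, u.name B, v.name B} ∅ s s' ∧
        HoldsDivTable (u.name B) (v.name B) m (K * m) s') := by
  have hsizes {s'} (hs' : AgreesOff {NatArray.outer.name B, NatArray.inner.name B, u.name B,
      v.name B} ∅ s s') : Sizes B n d s' := h.of_agreesOff hs' <| by
    simp at hnodup ⊢
    tauto
  refine (KSM.runs_divTable (by simp at hnodup ⊢; tauto) (fun s' hs' => hN s' (hsizes hs'))
    fun s' hs' => hD s' (hsizes hs')).mono ?_ fun s' ⟨hs', htable⟩ => ⟨hsizes hs', hs', htable⟩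
  have hsize' : ((K : ℝ) + 1) * (m + 1) ≤ 4 * (kktSize n d : ℝ) ^ 2 := by exact_mod_cast hsize
  have hcost' : (N.cost : ℝ) + 3 * D.cost ≤ 20 := by exact_mod_cast hcost
  calc ((K : ℝ) + 1) * (m + 1) * (N.cost + 3 * D.cost + 60)
      ≤ 4 * (kktSize n d : ℝ) ^ 2 * (20 + 60) := by gcongr
    _ = 320 * (kktSize n d : ℝ) ^ 2 := by ring

/-- Reads the sizes and fills the tables. -/
def tableProg (B : ℕ) : Prog :=
  .seq (sizeProg B)
    (.seq (divTable (NatArray.outer.name B) (NatArray.inner.name B) (NatArray.hi.name B)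
        (NatArray.lo.name B) (.add (natVar B .numPoints) (natVar B .dim)) (natVar B .dim))
      (divTable (NatArray.outer.name B) (NatArray.inner.name B) (NatArray.kktHi.name B)
        (NatArray.kktLo.name B) (natVar B .order) (natVar B .order)))

theorem runs_tableProg (hB : 0 < B) (h : HoldsInput s k P) :
    Runs (tableProg B) s (1000 * (kktSize n d : ℝ) ^ 2)
      (fun s' => Tables B n d s' ∧ HoldsInput s' k P) := by
  have hzero (v : NatArray) : 0 ≠ v.name B := (hB.trans_le (v.le_name B)).ne
  have hone : (1 : ℝ) ≤ (kktSize n d : ℝ) ^ 2 := by exact_mod_cast one_le_kktSize_sq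
  refine ((runs_sizeProg hB h).seq fun s₁ ⟨hsizes₁, hs₁⟩ =>
    (hsizes₁.runs_divTable (K := n + d) (m := d) (by simp)
      (fun s' hs' => by simp [hs'.numPoints, hs'.dim]) (fun s' hs' => by simp [hs'.dim])
      (by norm_num) ?_).seq fun s₂ ⟨hsizes₂, hs₂, htable⟩ =>
    (hsizes₂.runs_divTable (K := kktSize n d) (m := kktSize n d) (by simp)
      (fun s' hs' => by simp [hs'.order]) (fun s' hs' => by simp [hs'.order])
      (by norm_num) ?_).imp fun s₃ ⟨hsizes₃, hs₃, hkktTable⟩ =>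
    ⟨⟨hsizes₃, htable.congr (hs₃.nat _ (by simp)) (hs₃.nat _ (by simp)), hkktTable⟩,
      ((h.of_agreesOff hs₁ (by simpa using hB.ne') (by simp)).of_agreesOff hs₂ (by simp [hzero])
        (by simp)).of_agreesOff hs₃ (by simp [hzero]) (by simp)⟩).mono (by linarith) fun _ h => h
  · rw [kktSize]
    nlinarith [Nat.le_mul_self d, Nat.mul_le_mul_left n (Nat.le_mul_self d)]
  · nlinarith [one_le_kktSize (n := n) (d := d)]

/-- Copies the points and computes the identity matrix and `X0`. -/
def matrixProg (B : ℕ) : Prog :=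
  let dimSq : NExp := .mul (natVar B .dim) (natVar B .dim)
  .seq
    (fill (NatArray.outer.name B) (RealArray.points.name B)
      (.mul (natVar B .numPoints) (natVar B .dim)) (.ret (.get 0 (natVar B .outer))))
    (.seq
      (fill (NatArray.outer.name B) (RealArray.identity.name B) dimSq
        (.ifEq (natAt B .hi (natVar B .outer)) (natAt B .lo (natVar B .outer)) (.ret (.lit 1))
          (.ret (.lit 0))))
      (fill (NatArray.outer.name B) (RealArray.matrix.name B) dimSq
        (.ret (.mul (.div (.sub (.ofNat (natVar B .dim)) (.ofNat (.get 0 (.lit 2))))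
          (.ofNat (natVar B .dim))) (realAt B .identity (natVar B .outer))))))

theorem runs_matrixProg (hB : 0 < B) (htables : Tables B n d s) (h : HoldsInput s k P) :
    Runs (matrixProg B) s (30000 * (kktSize n d : ℝ) ^ 2)
      (Holds B P t (startPoint k P) {.matrix, .identity, .points}) := by
  have hsize : d * d ≤ kktSize n d := Nat.le_add_right _ _
  have hpoints : n * d ≤ kktSize n d ^ 2 := by
    rw [kktSize]
    nlinarith [Nat.le_mul_self d, Nat.mul_le_mul_left n (Nat.le_mul_self d)]
  have hcounters : 0 ∉ counters B := by
    simp [counters, (hB.trans_le (NatArray.le_name B _)).ne]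
  have hreal (a : RealArray) : 0 ∉ ({a.name B} : Set ℕ) := by
    simp [(hB.trans_le (a.le_name B)).ne]
  have h₀ : Holds B P t (startPoint k P) ∅ s := ⟨htables, by simp⟩
  refine ((htables.runs_fill (rowMajor n d) (e := .ret (.get 0 (natVar B .outer)))
    (N := .mul (natVar B .numPoints) (natVar B .dim)) (by simp) hpoints
    (fun s' hs' => by simp [hs'.numPoints, hs'.dim]) (G := fun p => P p.1 p.2)
    fun p s' hs' ho _ => ?_).seq (T' := 20000 * (kktSize n d : ℝ) ^ 2)
    fun s₁ ⟨hs₁, hP⟩ => ?_).mono (le_of_eq (by ring)) fun _ h => h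
  · simp [ho, coe_rowMajor, hs'.real 0 (hreal _), h.2.2.2]
  have h₁ : Holds B P t (startPoint k P) {.points} s₁ :=
    (h₀.insert hs₁ fun i a => by simpa only [coe_rowMajor] using hP (i, a)).mono (by simp)
  have hinput₁ := h.of_agreesOff hs₁ hcounters (hreal _)
  have hidentity := h₁.tables.runs_fill (rowMajor d d) (b := RealArray.identity.name B)
    (e := .ifEq (natAt B .hi (natVar B .outer)) (natAt B .lo (natVar B .outer)) (.ret (.lit 1))
      (.ret (.lit 0))) (N := .mul (natVar B .dim) (natVar B .dim))
    (by simp [CExp.ifEq]) (by nlinarith [hsize]) (fun s' hs' => by simp [hs'.dim])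
    (G := fun p => (1 : Matrix (Fin d) (Fin d) ℝ) p.1 p.2) fun p s' hs' ho _ => by
      have hhi := (h₁.sdiff hs').tables.hi_lo (by omega) p.1 p.2
      simp [CExp.eval_ifEq, ho, coe_rowMajor, hhi, Matrix.one_apply, Fin.ext_iff]
  refine (hidentity.seq (T' := 10000 * (kktSize n d : ℝ) ^ 2) fun s₂ ⟨hs₂, hone⟩ => ?_).mono
    (le_of_eq (by ring)) fun _ h => h
  have h₂ := h₁.insert hs₂ fun a b => by simpa only [coe_rowMajor] using hone (a, b)
  have hinput₂ := hinput₁.of_agreesOff hs₂ hcounters (hreal _)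
  refine (h₂.tables.runs_fill (rowMajor d d) (by simp) (by nlinarith [hsize])
    (fun s' hs' => by simp [hs'.dim]) (G := fun p => X0 d k p.1 p.2)
    fun p s' hs' ho _ => ?_).imp fun s₃ ⟨hs₃, hX⟩ => h₂.insert hs₃ fun a b => ?_
  · have h' := h₂.sdiff hs'
    have hone' := h'.content .identity (by simp) p.1 p.2
    have hinput := hinput₂.of_agreesOff hs' hcounters (hreal _)
    simp [ho, coe_rowMajor, h'.tables.dim, hone', hinput.2.2.1, X0]
  · simpa only [coe_rowMajor, startPoint, mkPoint_X] using hX (a, b)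

/-- Computes `t0` and the slacks of `startPoint`. -/
def scaleProg (B : ℕ) : Prog :=
  .seq
    (fillSum (NatArray.outer.name B) (NatArray.inner.name B) (RealArray.parameter.name B) (.lit 1)
      (natVar B .numPoints) (.sqrt (.add (realAt B .sqNorms (natVar B .inner)) .euler)))
    (.seq
      (.setReal (RealArray.parameter.name B) (.lit 0)
        (.div (.mul (.lit 2) (.ofNat (natVar B .numPoints))) (realAt B .parameter (.lit 0))))
      (fill (NatArray.outer.name B) (RealArray.slack.name B) (natVar B .numPoints)
        (.ret (.add (.sqrt (realAt B .sqNorms (natVar B .outer)))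
          (.div (.lit 2) (realAt B .parameter (.lit 0)))))))

theorem runs_scaleProg (h : Holds B P (t0 k P) (startPoint k P) J s) (hsq : .sqNorms ∈ J) :
    Runs (scaleProg B) s (30000 * (kktSize n d : ℝ) ^ 2)
      (Holds B P (t0 k P) (startPoint k P) (insert .slack (insert .parameter J))) := by
  have hX : (startPoint k P).X = X0 d k := mkPoint_X _ _
  have hnorm (i : Fin n) : s.real (RealArray.sqNorms.name B) i = ‖applyTo (X0 d k) (P i)‖ ^ 2 := by
    rw [← hX]
    exact h.content .sqNorms hsq i
  have hsum := h.tables.runs_fillSum (.refl (Fin 1)) (b := RealArray.parameter.name B)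
    (N := .lit 1) (L := natVar B .numPoints)
    (e := .sqrt (.add (realAt B .sqNorms (natVar B .inner)) .euler)) (by simp)
    (by rw [kktSize]; nlinarith) (fun _ _ => by simp) (fun s' hs' => by simp [hs'.numPoints])
    (F := fun _ i => y0 k P i) fun _ i s' hs' _ hi => by
      simp [hi, hs'.real _ (by simp : RealArray.sqNorms.name B ∉ {RealArray.parameter.name B}),
        hnorm, y0]
  have hone : (1 : ℝ) ≤ (kktSize n d : ℝ) ^ 2 := by exact_mod_cast one_le_kktSize_sq
  refine (hsum.seq fun s₁ ⟨hs₁, hparam⟩ => (runs_setReal s₁ _ _ _).seq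
    (T' := 10000 * (kktSize n d : ℝ) ^ 2) fun s₂ hs₂ => ?_).mono ?_ fun _ h => h
  · have hsum₁ : s₁.real (RealArray.parameter.name B) 0 = ∑ i, y0 k P i := hparam 0
    have h₂ := h.insert (s' := s₂) (by rw [hs₂]; exact hs₁.writeReal rfl _ _) <| by
      simp [hs₂, Content, hsum₁, (h.sdiff hs₁).tables.numPoints, t0]
    refine (h₂.tables.runs_fill (.refl (Fin n)) (by simp) (by rw [kktSize]; nlinarith)
      (fun s' hs' => by simp [hs'.numPoints]) (G := fun i => (startPoint k P).y i)
      fun i s' hs' ho _ => ?_).imp fun s₃ ⟨hs₃, hy⟩ => h₂.insert hs₃ hy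
    have h' := h₂.sdiff hs'
    have hparam' : s'.real (RealArray.parameter.name B) 0 = t0 k P :=
      h'.content .parameter (by simp)
    have hnorm' := h'.content .sqNorms (by simp [hsq]) i
    simp [ho, hparam', hnorm', startPoint, Real.sqrt_sq (norm_nonneg _)]
  · generalize (kktSize n d : ℝ) ^ 2 = q at hone ⊢
    norm_num
    linarith

/-- Moves to `startPoint`. -/
def initProg (B : ℕ) : Prog :=
  .seq (tableProg B) (.seq (matrixProg B) (.seq (imageProg B) (.seq (normProg B) (scaleProg B))))

theorem runs_initProg (hB : 0 < B) (h : HoldsInput s k P) :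
    Runs (initProg B) s (100000 * (kktSize n d : ℝ) ^ 2)
      (Holds B P (t0 k P) (startPoint k P) baseArrays) :=
  ((runs_tableProg hB h).seq fun _ h₁ => (runs_matrixProg hB h₁.1 h₁.2).seq fun _ h₂ =>
    (runs_imageProg h₂ (by simp) (by simp)).seq fun _ h₃ =>
    (runs_normProg h₃ (by simp)).seq fun _ h₄ => runs_scaleProg h₄ (by simp)).mono
    (by linarith [sq_nonneg (kktSize n d : ℝ)]) fun _ h => h.mono fun a ha => by
      rcases ha with rfl | rfl | rfl | rfl | rfl <;> simp

/-- Copies the current point to the output arrays. -/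
def outputProg (B : ℕ) : Prog :=
  .seq
    (fill (NatArray.outer.name B) 1 (.mul (natVar B .dim) (natVar B .dim))
      (.ret (realAt B .matrix (natVar B .outer))))
    (fill (NatArray.outer.name B) 2 (natVar B .numPoints)
      (.ret (realAt B .slack (natVar B .outer))))

theorem runs_outputProg (hB : 2 < B) (h : Holds B P t z {.matrix, .slack} s) :
    Runs (outputProg B) s (20000 * (kktSize n d : ℝ) ^ 2) (fun s' => HoldsOutput s' z) := by
  have hsize : d * d ≤ kktSize n d := Nat.le_add_right _ _
  have hmatrix := h.tables.runs_fill (rowMajor d d) (b := 1)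
    (e := .ret (realAt B .matrix (natVar B .outer))) (N := .mul (natVar B .dim) (natVar B .dim))
    (by simp) (by nlinarith [hsize]) (fun s' hs' => by simp [hs'.dim])
    (G := fun p => z.X p.1 p.2) fun p s' hs' ho _ => by
      have hX := h.content .matrix (by simp) p.1 p.2
      rw [← hs'.real _ (by simpa using (by have := RealArray.le_name B .matrix; omega))] at hX
      simpa [ho, coe_rowMajor] using hX
  refine (hmatrix.seq (T' := 10000 * (kktSize n d : ℝ) ^ 2) fun s₁ ⟨hs₁, hX⟩ => ?_).mono
    (le_of_eq (by ring)) fun _ h => h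
  have h₁ : Holds B P t z {.matrix, .slack} s₁ :=
    h.of_agreesOff (hs₁.mono Set.subset_union_left le_rfl) fun a ha =>
      ⟨ha, by simpa using (by have := a.le_name B; omega)⟩
  refine (h₁.tables.runs_fill (.refl (Fin n)) (by simp) (by rw [kktSize]; nlinarith)
    (fun s' hs' => by simp [hs'.numPoints]) (G := z.y) fun i s' hs' ho _ => ?_).imp
    fun s₂ ⟨hs₂, hy⟩ => ⟨fun a b => ?_, hy⟩
  · have hy := h₁.content .slack (by simp) i
    rw [← hs'.real _ (by simpa using (by have := RealArray.le_name B .slack; omega))] at hy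
    simpa [ho] using hy
  · rw [hs₂.real 1 (by simp)]
    simpa only [coe_rowMajor] using hX (a, b)

/-- Computes a point with Newton decrement at most `1 / 100` by damped Newton steps, starting from
`startPoint`; the program `inv` inverts the matrices. -/
def mainProg (inv : Prog) : Prog :=
  let B := inv.bound + 3
  .seq (initProg B) (.seq (computeProg inv B) (.seq (newtonProg inv B) (outputProg B)))

theorem exists_nat_lt_mul {x ε : ℝ} (hx : 0 ≤ x) (hε : 0 < ε) :
    ∃ j : ℕ, x < j * ε ∧ j ≤ x / ε + 1 := by
  refine ⟨⌊x / ε⌋₊ + 1, (div_lt_iff₀ hε).1 (by exact_mod_cast Nat.lt_floor_add_one (x / ε)), ?_⟩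
  push_cast
  gcongr
  exact Nat.floor_le (by positivity)

theorem kktSize_rpow_le (hω : 0 ≤ ω) (hn : n ≠ 0) (hd : d ≠ 0) :
    (kktSize n d : ℝ) ^ ω ≤ 3 ^ ω * ((n : ℝ) + (d : ℝ) ^ 2) ^ ω := by
  rw [← Real.mul_rpow (by norm_num) (by positivity)]
  refine Real.rpow_le_rpow (by positivity) ?_ hω
  have : kktSize n d ≤ 3 * (n + d ^ 2) := by
    rw [kktSize]
    nlinarith [Nat.pos_of_ne_zero hn, Nat.pos_of_ne_zero hd]
  exact_mod_cast this

theorem runs_mainProg_iterations (hinv : Inverts inv C ω) (hn : 1 ≤ n) (hk : 1 ≤ k) (hkd : k < d)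
    (h : HoldsInput s k P) {j : ℕ} (hj : 2 * n + 2 * d * Real.log d < j * (1 / 10001 : ℝ) ^ 2) :
    Runs (mainProg inv) s ((j + 2) * (140000 * (C * (kktSize n d : ℝ) ^ ω)))
      (fun s' => ∃ z : Point n d, HoldsOutput s' z ∧ z ∈ domain k P ∧
        decrement P (t0 k P) z ≤ 1 / 100) := by
  have hd : d ≠ 0 := by omega
  have hB : inv.bound ≤ inv.bound + 3 := Nat.le_add_right _ _
  have hmem := startPoint_mem_domain (P := P) hn hk hkd
  have hstart := relaxation_startPoint_le (P := P) hn hk hkd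
  have hsq : (kktSize n d : ℝ) ^ 2 ≤ C * (kktSize n d : ℝ) ^ ω := hinv.sq_le one_le_kktSize
  refine ((runs_initProg (by omega) h).seq fun s₁ h₁ =>
    (runs_computeProg hinv hB (by omega) hd hmem h₁).seq fun s₂ h₂ =>
    (runs_newtonProg hinv hB (by omega) hd hmem h₂ (j := j)
      (fun z hz => two_mul_add_le_relaxation (t0_pos hn) hz) (by linarith)).seq
    fun s₃ ⟨z, hz, h₃, hdec⟩ => (runs_outputProg (by omega)
      (h₃.mono fun a ha => by rcases ha with rfl | rfl <;> simp)).imp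
      fun s₄ h₄ => ⟨z, h₄, hz, hdec⟩).mono ?_ fun _ h => h
  linarith [(sq_nonneg (kktSize n d : ℝ)).trans hsq]

theorem runs_mainProg (hinv : Inverts inv C ω) (hn : 1 ≤ n) (hk : 1 ≤ k) (hkd : k < d)
    (h : HoldsInput s k P) :
    Runs (mainProg inv) s (420000 * 10001 ^ 2 * C * 3 ^ ω *
        (((n : ℝ) + (d : ℝ) ^ 2) ^ ω * ((n : ℝ) + (d : ℝ) * Real.log d)))
      (fun s' => ∃ z : Point n d, HoldsOutput s' z ∧ z ∈ domain k P ∧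
        decrement P (t0 k P) z ≤ 1 / 100) := by
  have hC := hinv.nonneg
  have hlog : 0 ≤ (d : ℝ) * Real.log d := mul_nonneg d.cast_nonneg (Real.log_natCast_nonneg d)
  have hone : (1 : ℝ) ≤ n + d * Real.log d := by linarith [(by exact_mod_cast hn : (1 : ℝ) ≤ n)]
  obtain ⟨j, hlt, hle⟩ := exists_nat_lt_mul (x := 2 * n + 2 * d * Real.log d)
    (ε := (1 / 10001 : ℝ) ^ 2) (by linarith) (by norm_num)
  refine (runs_mainProg_iterations hinv hn hk hkd h hlt).mono ?_ fun _ h => h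
  calc ((j : ℝ) + 2) * (140000 * (C * (kktSize n d : ℝ) ^ ω))
      ≤ (3 * 10001 ^ 2 * (n + d * Real.log d)) *
          (140000 * (C * (3 ^ ω * ((n : ℝ) + (d : ℝ) ^ 2) ^ ω))) := by
        gcongr
        · norm_num at hle ⊢
          linarith
        · exact kktSize_rpow_le (by linarith [hinv.two_le]) (by omega) (by omega)
    _ = _ := by ring

end MainProgram

end Programs

end KSM

end

theorem mainTheorem4 (ω : ℝ) (hω : KSM.InversionTime ω) :
    (∀ (n d k : ℕ), 1 ≤ n → 1 ≤ k → k < d → ∀ P : Fin n → EuclideanSpace ℝ (Fin d),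
      KSM.initialPoint k P ∈ KSM.domain k P ∧
      BddBelow (KSM.relaxation P (KSM.t0 k P) '' KSM.domain k P) ∧
      (1 < KSM.t0 k P →
        KSM.relaxation P (KSM.t0 k P) (KSM.initialPoint k P)
            - sInf (KSM.relaxation P (KSM.t0 k P) '' KSM.domain k P)
          ≤ 2 * (n : ℝ) + 4 * (d : ℝ) * Real.log d)) ∧
    ∃ (prog : KSM.Prog) (C : ℝ),
      ∀ (n d k : ℕ), 1 ≤ n → 1 ≤ k → k < d → ∀ P : Fin n → EuclideanSpace ℝ (Fin d),
        ∀ s : KSM.Memory, KSM.HoldsInput s k P →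
          ∃ (s' : KSM.Memory) (τ : ℕ) (z : KSM.Point n d),
            KSM.Exec prog s s' τ ∧
            (τ : ℝ) ≤ C * (((n : ℝ) + (d : ℝ) ^ 2) ^ ω * ((n : ℝ) + (d : ℝ) * Real.log d)) ∧
            KSM.HoldsOutput s' z ∧
            z ∈ KSM.domain k P ∧
            KSM.decrement P (KSM.t0 k P) z ≤ 1 / 100 := by
  obtain ⟨inv, C, hinv⟩ := hω
  refine ⟨fun n d k hn hk hkd P => ⟨KSM.initialPoint_mem_domain hk hkd, ?_,
    KSM.relaxation_initialPoint_sub_sInf_le hn hk hkd⟩,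
    KSM.mainProg inv, 420000 * 10001 ^ 2 * C * 3 ^ ω, ?_⟩
  · refine ⟨2 * n + 2 * n * Real.log (KSM.t0 k P / 2), ?_⟩
    rintro _ ⟨z, hz, rfl⟩
    exact KSM.two_mul_add_le_relaxation (KSM.t0_pos hn) hz
  · intro n d k hn hk hkd P s hs
    obtain ⟨s', τ, hexec, hτ, z, hout, hz, hdec⟩ := KSM.runs_mainProg hinv hn hk hkd hs
    exact ⟨s', τ, z, hexec, hτ, hout, hz, hdec⟩
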